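/- Let $\alpha>0$ and $r>1+\alpha$ be real numbers. Let $F$ be a $C^r$ Anosov diffeomorphism of $\mathbb T^2=\mathbb R^2/\mathbb Z^2$: there are a $DF$-invariant splitting $T_x\mathbb T^2=E^s(x)\oplus E^u(x)$ into nontrivial subspaces and constants $c>0$, $\lambda>1$ such that, for all $n\ge 0$ and $x\in\mathbb T^2$, $\|D_xF^nv\|\le c\lambda^{-n}\|v\|$ for $v\in E^s(x)$ and $\|D_xF^nv\|\ge c^{-1}\lambda^{n}\|v\|$ for $v\in E^u(x)$. Let $V\in C^{1+\alpha}(\mathbb T^2,\mathbb R^2)$ be a vector field such that $\|V\|\in C^r(\mathbb T^2,\mathbb R)$ and, for all $x$, $V(x)\neq 0$ and $V(x)\in E^s(x)$, and let $(\phi_t)_{t\in\mathbb R}$ be the flow on $\mathbb T^2$ generated by $V$. Then there exist constants $C,\beta>0$ such that, for every $x\in\mathbb T^2$, each $\phi_s$, $s\in\mathbb R$, is differentiable at $x$ with invertible derivative $\xi(s):=D_x\phi_s\in GL(2,\mathbb R)$ and, for every $t>0$, $\xi$ is of class $C^{r-1}$ on $(0,t)$ with \[ \|\xi\|_{C^{r-1}((0,t),GL(2,\mathbb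 R))}\le C\max\{1,t\}^{\beta}. \] Here, for real $\rho\ge 0$ and $k=\lfloor\rho\rfloor$, $\|\xi\|_{C^\rho((0,t))}=\sum_{j=0}^{k}2^{k-j}\sup_{(0,t)}\|\xi^{(j)}\|$, to which, if $\rho$ is not an integer, the Hölder seminorm $\sup_{s\ne s'}\|\xi^{(k)}(s)-\xi^{(k)}(s')\|/|s-s'|^{\rho-k}$ over $s,s'\in(0,t)$ is added. Likewise, $C^\rho$ with non-integer $\rho$ means $C^{k}$ with $(\rho-k)$-Hölder derivatives of order $k$. -/

import Mathlib

open Set Filter Topology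
open scoped ENNReal

noncomputable section

/-- The Euclidean plane `ℝ²`, the tangent space of the torus at every point. -/
abbrev Plane : Type := EuclideanSpace ℝ (Fin 2)

/-- The torus `𝕋² = ℝ² / ℤ²`. -/
abbrev Torus2 : Type := UnitAddTorus (Fin 2)

/-- The covering projection `ℝ² → 𝕋²`. -/
def torusProj (x : Plane) : Torus2 := fun i => (x i : UnitAddCircle)

/-- `A` is the derivative `D_x f` of `f : 𝕋² → 𝕋²` at `x`: some local lift of `f` to the plane
near a preimage of `x` has derivative `A` there. -/
def HasTorusFDerivAt (f : Torus2 → Torus2) (A : Plane →L[ℝ] Plane) (x : Torus2) : Prop :=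
  ∃ (p : Plane) (g : Plane → Plane), torusProj p = x ∧
    (∀ᶠ y in 𝓝 p, torusProj (g y) = f (torusProj y)) ∧ HasFDerivAt g A p

/-- `f` is of class `C^r` for a real number `r ≥ 0`, with uniform modulus: `f` is `⌊r⌋` times
continuously differentiable and its derivative of order `⌊r⌋` is Hölder continuous of exponent
`r - ⌊r⌋`. If `r` is an integer, the second condition only says that the top derivative has bounded
oscillation; it then holds automatically for `ℤ²`-periodic `C^r` functions and, if `r ≥ 1`, for
lifts of `C^r` maps of the torus. -/
def IsHolderClass {E G : Type*} [NormedAddCommGroup E] [NormedSpace ℝ E]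
    [NormedAddCommGroup G] [NormedSpace ℝ G] (r : ℝ) (f : E → G) : Prop :=
  ContDiff ℝ (⌊r⌋₊ : ℕ) f ∧
    ∃ K : ℝ, ∀ x y : E,
      ‖iteratedFDeriv ℝ ⌊r⌋₊ f x - iteratedFDeriv ℝ ⌊r⌋₊ f y‖ ≤ K * ‖x - y‖ ^ (r - (⌊r⌋₊ : ℝ))

/-- A function on the torus with values in a normed space is of class `C^r`. -/
def IsTorusHolderFun {G : Type*} [NormedAddCommGroup G] [NormedSpace ℝ G]
    (r : ℝ) (f : Torus2 → G) : Prop :=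
  IsHolderClass r (fun p : Plane => f (torusProj p))

/-- A self-map of the torus is of class `C^r`: it has a lift to the plane of class `C^r`. -/
def IsTorusHolderMap (r : ℝ) (f : Torus2 → Torus2) : Prop :=
  ∃ g : Plane → Plane, (∀ p, torusProj (g p) = f (torusProj p)) ∧ IsHolderClass r g

/-- `F` is a `C^r` Anosov diffeomorphism of the torus with stable distribution `Es` and unstable
distribution `Eu`. -/
structure IsAnosov (r : ℝ) (F : Torus2 ≃ Torus2) (Es Eu : Torus2 → Submodule ℝ Plane) : Prop where
  smooth : IsTorusHolderMap r F
  smooth_symm : IsTorusHolderMap r F.symm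
  stable_ne_bot : ∀ x, Es x ≠ ⊥
  unstable_ne_bot : ∀ x, Eu x ≠ ⊥
  isCompl : ∀ x, IsCompl (Es x) (Eu x)
  map_stable : ∀ x A, HasTorusFDerivAt F A x → (Es x).map (A : Plane →ₗ[ℝ] Plane) = Es (F x)
  map_unstable : ∀ x A, HasTorusFDerivAt F A x → (Eu x).map (A : Plane →ₗ[ℝ] Plane) = Eu (F x)
  hyperbolic : ∃ C lam : ℝ, 0 < C ∧ 1 < lam ∧
    ∀ (n : ℕ) (x : Torus2) (A : Plane →L[ℝ] Plane), HasTorusFDerivAt (F^[n]) A x →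
      (∀ v ∈ Es x, ‖A v‖ ≤ C * lam⁻¹ ^ n * ‖v‖) ∧
      (∀ v ∈ Eu x, C⁻¹ * lam ^ n * ‖v‖ ≤ ‖A v‖)

/-- The flow `φ` on the torus is generated by the vector field `V`: every orbit, lifted to the
plane, solves the differential equation `γ' = V(γ)`. -/
def IsFlowGeneratedBy (φ : Flow ℝ Torus2) (V : Torus2 → Plane) : Prop :=
  ∀ x, ∃ γ : ℝ → Plane, ∀ t, torusProj (γ t) = φ t x ∧ HasDerivAt γ (V (φ t x)) t

/-- The `C^ρ` norm on a set `U ⊆ ℝ`, with values in `[0, ∞]`: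
`∑_{j ≤ ⌊ρ⌋} 2^(⌊ρ⌋ - j) sup_U ‖f^(j)‖`, plus, if `ρ` is not an integer, the Hölder seminorm of
exponent `ρ - ⌊ρ⌋` of the derivative of order `⌊ρ⌋`. -/
def holderNormOn {E : Type*} [NormedAddCommGroup E] [NormedSpace ℝ E]
    (ρ : ℝ) (U : Set ℝ) (f : ℝ → E) : ℝ≥0∞ :=
  (∑ j ∈ Finset.range (⌊ρ⌋₊ + 1),
      (2 : ℝ≥0∞) ^ (⌊ρ⌋₊ - j) * ⨆ s ∈ U, ‖iteratedDerivWithin j f U s‖ₑ) +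
    open scoped Classical in
    if ρ = (⌊ρ⌋₊ : ℝ) then 0 else
      ⨆ s ∈ U, ⨆ s' ∈ U \ {s},
        ‖iteratedDerivWithin ⌊ρ⌋₊ f U s - iteratedDerivWithin ⌊ρ⌋₊ f U s'‖ₑ /
          ENNReal.ofReal (|s - s'| ^ (ρ - (⌊ρ⌋₊ : ℝ)))

end

/-!
Lift everything to the plane: `W` is the stable field, `Φ` its flow and `T` the Anosov map, whose
derivative multiplies `W` by the *speed factor* and the direction transverse to `W` by the
*transverse factor*. In the frame `W, JW`, with `J` the right-angle rotation, the derivative of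
`Φ s` is triangular; its entries are integrals along the orbits of the divergence of `W` and of its
*shear*, and the latter involves the *bending* `ω(W, DW W)` of the orbits.

Although `W` is only `C^1`, it is as regular along its own orbits as `‖W‖` is on the plane.
Differentiating `ω(W ∘ T, DT W) = 0` along `W` gives a cohomological equation for the bending, with
a cocycle over `T` that contracts because `T` expands transversally to `W`. Its solution is the sum
of a geometrically convergent series of functions regular along the orbits. The divergence solves
another such equation.

As `T` conjugates `Φ` to itself with time slowed down, the logarithm of the Jacobian of `Φ` over a
time interval of length `t` differs by a bounded amount from the one over an interval of length at
most `t / 2`. Iterating `log t` times shows that the Jacobian grows at most polynomially.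
-/

section HolderCurve

variable {E F G : Type*} [NormedAddCommGroup E] [NormedSpace ℝ E] [NormedAddCommGroup F]
  [NormedSpace ℝ F] [NormedAddCommGroup G] [NormedSpace ℝ G]

/-- `f` is a curve of class `C^(k+η)` at the points of `I`, with the single constant `B` bounding
its derivatives up to order `k` and the `η`-Hölder seminorm of the last one. Continuity is a
separate requirement because the Hölder condition does not imply it for `η = 0`. -/
def IsHolderCurve (η : ℝ) : ℕ → ℝ → Set ℝ → (ℝ → E) → Prop
  | 0, B, I, f => ContinuousOn f I ∧ (∀ s ∈ I, ‖f s‖ ≤ B) ∧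
      ∀ s ∈ I, ∀ s' ∈ I, ‖f s - f s'‖ ≤ B * |s - s'| ^ η
  | k + 1, B, I, f => (∀ s ∈ I, ‖f s‖ ≤ B) ∧
      ∃ f' : ℝ → E, (∀ s ∈ I, HasDerivAt f (f' s) s) ∧ IsHolderCurve η k B I f'

theorem le_mul_rpow_of_le_of_le_mul {η x L d : ℝ} (hη : η ∈ Icc (0 : ℝ) 1) (hL : 0 ≤ L)
    (hd : 0 ≤ d) (hxL : x ≤ L) (hxLd : x ≤ L * d) : x ≤ L * d ^ η := by
  rcases le_total d 1 with h | h
  · exact hxLd.trans (by gcongr; exact Real.self_le_rpow_of_le_one hd h hη.2)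
  · exact hxL.trans (le_mul_of_one_le_right hL (Real.one_le_rpow h hη.1))

namespace IsHolderCurve

variable {η : ℝ} {k : ℕ} {B B' : ℝ} {I I' : Set ℝ} {f : ℝ → E} {g : ℝ → F}

theorem norm_le (h : IsHolderCurve η k B I f) : ∀ s ∈ I, ‖f s‖ ≤ B := by
  cases k with
  | zero => exact h.2.1
  | succ k => exact h.1

theorem continuousOn (h : IsHolderCurve η k B I f) : ContinuousOn f I := by
  cases k with
  | zero => exact h.1
  | succ k =>
    obtain ⟨-, f', hf', -⟩ := h
    exact fun s hs => (hf' s hs).continuousAt.continuousWithinAt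

theorem mono (h : IsHolderCurve η k B I f) (hB : B ≤ B') (hI : I' ⊆ I) :
    IsHolderCurve η k B' I' f := by
  induction k generalizing f with
  | zero =>
    exact ⟨h.1.mono hI, fun s hs => (h.2.1 s (hI hs)).trans hB,
      fun s hs s' hs' => (h.2.2 s (hI hs) s' (hI hs')).trans (by gcongr)⟩
  | succ k ih =>
    obtain ⟨hf, f', hf', hk⟩ := h
    exact ⟨fun s hs => (hf s (hI hs)).trans hB, f', fun s hs => hf' s (hI hs), ih hk⟩

theorem zero_of_hasDerivAt (hη : η ∈ Icc (0 : ℝ) 1) (hI : Convex ℝ I) {f' : ℝ → E}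
    (hf : ∀ s ∈ I, ‖f s‖ ≤ B) (hf' : ∀ s ∈ I, HasDerivAt f (f' s) s)
    (hB : ∀ s ∈ I, ‖f' s‖ ≤ B) : IsHolderCurve η 0 (2 * B) I f := by
  refine ⟨fun s hs => (hf' s hs).continuousAt.continuousWithinAt, fun s hs => ?_,
    fun s hs s' hs' => ?_⟩
  · linarith [hf s hs, norm_nonneg (f s)]
  · have hB₀ : 0 ≤ B := (norm_nonneg _).trans (hf s hs)
    refine le_mul_rpow_of_le_of_le_mul hη (by positivity) (abs_nonneg _) ?_ ?_
    · linarith [norm_sub_le (f s) (f s'), hf s hs, hf s' hs']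
    · have := hI.norm_image_sub_le_of_norm_hasDerivWithin_le
        (fun x hx => (hf' x hx).hasDerivWithinAt) hB hs' hs
      rw [Real.norm_eq_abs] at this
      nlinarith [mul_nonneg hB₀ (abs_nonneg (s - s'))]

theorem of_succ (hη : η ∈ Icc (0 : ℝ) 1) (hI : Convex ℝ I)
    (h : IsHolderCurve η (k + 1) B I f) : IsHolderCurve η k (2 * B) I f := by
  induction k generalizing f with
  | zero =>
    obtain ⟨hf, f', hf', hk⟩ := h
    exact zero_of_hasDerivAt hη hI hf hf' hk.norm_le
  | succ k ih =>
    obtain ⟨hf, f', hf', hk⟩ := h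
    exact ⟨fun s hs => by linarith [hf s hs, norm_nonneg (f s)], f', hf', ih hk⟩

theorem const (c : E) : IsHolderCurve η k ‖c‖ I (fun _ => c) := by
  induction k generalizing c with
  | zero =>
    refine ⟨continuousOn_const, fun _ _ => le_rfl, fun s _ s' _ => ?_⟩
    rw [sub_self, norm_zero]
    positivity
  | succ k ih =>
    exact ⟨fun _ _ => le_rfl, fun _ => 0, fun s _ => hasDerivAt_const s c,
      (ih 0).mono (by simp) subset_rfl⟩

theorem clm_apply (A : E →L[ℝ] F) (h : IsHolderCurve η k B I f) :
    IsHolderCurve η k (‖A‖ * B) I (fun s => A (f s)) := by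
  induction k generalizing f with
  | zero =>
    refine ⟨A.continuous.comp_continuousOn h.1, fun s hs => A.le_opNorm_of_le (h.2.1 s hs),
      fun s hs s' hs' => ?_⟩
    rw [← map_sub, mul_assoc]
    exact A.le_opNorm_of_le (h.2.2 s hs s' hs')
  | succ k ih =>
    obtain ⟨hf, f', hf', hk⟩ := h
    exact ⟨fun s hs => A.le_opNorm_of_le (hf s hs), fun s => A (f' s),
      fun s hs => A.hasFDerivAt.comp_hasDerivAt s (hf' s hs), ih hk⟩

theorem add {g : ℝ → E} (hf : IsHolderCurve η k B I f) (hg : IsHolderCurve η k B' I g) :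
    IsHolderCurve η k (B + B') I (fun s => f s + g s) := by
  induction k generalizing f g with
  | zero =>
    refine ⟨hf.1.add hg.1, fun s hs => norm_add_le_of_le (hf.2.1 s hs) (hg.2.1 s hs),
      fun s hs s' hs' => ?_⟩
    rw [add_sub_add_comm, add_mul]
    exact norm_add_le_of_le (hf.2.2 s hs s' hs') (hg.2.2 s hs s' hs')
  | succ k ih =>
    obtain ⟨hf, f', hf', hfk⟩ := hf
    obtain ⟨hg, g', hg', hgk⟩ := hg
    exact ⟨fun s hs => norm_add_le_of_le (hf s hs) (hg s hs), fun s => f' s + g' s,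
      fun s hs => (hf' s hs).add (hg' s hs), ih hfk hgk⟩

theorem norm_bilin_le (b : E →L[ℝ] F →L[ℝ] G) (hB : 0 ≤ B) (hB' : 0 ≤ B')
    (hf : IsHolderCurve η k B I f) (hg : IsHolderCurve η k B' I g) :
    ∀ s ∈ I, ‖b (f s) (g s)‖ ≤ 2 * 4 ^ k * (‖b‖ * B * B') := fun s hs =>
  ((b _).le_of_opNorm_le_of_le (b.le_opNorm_of_le (hf.norm_le s hs)) (hg.norm_le s hs)).trans
    (le_mul_of_one_le_left (by positivity)
      (by linarith [one_le_pow₀ (n := k) (show (1 : ℝ) ≤ 4 by norm_num)]))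

theorem bilin (b : E →L[ℝ] F →L[ℝ] G) (hη : η ∈ Icc (0 : ℝ) 1) (hI : Convex ℝ I) (hB : 0 ≤ B)
    (hB' : 0 ≤ B') (hf : IsHolderCurve η k B I f) (hg : IsHolderCurve η k B' I g) :
    IsHolderCurve η k (2 * 4 ^ k * (‖b‖ * B * B')) I (fun s => b (f s) (g s)) := by
  induction k generalizing f g B B' with
  | zero =>
    refine ⟨(b.continuous.comp_continuousOn hf.1).clm_apply hg.1, norm_bilin_le b hB hB' hf hg,
      fun s hs s' hs' => ?_⟩
    have hf_sub := b.le_opNorm_of_le (hf.2.2 s hs s' hs')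
    have hg_sub := hg.2.2 s hs s' hs'
    calc ‖b (f s) (g s) - b (f s') (g s')‖
        = ‖b (f s - f s') (g s) + b (f s') (g s - g s')‖ := by
          simp only [map_sub, sub_apply]; congr 1; abel
      _ ≤ ‖b‖ * (B * |s - s'| ^ η) * B' + ‖b‖ * B * (B' * |s - s'| ^ η) :=
          norm_add_le_of_le ((b _).le_of_opNorm_le_of_le hf_sub (hg.norm_le s hs))
            ((b _).le_of_opNorm_le_of_le (b.le_opNorm_of_le (hf.norm_le s' hs')) hg_sub)
      _ = 2 * 4 ^ 0 * (‖b‖ * B * B') * |s - s'| ^ η := by ring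
  | succ k ih =>
    have hnorm := norm_bilin_le b hB hB' hf hg
    have hf₁ := hf.of_succ hη hI
    have hg₁ := hg.of_succ hη hI
    obtain ⟨-, f', hf', hfk⟩ := hf
    obtain ⟨-, g', hg', hgk⟩ := hg
    refine ⟨hnorm, fun s => b (f s) (g' s) + b (f' s) (g s), fun s hs => ?_, ?_⟩
    · simpa using (b.hasFDerivAt_of_bilinear (hf' s hs).hasFDerivAt
        (hg' s hs).hasFDerivAt).hasDerivAt
    · exact ((ih (by positivity) hB' hf₁ hgk).add (ih hB (by positivity) hfk hg₁)).mono
        (le_of_eq (by ring)) subset_rfl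

theorem mul {f g : ℝ → ℝ} (hη : η ∈ Icc (0 : ℝ) 1) (hI : Convex ℝ I) (hB : 0 ≤ B)
    (hB' : 0 ≤ B') (hf : IsHolderCurve η k B I f) (hg : IsHolderCurve η k B' I g) :
    IsHolderCurve η k (2 * 4 ^ k * (B * B')) I (fun s => f s * g s) := by
  simpa using bilin (ContinuousLinearMap.mul ℝ ℝ) hη hI hB hB' hf hg

theorem exists_inv (hη : η ∈ Icc (0 : ℝ) 1) (hI : Convex ℝ I) {c : ℝ} (hc : 0 < c) (hB : 0 ≤ B) :
    ∃ B' : ℝ, 0 ≤ B' ∧ ∀ f : ℝ → ℝ, IsHolderCurve η k B I f → (∀ s ∈ I, c ≤ |f s|) →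
      IsHolderCurve η k B' I (fun s => (f s)⁻¹) := by
  have hne : ∀ {x : ℝ}, c ≤ |x| → x ≠ 0 := fun hx => abs_pos.1 (hc.trans_le hx)
  have hinv : ∀ {x : ℝ}, c ≤ |x| → ‖x⁻¹‖ ≤ c⁻¹ := fun hx => by
    rw [norm_inv]
    exact inv_anti₀ hc hx
  induction k generalizing B with
  | zero =>
    refine ⟨c⁻¹ + c⁻¹ * c⁻¹ * B, by positivity, fun f hf hfc =>
      ⟨hf.1.inv₀ fun s hs => hne (hfc s hs),
        fun s hs => (hinv (hfc s hs)).trans (le_add_of_nonneg_right (by positivity)),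
        fun s hs s' hs' => ?_⟩⟩
    calc ‖(f s)⁻¹ - (f s')⁻¹‖ = ‖(f s)⁻¹‖ * ‖(f s')⁻¹‖ * ‖f s - f s'‖ := by
          rw [inv_sub_inv (hne (hfc s hs)) (hne (hfc s' hs')), norm_div, norm_mul, norm_inv,
            norm_inv, norm_sub_rev, div_eq_mul_inv, mul_inv, mul_comm]
      _ ≤ c⁻¹ * c⁻¹ * (B * |s - s'| ^ η) := by
          gcongr
          exacts [hinv (hfc s hs), hinv (hfc s' hs'), hf.2.2 s hs s' hs']
      _ ≤ (c⁻¹ + c⁻¹ * c⁻¹ * B) * |s - s'| ^ η := by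
          rw [← mul_assoc]
          gcongr
          exact le_add_of_nonneg_left (by positivity)
  | succ k ih =>
    obtain ⟨B', hB', ih⟩ := ih (B := 2 * B) (by positivity)
    refine ⟨c⁻¹ + 2 * 4 ^ k * ((2 * 4 ^ k * (B' * B')) * B), by positivity, fun f hf hfc => ?_⟩
    have hi := ih f (hf.of_succ hη hI) hfc
    obtain ⟨-, f', hf', hfk⟩ := hf
    refine ⟨fun s hs => (hinv (hfc s hs)).trans (le_add_of_nonneg_right (by positivity)),
      fun s => -((f s)⁻¹ * (f s)⁻¹ * f' s), fun s hs => ?_, ?_⟩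
    · exact ((hf' s hs).inv (hne (hfc s hs))).congr_deriv
        (by rw [div_eq_mul_inv, sq, mul_inv]; ring)
    · have := ((hi.mul hη hI hB' hB' hi).mul hη hI (by positivity) hB hfk).clm_apply
        (-ContinuousLinearMap.id ℝ ℝ)
      simp only [norm_neg, ContinuousLinearMap.norm_id, one_mul, neg_apply,
        ContinuousLinearMap.id_apply] at this
      exact this.mono (le_add_of_nonneg_left (by positivity)) subset_rfl

theorem contDiffOn (hI : IsOpen I) (h : IsHolderCurve η k B I f) : ContDiffOn ℝ k f I := by
  induction k generalizing f with
  | zero => exact contDiffOn_zero.2 h.1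
  | succ k ih =>
    obtain ⟨-, f', hf', hk⟩ := h
    rw [Nat.cast_add, Nat.cast_one, contDiffOn_succ_iff_deriv_of_isOpen hI]
    exact ⟨fun s hs => (hf' s hs).differentiableAt.differentiableWithinAt, by simp,
      (ih hk).congr fun s hs => (hf' s hs).deriv⟩

theorem eqOn_iteratedDerivWithin_succ (hI : IsOpen I) {f' : ℝ → E}
    (hf' : ∀ s ∈ I, HasDerivAt f (f' s) s) (j : ℕ) :
    EqOn (iteratedDerivWithin (j + 1) f I) (iteratedDerivWithin j f' I) I := fun s hs => by
  rw [iteratedDerivWithin_succ']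
  exact iteratedDerivWithin_congr (fun s hs =>
    (hf' s hs).hasDerivWithinAt.derivWithin (hI.uniqueDiffWithinAt hs)) hs

theorem norm_iteratedDerivWithin_le (hI : IsOpen I) (h : IsHolderCurve η k B I f) {j : ℕ}
    (hj : j ≤ k) : ∀ s ∈ I, ‖iteratedDerivWithin j f I s‖ ≤ B := by
  induction k generalizing f j with
  | zero => simpa [Nat.le_zero.1 hj] using h.norm_le
  | succ k ih =>
    cases j with
    | zero => simpa using h.norm_le
    | succ j =>
      obtain ⟨-, f', hf', hk⟩ := h
      intro s hs
      rw [eqOn_iteratedDerivWithin_succ hI hf' j hs]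
      exact ih hk (by omega) s hs

theorem norm_iteratedDerivWithin_sub_le (hI : IsOpen I) (h : IsHolderCurve η k B I f) :
    ∀ s ∈ I, ∀ s' ∈ I, ‖iteratedDerivWithin k f I s - iteratedDerivWithin k f I s'‖ ≤
      B * |s - s'| ^ η := by
  induction k generalizing f with
  | zero => simpa using h.2.2
  | succ k ih =>
    obtain ⟨-, f', hf', hk⟩ := h
    intro s hs s' hs'
    rw [eqOn_iteratedDerivWithin_succ hI hf' k hs, eqOn_iteratedDerivWithin_succ hI hf' k hs']
    exact ih hk s hs s' hs'

theorem holderNormOn_le {ρ : ℝ} (hI : IsOpen I) (hB : 0 ≤ B)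
    (h : IsHolderCurve (ρ - ⌊ρ⌋₊) ⌊ρ⌋₊ B I f) :
    holderNormOn ρ I f ≤ ENNReal.ofReal
      ((∑ j ∈ Finset.range (⌊ρ⌋₊ + 1), 2 ^ (⌊ρ⌋₊ - j) + 1) * B) := by
  rw [holderNormOn, add_mul, one_mul, ENNReal.ofReal_add (by positivity) hB, Finset.sum_mul,
    ENNReal.ofReal_sum_of_nonneg (fun _ _ => by positivity)]
  refine add_le_add (Finset.sum_le_sum fun j hj => ?_) ?_
  · rw [ENNReal.ofReal_mul (by positivity), ENNReal.ofReal_pow (by norm_num), ENNReal.ofReal_ofNat]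
    gcongr
    refine iSup₂_le fun s hs => ?_
    rw [← ofReal_norm]
    exact ENNReal.ofReal_le_ofReal
      (h.norm_iteratedDerivWithin_le hI (Finset.mem_range_succ_iff.1 hj) s hs)
  · split_ifs
    · exact zero_le
    · refine iSup₂_le fun s hs => iSup₂_le fun s' hs' => ?_
      have hpos : 0 < |s - s'| ^ (ρ - (⌊ρ⌋₊ : ℝ)) :=
        Real.rpow_pos_of_pos (abs_pos.2 (sub_ne_zero.2 fun h => hs'.2 h.symm)) _
      rw [ENNReal.div_le_iff (by simpa using hpos) ENNReal.ofReal_ne_top,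
        ← ENNReal.ofReal_mul hB, ← ofReal_norm]
      exact ENNReal.ofReal_le_ofReal (h.norm_iteratedDerivWithin_sub_le hI s hs s' hs'.1)

end IsHolderCurve

end HolderCurve

section GlobalFlow

open scoped NNReal

variable {E F : Type*} [NormedAddCommGroup E] [NormedSpace ℝ E] [NormedAddCommGroup F]
  [NormedSpace ℝ F] {W : E → E} {L : ℝ≥0}

theorem norm_sub_le_mul_exp_of_hasDerivAt (hW : LipschitzWith L W) {γ γ' : ℝ → E}
    (hγ : ∀ s, HasDerivAt γ (W (γ s)) s) (hγ' : ∀ s, HasDerivAt γ' (W (γ' s)) s) (s : ℝ) :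
    ‖γ s - γ' s‖ ≤ ‖γ 0 - γ' 0‖ * Real.exp (L * |s|) := by
  have of_nonneg : ∀ {W : E → E} {γ γ' : ℝ → E} {s : ℝ}, LipschitzWith L W →
      (∀ s, HasDerivAt γ (W (γ s)) s) → (∀ s, HasDerivAt γ' (W (γ' s)) s) → 0 ≤ s →
      ‖γ s - γ' s‖ ≤ ‖γ 0 - γ' 0‖ * Real.exp (L * s) := fun {W γ γ' s} hW hγ hγ' hs => by
    have := dist_le_of_trajectories_ODE (v := fun _ => W) (K := L) (a := 0) (b := s)
      (δ := ‖γ 0 - γ' 0‖) (fun _ => hW)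
      (fun t _ => (hγ t).continuousAt.continuousWithinAt) (fun t _ => (hγ t).hasDerivWithinAt)
      (fun t _ => (hγ' t).continuousAt.continuousWithinAt) (fun t _ => (hγ' t).hasDerivWithinAt)
      (dist_eq_norm _ _).le s (right_mem_Icc.2 hs)
    simpa [dist_eq_norm] using this
  rcases le_total 0 s with hs | hs
  · simpa [abs_of_nonneg hs] using of_nonneg hW hγ hγ' hs
  · have reverse : ∀ {γ : ℝ → E}, (∀ s, HasDerivAt γ (W (γ s)) s) →
        ∀ s, HasDerivAt (fun s => γ (-s)) (-W (γ (-s))) s := fun hγ s => by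
      simpa [Function.comp_def] using (hγ (-s)).scomp s (hasDerivAt_neg s)
    simpa [abs_of_nonpos hs] using
      of_nonneg (W := fun x => -W x) hW.neg (reverse hγ) (reverse hγ') (neg_nonneg.2 hs)

theorem exists_flow_of_hasDerivAt (hW : LipschitzWith L W) {Ψ : ℝ → E → E} (h0 : ∀ p, Ψ 0 p = p)
    (hΨ : ∀ p s, HasDerivAt (fun s => Ψ s p) (W (Ψ s p)) s) :
    ∃ Φ : Flow ℝ E, ∀ s p, Φ s p = Ψ s p := by
  refine ⟨⟨Ψ, ?_, fun t₁ t₂ p => ?_, h0⟩, fun _ _ => rfl⟩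
  · refine continuous_iff_continuousAt.2 fun ⟨s, p⟩ => ?_
    have hlim : Tendsto (fun x : ℝ × E => ‖x.2 - p‖ * Real.exp (L * |x.1|) + ‖Ψ x.1 p - Ψ s p‖)
        (𝓝 (s, p)) (𝓝 0) := by
      have hp : Continuous fun s => Ψ s p :=
        continuous_iff_continuousAt.2 fun s => (hΨ p s).continuousAt
      have : Continuous fun x : ℝ × E =>
          ‖x.2 - p‖ * Real.exp (L * |x.1|) + ‖Ψ x.1 p - Ψ s p‖ := by fun_prop
      simpa using this.tendsto (s, p)
    refine tendsto_iff_norm_sub_tendsto_zero.2 (squeeze_zero (fun _ => norm_nonneg _) ?_ hlim)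
    refine fun x => (norm_sub_le_norm_sub_add_norm_sub _ (Ψ x.1 p) _).trans (add_le_add_left ?_ _)
    simpa [h0, Function.uncurry] using
      norm_sub_le_mul_exp_of_hasDerivAt hW (hΨ x.2) (hΨ p) x.1
  · have horbit := ODE_solution_unique_univ (v := fun _ => W) (s := fun _ => univ) (t₀ := 0)
      (fun _ => hW.lipschitzOnWith)
      (fun t => ⟨(hΨ p (t + t₂)).comp_add_const t t₂, mem_univ _⟩)
      (fun t => ⟨hΨ (Ψ t₂ p) t, mem_univ _⟩) (by simp [h0])
    exact congrFun horbit t₁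

theorem exists_norm_sub_sub_fderiv_le_of_isCompact {f : E → F} (hf : ContDiff ℝ 1 f) {K : Set E}
    (hK : IsCompact K) {ε : ℝ} (hε : 0 < ε) :
    ∃ δ > 0, ∀ x ∈ K, ∀ y, ‖y - x‖ < δ → ‖f y - f x - fderiv ℝ f x (y - x)‖ ≤ ε * ‖y - x‖ := by
  obtain ⟨δ, hδ, huc⟩ := Metric.mem_uniformity_dist.1 <|
    hK.uniformContinuousAt_of_continuousAt (fderiv ℝ f)
      (fun x _ => (hf.continuous_fderiv one_ne_zero).continuousAt) (Metric.dist_mem_uniformity hε)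
  refine ⟨δ, hδ, fun x hx y hy => ?_⟩
  refine (convex_ball x δ).norm_image_sub_le_of_norm_fderiv_le'
    (fun z _ => hf.differentiable one_ne_zero z) (fun z hz => ?_) (Metric.mem_ball_self hδ)
    (by rwa [Metric.mem_ball, dist_eq_norm])
  rw [← dist_eq_norm, dist_comm]
  exact (huc (by rwa [dist_comm]) hx).le

/-- `Φ` is the flow of the continuously differentiable, globally Lipschitz vector field `W`. -/
structure IsC1Flow (W : E → E) (Φ : Flow ℝ E) : Prop where
  contDiff : ContDiff ℝ 1 W
  exists_lipschitz : ∃ L : ℝ≥0, LipschitzWith L W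
  hasDerivAt : ∀ p s, HasDerivAt (fun s => Φ s p) (W (Φ s p)) s

namespace IsC1Flow

variable {Φ : Flow ℝ E}

theorem reverse (h : IsC1Flow W Φ) : IsC1Flow (fun p => -W p) Φ.reverse where
  contDiff := h.contDiff.neg
  exists_lipschitz := h.exists_lipschitz.imp fun _ hL => hL.neg
  hasDerivAt p s := by
    simpa [Function.comp_def] using (h.hasDerivAt p (-s)).scomp s (hasDerivAt_neg s)

theorem norm_sub_sub_le (h : IsC1Flow W Φ) (hL : LipschitzWith L W) {p q : E} {ξ : ℝ → E →L[ℝ] E}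
    (h0 : ξ 0 = ContinuousLinearMap.id ℝ E)
    (hξ : ∀ v s, HasDerivAt (fun s => ξ s v) (fderiv ℝ W (Φ s p) (ξ s v)) s) {S ε : ℝ} (hS : 0 ≤ S)
    (hε : 0 ≤ ε) (hTaylor : ∀ s ∈ Ico 0 S,
      ‖W (Φ s q) - W (Φ s p) - fderiv ℝ W (Φ s p) (Φ s q - Φ s p)‖ ≤ ε) :
    ‖Φ S q - Φ S p - ξ S (q - p)‖ ≤ ε * Real.exp ((L + 1) * S) := by
  have hderiv : ∀ s, HasDerivAt (fun s => Φ s q - Φ s p - ξ s (q - p))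
      (W (Φ s q) - W (Φ s p) - fderiv ℝ W (Φ s p) (ξ s (q - p))) s :=
    fun s => ((h.hasDerivAt q s).sub (h.hasDerivAt p s)).sub (hξ (q - p) s)
  have hgronwall := norm_le_gronwallBound_of_norm_deriv_right_le (δ := 0) (K := L + 1) (ε := ε)
    (fun s _ => (hderiv s).continuousAt.continuousWithinAt) (fun s _ => (hderiv s).hasDerivWithinAt)
    (by simp [h0]) (fun s hs => ?_) S (right_mem_Icc.2 hS)
  · rw [gronwallBound_of_K_ne_0 (by positivity)] at hgronwall
    simp only [zero_mul, zero_add, sub_zero] at hgronwall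
    have hexp : 1 ≤ Real.exp ((L + 1) * S) := Real.one_le_exp (by positivity)
    exact hgronwall.trans (mul_le_mul (div_le_self hε (by simp)) (by linarith) (by linarith) hε)
  · set e := Φ s q - Φ s p - ξ s (q - p)
    calc ‖W (Φ s q) - W (Φ s p) - fderiv ℝ W (Φ s p) (ξ s (q - p))‖
        = ‖fderiv ℝ W (Φ s p) e +
            (W (Φ s q) - W (Φ s p) - fderiv ℝ W (Φ s p) (Φ s q - Φ s p))‖ := by
          congr 1
          rw [map_sub _ (Φ s q - Φ s p)]
          abel
      _ ≤ L * ‖e‖ + ε := norm_add_le_of_le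
          (ContinuousLinearMap.le_of_opNorm_le _ (norm_fderiv_le_of_lipschitz ℝ hL) _)
          (hTaylor s hs)
      _ ≤ (L + 1) * ‖e‖ + ε := by linarith [norm_nonneg e]

theorem hasFDerivAt_of_nonneg (h : IsC1Flow W Φ) {p : E} {ξ : ℝ → E →L[ℝ] E}
    (h0 : ξ 0 = ContinuousLinearMap.id ℝ E)
    (hξ : ∀ v s, HasDerivAt (fun s => ξ s v) (fderiv ℝ W (Φ s p) (ξ s v)) s) {S : ℝ} (hS : 0 ≤ S) :
    HasFDerivAt (Φ S) (ξ S) p := by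
  obtain ⟨L, hL⟩ := h.exists_lipschitz
  refine .of_isLittleO (Asymptotics.isLittleO_iff.2 fun ε hε => ?_)
  set d : ℝ := Real.exp (L * S)
  set c : ℝ := Real.exp ((L + 1) * S)
  have hd : 0 < d := Real.exp_pos _
  have hc : 0 < c := Real.exp_pos _
  obtain ⟨δ, hδ, hTaylor⟩ := exists_norm_sub_sub_fderiv_le_of_isCompact h.contDiff
    ((isCompact_Icc (a := 0) (b := S)).image (f := fun s => Φ s p) (by fun_prop))
    (show 0 < ε / (d * c) by positivity)
  filter_upwards [Metric.ball_mem_nhds p (show 0 < δ / d by positivity)] with q hq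
  have hspread : ∀ s ∈ Ico 0 S, ‖Φ s q - Φ s p‖ ≤ ‖q - p‖ * d := fun s hs => by
    refine (norm_sub_le_mul_exp_of_hasDerivAt hL (h.hasDerivAt q) (h.hasDerivAt p) s).trans ?_
    simp only [Φ.map_zero_apply, abs_of_nonneg hs.1, d]
    gcongr
    exact hs.2.le
  have hclose : ‖q - p‖ * d < δ := by rwa [← lt_div_iff₀ hd, ← dist_eq_norm]
  calc ‖Φ S q - Φ S p - ξ S (q - p)‖ ≤ ε / (d * c) * (‖q - p‖ * d) * c :=
        h.norm_sub_sub_le hL h0 hξ hS (by positivity) fun s hs =>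
          (hTaylor _ ⟨s, Ico_subset_Icc_self hs, rfl⟩ _ ((hspread s hs).trans_lt hclose)).trans
            (by gcongr; exact hspread s hs)
    _ = ε * ‖q - p‖ := by field_simp

theorem hasFDerivAt (h : IsC1Flow W Φ) {p : E} {ξ : ℝ → E →L[ℝ] E}
    (h0 : ξ 0 = ContinuousLinearMap.id ℝ E)
    (hξ : ∀ v s, HasDerivAt (fun s => ξ s v) (fderiv ℝ W (Φ s p) (ξ s v)) s) (S : ℝ) :
    HasFDerivAt (Φ S) (ξ S) p := by
  rcases le_total 0 S with hS | hS
  · exact h.hasFDerivAt_of_nonneg h0 hξ hS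
  · have := h.reverse.hasFDerivAt_of_nonneg (p := p) (ξ := fun s => ξ (-s)) (by simpa using h0)
      (fun v s => ?_) (neg_nonneg.2 hS)
    · simpa [Flow.reverse] using this
    · have := (hξ v (-s)).scomp s (hasDerivAt_neg s)
      simpa [fderiv_fun_neg, Function.comp_def] using this

end IsC1Flow

end GlobalFlow

section OrientedPlane

variable {E : Type*} [NormedAddCommGroup E] [InnerProductSpace ℝ E]
  [Fact (Module.finrank ℝ E = 2)] (o : Orientation ℝ E (Fin 2))

theorem inner_smul_add_areaForm_smul {u : E} (hu : u ≠ 0) (v : E) :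
    (inner ℝ u v / ‖u‖ ^ 2) • u + (o.areaForm u v / ‖u‖ ^ 2) • o.rightAngleRotation u = v := by
  have hne : ‖u‖ ^ 2 ≠ 0 := by positivity
  refine ext_inner_right ℝ fun w => ?_
  rw [inner_add_left, real_inner_smul_left, real_inner_smul_left, o.inner_rightAngleRotation_left,
    div_mul_eq_mul_div, div_mul_eq_mul_div, ← add_div, div_eq_iff hne, mul_comm (inner ℝ v w),
    o.inner_mul_inner_add_areaForm_mul_areaForm]

theorem areaForm_smul_add_smul (u v : E) (x y : ℝ) :
    o.areaForm u (x • u + y • v) = y * o.areaForm u v := by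
  simp

theorem norm_sq_mul_trace (A : E →ₗ[ℝ] E) (u : E) :
    ‖u‖ ^ 2 * LinearMap.trace ℝ E A =
      inner ℝ u (A u) + o.areaForm u (A (o.rightAngleRotation u)) := by
  rcases eq_or_ne u 0 with rfl | hu
  · simp
  set b := o.basisRightAngleRotation u hu
  have hb : ⇑b = ![u, o.rightAngleRotation u] := o.coe_basisRightAngleRotation u hu
  have hrepr : ∀ v,
      b.repr v 0 = inner ℝ u v / ‖u‖ ^ 2 ∧ b.repr v 1 = o.areaForm u v / ‖u‖ ^ 2 := fun v => by
    have hv : v = (inner ℝ u v / ‖u‖ ^ 2) • b 0 + (o.areaForm u v / ‖u‖ ^ 2) • b 1 := by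
      simpa [hb] using (inner_smul_add_areaForm_smul o hu v).symm
    constructor <;> conv_lhs => rw [hv]
    all_goals simp
  rw [LinearMap.trace_eq_matrix_trace ℝ b, Matrix.trace_fin_two, LinearMap.toMatrix_apply,
    LinearMap.toMatrix_apply, (hrepr _).1, (hrepr _).2, ← add_div,
    mul_div_cancel₀ _ (by positivity), hb]
  rfl

end OrientedPlane

/-- The divergence of a vector field. -/
noncomputable def divergence {E : Type*} [NormedAddCommGroup E] [NormedSpace ℝ E] (W : E → E)
    (p : E) : ℝ :=
  LinearMap.trace ℝ E (fderiv ℝ W p)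

/-- The acceleration of the orbits of a vector field. -/
noncomputable def acceleration {E : Type*} [NormedAddCommGroup E] [NormedSpace ℝ E] (W : E → E)
    (p : E) : E :=
  fderiv ℝ W p (W p)

/-- The determinant of the derivative at `p` of the time-`s` map of the flow of `W`, in the form
given by Liouville's formula. -/
noncomputable def flowJacobian {E : Type*} [NormedAddCommGroup E] [NormedSpace ℝ E] (W : E → E)
    (Φ : Flow ℝ E) (p : E) (s : ℝ) : ℝ :=
  Real.exp (∫ u in (0 : ℝ)..s, divergence W (Φ u p))

section FlowJacobian

theorem hasDerivAt_intervalIntegral_of_continuous {f : ℝ → ℝ} (hf : Continuous f) (s : ℝ) :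
    HasDerivAt (fun s => ∫ u in (0 : ℝ)..s, f u) (f s) s :=
  intervalIntegral.integral_hasDerivAt_right (hf.intervalIntegrable _ _)
    (hf.stronglyMeasurableAtFilter _ _) hf.continuousAt

variable {E : Type*} [NormedAddCommGroup E] [NormedSpace ℝ E] {W : E → E} {Φ : Flow ℝ E}

theorem flowJacobian_zero (p : E) : flowJacobian W Φ p 0 = 1 := by
  simp [flowJacobian]

theorem flowJacobian_pos (p : E) (s : ℝ) : 0 < flowJacobian W Φ p s := Real.exp_pos _

theorem flowJacobian_map_neg (q : E) (t : ℝ) :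
    flowJacobian W Φ (Φ t q) (-t) * flowJacobian W Φ q t = 1 := by
  rw [flowJacobian, flowJacobian, ← Real.exp_add, Real.exp_eq_one_iff]
  simp only [← Φ.map_add]
  rw [intervalIntegral.integral_comp_add_right (fun u => divergence W (Φ u q)) t, zero_add,
    neg_add_cancel, intervalIntegral.integral_symm, neg_add_cancel]

theorem flowJacobian_le_exp {D : ℝ} (hD : ∀ p, |divergence W p| ≤ D) (p : E) (s : ℝ) :
    flowJacobian W Φ p s ≤ Real.exp (D * |s|) := by
  have := intervalIntegral.norm_integral_le_of_norm_le_const (a := 0) (b := s)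
    (f := fun u => divergence W (Φ u p)) (fun u _ => hD _)
  rw [sub_zero] at this
  exact Real.exp_le_exp.2 ((le_abs_self _).trans this)

namespace IsC1Flow

theorem continuous_divergence [FiniteDimensional ℝ E] (h : IsC1Flow W Φ) :
    Continuous (divergence W) :=
  (LinearMap.continuous_of_finiteDimensional
    (LinearMap.trace ℝ E ∘ₗ ContinuousLinearMap.coeLM ℝ)).comp
    (h.contDiff.continuous_fderiv one_ne_zero)

theorem continuous_acceleration (h : IsC1Flow W Φ) : Continuous (acceleration W) :=
  (h.contDiff.continuous_fderiv one_ne_zero).clm_apply h.contDiff.continuous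

theorem hasDerivAt_field (h : IsC1Flow W Φ) (p : E) (s : ℝ) :
    HasDerivAt (fun s => W (Φ s p)) (acceleration W (Φ s p)) s :=
  (h.contDiff.differentiable one_ne_zero _).hasFDerivAt.comp_hasDerivAt s (h.hasDerivAt p s)

theorem hasDerivAt_flowJacobian [FiniteDimensional ℝ E] (h : IsC1Flow W Φ) (p : E) (s : ℝ) :
    HasDerivAt (flowJacobian W Φ p) (flowJacobian W Φ p s * divergence W (Φ s p)) s := by
  have hc : Continuous fun u => divergence W (Φ u p) := h.continuous_divergence.comp (by fun_prop)
  exact (hasDerivAt_intervalIntegral_of_continuous hc s).exp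

end IsC1Flow

end FlowJacobian

section FlowDeriv

variable {E : Type*} [NormedAddCommGroup E] [InnerProductSpace ℝ E]
  [Fact (Module.finrank ℝ E = 2)] (o : Orientation ℝ E (Fin 2)) {W : E → E} {Φ : Flow ℝ E}

/-- The transverse part of the acceleration of the orbits of a planar vector field. -/
noncomputable def bending (W : E → E) (p : E) : ℝ := o.areaForm (W p) (acceleration W p)

/-- The rate at which vectors orthogonal to a planar vector field `W` are sheared along `W` by the
flow of `W`. -/
noncomputable def shear (W : E → E) (p : E) : ℝ :=
  (inner ℝ (W p) (fderiv ℝ W p (o.rightAngleRotation (W p))) + bending o W p) / ‖W p‖ ^ 2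

/-- The component along `J W` of the image of `J W` under the derivative of the flow of `W`, where
`J` is the rotation by a right angle. -/
noncomputable def flowNormal (W : E → E) (Φ : Flow ℝ E) (p : E) (s : ℝ) : ℝ :=
  flowJacobian W Φ p s * ‖W p‖ ^ 2 / ‖W (Φ s p)‖ ^ 2

/-- The component along `W` of the image of `J W` under the derivative of the flow of `W`, where
`J` is the rotation by a right angle. -/
noncomputable def flowShear (W : E → E) (Φ : Flow ℝ E) (p : E) (s : ℝ) : ℝ :=
  ∫ u in (0 : ℝ)..s, flowNormal W Φ p u * shear o W (Φ u p)

/-- The derivative of the flow of a planar vector field `W` with respect to the initial point,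
written in the moving frame formed by `W` and its rotation by a right angle. -/
noncomputable def flowDeriv (W : E → E) (Φ : Flow ℝ E) (p : E) (s : ℝ) : E →L[ℝ] E :=
  ((‖W p‖ ^ 2)⁻¹ • innerSL ℝ (W p)).smulRight (W (Φ s p)) +
    ((‖W p‖ ^ 2)⁻¹ • innerSL ℝ (o.rightAngleRotation (W p))).smulRight
      (flowShear o W Φ p s • W (Φ s p) +
        flowNormal W Φ p s • o.rightAngleRotation (W (Φ s p)))

theorem flowDeriv_apply (p : E) (s : ℝ) (v : E) : flowDeriv o W Φ p s v =
    (inner ℝ (W p) v / ‖W p‖ ^ 2) • W (Φ s p) + (o.areaForm (W p) v / ‖W p‖ ^ 2) •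
      (flowShear o W Φ p s • W (Φ s p) +
        flowNormal W Φ p s • o.rightAngleRotation (W (Φ s p))) := by
  simp only [flowDeriv, add_apply, ContinuousLinearMap.smulRight_apply, smul_apply,
    innerSL_apply_apply, o.inner_rightAngleRotation_left, smul_eq_mul, inv_mul_eq_div]

theorem fderiv_rightAngleRotation {p : E} (h0 : W p ≠ 0) :
    fderiv ℝ W p (o.rightAngleRotation (W p)) = o.rightAngleRotation (acceleration W p) +
      (divergence W p - 2 * inner ℝ (W p) (acceleration W p) / ‖W p‖ ^ 2) •
        o.rightAngleRotation (W p) + shear o W p • W p := by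
  have : ‖W p‖ ^ 2 ≠ 0 := by positivity
  have htrace := norm_sq_mul_trace o (fderiv ℝ W p : E →ₗ[ℝ] E) (W p)
  conv_lhs => rw [← inner_smul_add_areaForm_smul o h0 (fderiv ℝ W p (o.rightAngleRotation (W p)))]
  conv_rhs => rw [← inner_smul_add_areaForm_smul o h0 (acceleration W p)]
  simp only [map_add, map_smul, o.rightAngleRotation_rightAngleRotation,
    shear, bending, inner_add_right, inner_smul_right, o.inner_rightAngleRotation_right,
    o.areaForm_apply_self, real_inner_self_eq_norm_sq]
  change _ * divergence W p = inner ℝ (W p) (acceleration W p) +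
    o.areaForm (W p) (fderiv ℝ W p (o.rightAngleRotation (W p))) at htrace
  rw [← sub_eq_iff_eq_add'] at htrace
  rw [← htrace]
  match_scalars <;> field_simp <;> ring

theorem flowDeriv_zero (h0 : ∀ p, W p ≠ 0) (p : E) :
    flowDeriv o W Φ p 0 = ContinuousLinearMap.id ℝ E := by
  ext1 v
  have hne : ‖W p‖ ^ 2 ≠ 0 := pow_ne_zero 2 (norm_ne_zero_iff.2 (h0 p))
  rw [flowDeriv_apply, flowNormal, flowJacobian_zero, Φ.map_zero_apply, one_mul, div_self hne,
    flowShear, intervalIntegral.integral_same, zero_smul, zero_add, one_smul]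
  exact inner_smul_add_areaForm_smul o (h0 p) v

theorem areaForm_flowDeriv (h0 : ∀ p, W p ≠ 0) (p v : E) (s : ℝ) :
    o.areaForm (W (Φ s p)) (flowDeriv o W Φ p s v) =
      flowJacobian W Φ p s * o.areaForm (W p) v := by
  have h1 : ‖W (Φ s p)‖ ≠ 0 := norm_ne_zero_iff.2 (h0 _)
  have h2 : ‖W p‖ ≠ 0 := norm_ne_zero_iff.2 (h0 p)
  rw [flowDeriv_apply, areaForm_smul_add_smul, areaForm_smul_add_smul,
    o.areaForm_rightAngleRotation_right, real_inner_self_eq_norm_sq, flowNormal]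
  field_simp

theorem isUnit_flowDeriv (h0 : ∀ p, W p ≠ 0) (p : E) (s : ℝ) : IsUnit (flowDeriv o W Φ p s) := by
  have := FiniteDimensional.of_fact_finrank_eq_two (K := ℝ) (V := E)
  have hinj : Function.Injective (flowDeriv o W Φ p s) := by
    refine (injective_iff_map_eq_zero _).2 fun v hv => ?_
    have hω : o.areaForm (W p) v = 0 := by
      have := areaForm_flowDeriv o (Φ := Φ) h0 p v s
      rw [hv, map_zero] at this
      exact (mul_eq_zero.1 this.symm).resolve_left (flowJacobian_pos p s).ne'
    rw [flowDeriv_apply, hω, zero_div, zero_smul, add_zero] at hv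
    rw [← inner_smul_add_areaForm_smul o (h0 p) v, hω, (smul_eq_zero.1 hv).resolve_right (h0 _)]
    simp
  exact ContinuousLinearMap.isUnit_iff_bijective.2
    ⟨hinj, LinearMap.injective_iff_surjective (f := (flowDeriv o W Φ p s).toLinearMap).1 hinj⟩

namespace IsC1Flow

theorem continuous_bending (h : IsC1Flow W Φ) : Continuous (bending o W) :=
  (o.areaForm'.continuous.comp h.contDiff.continuous).clm_apply h.continuous_acceleration

theorem continuous_shear (h : IsC1Flow W Φ) (h0 : ∀ p, W p ≠ 0) : Continuous (shear o W) := by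
  have hW := h.contDiff.continuous
  have hDW := h.contDiff.continuous_fderiv one_ne_zero
  have hJ := o.rightAngleRotation.continuous.comp hW
  refine ((hW.inner (hDW.clm_apply hJ)).add (h.continuous_bending o)).div (by fun_prop) fun p => ?_
  have := h0 p
  positivity

theorem hasDerivAt_flowNormal (h : IsC1Flow W Φ) (h0 : ∀ p, W p ≠ 0) (p : E) (s : ℝ) :
    HasDerivAt (flowNormal W Φ p) (flowNormal W Φ p s * (divergence W (Φ s p) -
      2 * inner ℝ (W (Φ s p)) (acceleration W (Φ s p)) / ‖W (Φ s p)‖ ^ 2)) s := by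
  have := FiniteDimensional.of_fact_finrank_eq_two (K := ℝ) (V := E)
  have hn : ‖W (Φ s p)‖ ≠ 0 := norm_ne_zero_iff.2 (h0 _)
  refine (((h.hasDerivAt_flowJacobian p s).mul_const (‖W p‖ ^ 2)).div
    (h.hasDerivAt_field p s).norm_sq (pow_ne_zero 2 hn)).congr_deriv ?_
  rw [flowNormal]
  field_simp

theorem hasDerivAt_flowShear (h : IsC1Flow W Φ) (h0 : ∀ p, W p ≠ 0) (p : E) (s : ℝ) :
    HasDerivAt (flowShear o W Φ p) (flowNormal W Φ p s * shear o W (Φ s p)) s := by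
  have hc : Continuous fun u => flowNormal W Φ p u * shear o W (Φ u p) :=
    (continuous_iff_continuousAt.2 fun u => (h.hasDerivAt_flowNormal h0 p u).continuousAt).mul
      ((h.continuous_shear o h0).comp (by fun_prop))
  exact hasDerivAt_intervalIntegral_of_continuous hc s

theorem hasDerivAt_flowDeriv (h : IsC1Flow W Φ) (h0 : ∀ p, W p ≠ 0) (p v : E) (s : ℝ) :
    HasDerivAt (fun s => flowDeriv o W Φ p s v)
      (fderiv ℝ W (Φ s p) (flowDeriv o W Φ p s v)) s := by
  have hW := h.hasDerivAt_field p s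
  have hJ : HasDerivAt (fun s => o.rightAngleRotation (W (Φ s p)))
      (o.rightAngleRotation (acceleration W (Φ s p))) s :=
    o.rightAngleRotation.toContinuousLinearEquiv.hasFDerivAt.comp_hasDerivAt s hW
  simp only [flowDeriv_apply]
  refine ((hW.const_smul _).add ((((h.hasDerivAt_flowShear o h0 p s).smul hW).add
    ((h.hasDerivAt_flowNormal h0 p s).smul hJ)).const_smul _)).congr_deriv ?_
  simp only [map_add, map_smul, fderiv_rightAngleRotation o (h0 (Φ s p))]
  rw [← acceleration]
  module

theorem hasFDerivAt_flowDeriv (h : IsC1Flow W Φ) (h0 : ∀ p, W p ≠ 0) (p : E) (s : ℝ) :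
    HasFDerivAt (Φ s) (flowDeriv o W Φ p s) p :=
  h.hasFDerivAt (flowDeriv_zero o h0 p) (h.hasDerivAt_flowDeriv o h0 p) s

end IsC1Flow

end FlowDeriv

section Leafwise

variable {X E F G : Type*} [TopologicalSpace X] [NormedAddCommGroup E] [NormedSpace ℝ E]
  [NormedAddCommGroup F] [NormedSpace ℝ F] [NormedAddCommGroup G] [NormedSpace ℝ G]

/-- `f'` is the derivative of `f` along the orbits of the flow `Φ`. -/
def HasLeafDeriv (Φ : Flow ℝ X) (f f' : X → E) : Prop :=
  ∀ p s, HasDerivAt (fun s => f (Φ s p)) (f' (Φ s p)) s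

/-- The restrictions of `f` to the orbits of `Φ`, parametrized by the flow, are of class `C^(k+η)`
with a common bound. -/
def IsLeafwiseHolder (Φ : Flow ℝ X) (η : ℝ) (k : ℕ) (f : X → E) : Prop :=
  ∃ B : ℝ, 0 ≤ B ∧ ∀ p, IsHolderCurve η k B univ (fun s => f (Φ s p))

variable {Φ : Flow ℝ X} {η : ℝ} {k : ℕ} {f f' : X → E} {m m' : X → ℝ}

namespace HasLeafDeriv

theorem continuous (h : HasLeafDeriv Φ f f') (p : X) : Continuous fun s => f (Φ s p) :=
  continuous_iff_continuousAt.2 fun s => (h p s).continuousAt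

theorem unique {g : X → E} (hf : HasLeafDeriv Φ f f') (hg : HasLeafDeriv Φ f g) : f' = g := by
  funext p
  simpa only [Φ.map_zero_apply] using (hf p 0).unique (hg p 0)

theorem add {g g' : X → E} (hf : HasLeafDeriv Φ f f') (hg : HasLeafDeriv Φ g g') :
    HasLeafDeriv Φ (fun p => f p + g p) (fun p => f' p + g' p) :=
  fun p s => (hf p s).add (hg p s)

theorem smul (hm : HasLeafDeriv Φ m m') (hf : HasLeafDeriv Φ f f') :
    HasLeafDeriv Φ (fun p => m p • f p) (fun p => m p • f' p + m' p • f p) :=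
  fun p s => (hm p s).smul (hf p s)

end HasLeafDeriv

namespace IsLeafwiseHolder

theorem const (c : E) : IsLeafwiseHolder Φ η k (fun _ => c) :=
  ⟨‖c‖, norm_nonneg c, fun _ => IsHolderCurve.const c⟩

theorem add {g : X → E} (hf : IsLeafwiseHolder Φ η k f) (hg : IsLeafwiseHolder Φ η k g) :
    IsLeafwiseHolder Φ η k (fun p => f p + g p) := by
  obtain ⟨B, hB, hf⟩ := hf
  obtain ⟨B', hB', hg⟩ := hg
  exact ⟨B + B', add_nonneg hB hB', fun p => (hf p).add (hg p)⟩

theorem clm_apply (A : E →L[ℝ] F) (hf : IsLeafwiseHolder Φ η k f) :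
    IsLeafwiseHolder Φ η k (fun p => A (f p)) := by
  obtain ⟨B, hB, hf⟩ := hf
  exact ⟨‖A‖ * B, by positivity, fun p => (hf p).clm_apply A⟩

theorem bilin (b : E →L[ℝ] F →L[ℝ] G) (hη : η ∈ Icc (0 : ℝ) 1) {g : X → F}
    (hf : IsLeafwiseHolder Φ η k f) (hg : IsLeafwiseHolder Φ η k g) :
    IsLeafwiseHolder Φ η k (fun p => b (f p) (g p)) := by
  obtain ⟨B, hB, hf⟩ := hf
  obtain ⟨B', hB', hg⟩ := hg
  exact ⟨_, by positivity, fun p => (hf p).bilin b hη convex_univ hB hB' (hg p)⟩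

theorem apply (hη : η ∈ Icc (0 : ℝ) 1) {A : X → E →L[ℝ] F} (hA : IsLeafwiseHolder Φ η k A)
    (hf : IsLeafwiseHolder Φ η k f) : IsLeafwiseHolder Φ η k (fun p => A p (f p)) :=
  bilin (ContinuousLinearMap.id ℝ (E →L[ℝ] F)) hη hA hf

theorem smul (hη : η ∈ Icc (0 : ℝ) 1) (hm : IsLeafwiseHolder Φ η k m)
    (hf : IsLeafwiseHolder Φ η k f) : IsLeafwiseHolder Φ η k (fun p => m p • f p) :=
  bilin (ContinuousLinearMap.lsmul ℝ ℝ) hη hm hf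

theorem inv (hη : η ∈ Icc (0 : ℝ) 1) (hm : IsLeafwiseHolder Φ η k m) {c : ℝ} (hc : 0 < c)
    (hmc : ∀ p, c ≤ |m p|) : IsLeafwiseHolder Φ η k (fun p => (m p)⁻¹) := by
  obtain ⟨B, hB, hm⟩ := hm
  obtain ⟨B', hB', h⟩ := IsHolderCurve.exists_inv hη convex_univ hc hB
  exact ⟨B', hB', fun p => h _ (hm p) fun s _ => hmc _⟩

theorem of_le (hη : η ∈ Icc (0 : ℝ) 1) {j : ℕ} (hjk : j ≤ k) (hf : IsLeafwiseHolder Φ η k f) :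
    IsLeafwiseHolder Φ η j f := by
  induction hjk with
  | refl => exact hf
  | step _ ih =>
    obtain ⟨B, hB, hf⟩ := hf
    exact ih ⟨2 * B, by positivity, fun p => (hf p).of_succ hη convex_univ⟩

theorem continuous (hf : IsLeafwiseHolder Φ η k f) (p : X) : Continuous fun s => f (Φ s p) := by
  obtain ⟨B, -, hf⟩ := hf
  exact continuousOn_univ.1 (hf p).continuousOn

theorem exists_norm_le (hf : IsLeafwiseHolder Φ η k f) : ∃ B, 0 ≤ B ∧ ∀ p, ‖f p‖ ≤ B := by
  obtain ⟨B, hB, hf⟩ := hf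
  exact ⟨B, hB, fun p => by simpa only [Φ.map_zero_apply] using (hf p).norm_le 0 (mem_univ _)⟩

theorem of_hasLeafDeriv {B : ℝ} (hB : ∀ p, ‖f p‖ ≤ B) (hf : HasLeafDeriv Φ f f')
    (hf' : IsLeafwiseHolder Φ η k f') : IsLeafwiseHolder Φ η (k + 1) f := by
  obtain ⟨B', hB', hf'⟩ := hf'
  exact ⟨max B B', hB'.trans (le_max_right _ _), fun p =>
    ⟨fun s _ => (hB _).trans (le_max_left _ _), fun s => f' (Φ s p), fun s _ => hf p s,
      (hf' p).mono (le_max_right _ _) subset_rfl⟩⟩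

theorem exists_hasLeafDeriv (hf : IsLeafwiseHolder Φ η (k + 1) f) :
    ∃ f', HasLeafDeriv Φ f f' ∧ IsLeafwiseHolder Φ η k f' := by
  obtain ⟨B, hB, hf⟩ := hf
  choose _ γ' hγ' hk using hf
  have hγ'_flow : ∀ p s, γ' (Φ s p) 0 = γ' p s := by
    intro p s
    have hshift : HasDerivAt (fun t => f (Φ (t + s) p)) (γ' p s) 0 :=
      HasDerivAt.comp_add_const 0 s (by simpa only [zero_add] using hγ' p s (mem_univ _))
    simp only [Φ.map_add] at hshift
    exact (hγ' (Φ s p) 0 (mem_univ _)).unique hshift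
  refine ⟨fun p => γ' p 0, fun p s => ?_, B, hB, fun p => ?_⟩
  · exact (hγ' p s (mem_univ _)).congr_deriv (hγ'_flow p s).symm
  · simpa only [hγ'_flow] using hk p

end IsLeafwiseHolder

/-- The map `T` sends orbits of `Φ` to orbits of `Φ`, changing the speed by the factor `σ`. -/
def Intertwines (Φ : Flow ℝ X) (T : X → X) (σ : X → ℝ) : Prop :=
  ∀ p, ∃ τ : ℝ → ℝ, τ 0 = 0 ∧ (∀ s, HasDerivAt τ (σ (Φ s p)) s) ∧
    ∀ s, T (Φ s p) = Φ (τ s) (T p)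

/-- The multiplicative cocycle over `T` generated by `m`. -/
def cocycle {X : Type*} (T : X → X) (m : X → ℝ) : ℕ → X → ℝ
  | 0, _ => 1
  | n + 1, p => m p * cocycle T m n (T p)

namespace Intertwines

variable {T : X → X} {σ : X → ℝ}

theorem iterate (hT : Intertwines Φ T σ) (n : ℕ) : Intertwines Φ T^[n] (cocycle T σ n) := by
  induction n with
  | zero => exact fun p => ⟨id, rfl, fun s => hasDerivAt_id s, fun s => rfl⟩
  | succ n ih =>
    intro p
    obtain ⟨τ, hτ0, hτ, hτT⟩ := hT p
    obtain ⟨τ', hτ0', hτ', hτT'⟩ := ih (T p)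
    refine ⟨τ' ∘ τ, by simp [hτ0, hτ0'], fun s => ?_, fun s => ?_⟩
    · refine ((hτ' (τ s)).comp s (hτ s)).congr_deriv ?_
      rw [cocycle, hτT s, mul_comm]
    · rw [Function.iterate_succ_apply, Function.iterate_succ_apply, hτT s, hτT' (τ s)]
      rfl

theorem abs_sub_le {c : ℝ} (hσ : ∀ p, |σ p| ≤ c) {p : X} {τ : ℝ → ℝ}
    (hτ : ∀ s, HasDerivAt τ (σ (Φ s p)) s) (s s' : ℝ) : |τ s - τ s'| ≤ c * |s - s'| :=
  convex_univ.norm_image_sub_le_of_norm_hasDerivWithin_le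
    (fun x _ => (hτ x).hasDerivWithinAt) (fun _ _ => hσ _) (mem_univ s') (mem_univ s)

theorem continuous_comp (hT : Intertwines Φ T σ) {Y : Type*} [TopologicalSpace Y] {f : X → Y}
    (hf : ∀ p, Continuous fun s => f (Φ s p)) (p : X) : Continuous fun s => f (T (Φ s p)) := by
  obtain ⟨τ, -, hτ, hτT⟩ := hT p
  simp only [hτT]
  exact (hf (T p)).comp (continuous_iff_continuousAt.2 fun s => (hτ s).continuousAt)

theorem hasLeafDeriv_comp (hT : Intertwines Φ T σ) (hf : HasLeafDeriv Φ f f') :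
    HasLeafDeriv Φ (fun p => f (T p)) (fun p => σ p • f' (T p)) := by
  intro p s
  obtain ⟨τ, -, hτ, hτT⟩ := hT p
  simp only [hτT]
  exact (hf (T p) (τ s)).scomp s (hτ s)

theorem isLeafwiseHolder_zero_comp (hT : Intertwines Φ T σ) (hη : η ∈ Icc (0 : ℝ) 1) {c : ℝ}
    (hσ : ∀ p, |σ p| ≤ c) (hf : IsLeafwiseHolder Φ η 0 f) :
    IsLeafwiseHolder Φ η 0 (fun p => f (T p)) := by
  rcases isEmpty_or_nonempty X with _ | ⟨⟨p₀⟩⟩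
  · exact ⟨0, le_rfl, fun p => isEmptyElim p⟩
  have hc : 0 ≤ c := (abs_nonneg _).trans (hσ p₀)
  have hcont := hT.continuous_comp hf.continuous
  obtain ⟨B, hB, hf⟩ := hf
  refine ⟨B + B * c ^ η, by positivity, fun p => ⟨(hcont p).continuousOn, fun s _ => ?_,
    fun s _ s' _ => ?_⟩⟩
  all_goals
    obtain ⟨τ, -, hτ, hτT⟩ := hT p
    simp only [hτT]
  · exact ((hf (T p)).norm_le (τ s) (mem_univ _)).trans (le_add_of_nonneg_right (by positivity))
  · calc ‖f (Φ (τ s) (T p)) - f (Φ (τ s') (T p))‖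
        ≤ B * |τ s - τ s'| ^ η := (hf (T p)).2.2 (τ s) (mem_univ _) (τ s') (mem_univ _)
      _ ≤ B * (c * |s - s'|) ^ η := by
          gcongr
          exacts [hη.1, abs_sub_le hσ hτ s s']
      _ = B * c ^ η * |s - s'| ^ η := by rw [Real.mul_rpow hc (abs_nonneg _), mul_assoc]
      _ ≤ (B + B * c ^ η) * |s - s'| ^ η := by gcongr; exact le_add_of_nonneg_left hB

theorem isLeafwiseHolder_comp (hT : Intertwines Φ T σ) (hη : η ∈ Icc (0 : ℝ) 1) {c : ℝ}
    (hσ : ∀ p, |σ p| ≤ c) (hσk : ∀ j < k, IsLeafwiseHolder Φ η j σ)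
    (hf : IsLeafwiseHolder Φ η k f) : IsLeafwiseHolder Φ η k (fun p => f (T p)) := by
  induction k generalizing f with
  | zero => exact hT.isLeafwiseHolder_zero_comp hη hσ hf
  | succ k ih =>
    obtain ⟨B, -, hfB⟩ := hf.exists_norm_le
    obtain ⟨f', hff', hf'⟩ := hf.exists_hasLeafDeriv
    exact .of_hasLeafDeriv (fun p => hfB (T p)) (hT.hasLeafDeriv_comp hff')
      ((hσk k k.lt_succ_self).smul hη (ih (fun j hj => hσk j (hj.trans k.lt_succ_self)) hf'))

theorem isLeafwiseHolder_cocycle (hT : Intertwines Φ T σ) (hη : η ∈ Icc (0 : ℝ) 1)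
    (hσ : IsLeafwiseHolder Φ η k σ) (hm : IsLeafwiseHolder Φ η k m) (n : ℕ) :
    IsLeafwiseHolder Φ η k (cocycle T m n) := by
  obtain ⟨c, -, hσc⟩ := hσ.exists_norm_le
  induction n with
  | zero => exact .const 1
  | succ n ih =>
    exact hm.smul hη (hT.isLeafwiseHolder_comp hη hσc (fun j hj => hσ.of_le hη hj.le) ih)

end Intertwines

end Leafwise

section CohomologicalEquation

variable {X E : Type*} [NormedAddCommGroup E] [NormedSpace ℝ E]

/-- The weighted composition operator `f ↦ m • (f ∘ T)`; a cohomological equation over `T` has the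
form `u = f + twist T m u`. -/
def twist (T : X → X) (m : X → ℝ) (f : X → E) (p : X) : E := m p • f (T p)

variable {T : X → X} {m σ : X → ℝ} {f u : X → E}

theorem norm_twist_iterate_le {θ B : ℝ} (hm : ∀ p, |m p| ≤ θ) (hf : ∀ p, ‖f p‖ ≤ B) (n : ℕ)
    (p : X) : ‖(twist T m)^[n] f p‖ ≤ B * θ ^ n := by
  induction n generalizing p with
  | zero => simpa using hf p
  | succ n ih =>
    rw [Function.iterate_succ_apply', twist, norm_smul, pow_succ, ← mul_assoc, mul_comm]
    exact mul_le_mul (ih (T p)) (hm p) (abs_nonneg _) ((norm_nonneg _).trans (ih (T p)))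

theorem sub_sum_twist_iterate (hu : ∀ p, u p = f p + m p • u (T p)) (n : ℕ) (p : X) :
    u p - ∑ i ∈ Finset.range n, (twist T m)^[i] f p = (twist T m)^[n] u p := by
  induction n generalizing p with
  | zero => simp
  | succ n ih =>
    rw [Function.iterate_succ_apply', twist, ← ih, Finset.sum_range_succ', smul_sub,
      Finset.smul_sum, hu p]
    simp only [Function.iterate_succ_apply', Function.iterate_zero, id_eq, twist]
    abel

theorem hasSum_twist_iterate {H : ℝ} (hm : ∀ p, |m p| ≤ 1 / 2) (hH : ∀ p, ‖u p‖ ≤ H)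
    (hu : ∀ p, u p = f p + m p • u (T p)) (hf : ∀ p, Summable fun n => (twist T m)^[n] f p)
    (p : X) : HasSum (fun n => (twist T m)^[n] f p) (u p) := by
  refine (hf p).hasSum_iff_tendsto_nat.2 (tendsto_iff_norm_sub_tendsto_zero.2 ?_)
  have hgeom : Tendsto (fun n : ℕ => H * (1 / 2 : ℝ) ^ n) atTop (𝓝 0) := by
    simpa using (tendsto_pow_atTop_nhds_zero_of_lt_one (r := (1 / 2 : ℝ))
      (by norm_num) (by norm_num)).const_mul H
  refine squeeze_zero (fun _ => norm_nonneg _) (fun n => ?_) hgeom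
  rw [norm_sub_rev, sub_sum_twist_iterate hu]
  exact norm_twist_iterate_le hm hH n p

theorem exists_eq_add_cocycle_smul_iterate {P : (X → E) → Prop} (h0 : P fun _ => 0)
    (hP : ∀ g, P g → P fun p => f p + m p • g (T p)) (hu : ∀ p, u p = f p + m p • u (T p)) (n : ℕ) :
    ∃ g, P g ∧ ∀ p, u p = g p + cocycle T m n p • u (T^[n] p) := by
  induction n with
  | zero => exact ⟨fun _ => 0, h0, fun p => by simp [cocycle]⟩
  | succ n ih =>
    obtain ⟨g, hPg, hg⟩ := ih
    refine ⟨_, hP g hPg, fun p => ?_⟩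
    rw [hu p, hg (T p), cocycle, Function.iterate_succ_apply, smul_add, smul_smul, add_assoc]

variable [TopologicalSpace X] {Φ : Flow ℝ X} {η : ℝ} {k : ℕ} {H : ℝ}

namespace Intertwines

theorem norm_sub_le_of_contracting {E : Type*} [SeminormedAddCommGroup E] {u : X → E}
    (hT : Intertwines Φ T σ) (hη : 0 ≤ η) (hσ : ∀ p, |σ p| ≤ 1) (hm : ∀ p, |m p| ≤ 1 / 2) {A : ℝ}
    (hA : 0 ≤ A) (hH : ∀ p, ‖u p‖ ≤ H)
    (hu : ∀ p s s', ‖u (Φ s p) - u (Φ s' p)‖ ≤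
      A * |s - s'| ^ η + |m (Φ s' p)| * ‖u (T (Φ s p)) - u (T (Φ s' p))‖) (p : X) (s s' : ℝ) :
    ‖u (Φ s p) - u (Φ s' p)‖ ≤ 2 * A * |s - s'| ^ η := by
  have hstep : ∀ n : ℕ, ∀ p s s', ‖u (Φ s p) - u (Φ s' p)‖ ≤
      2 * A * |s - s'| ^ η + (1 / 2) ^ n * (2 * H) := by
    intro n
    induction n with
    | zero =>
      intro p s s'
      have htwo : ‖u (Φ s p) - u (Φ s' p)‖ ≤ H + H := norm_sub_le_of_le (hH _) (hH _)
      have hpos : 0 ≤ 2 * A * |s - s'| ^ η := by positivity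
      linarith
    | succ n ih =>
      intro p s s'
      obtain ⟨τ, -, hτ, hτT⟩ := hT p
      have : 0 ≤ H := (norm_nonneg _).trans (hH p)
      have hττ : |τ s - τ s'| ≤ |s - s'| := by simpa using abs_sub_le hσ hτ s s'
      calc ‖u (Φ s p) - u (Φ s' p)‖
          ≤ A * |s - s'| ^ η + |m (Φ s' p)| * ‖u (T (Φ s p)) - u (T (Φ s' p))‖ := hu p s s'
        _ ≤ A * |s - s'| ^ η +
              1 / 2 * (2 * A * |τ s - τ s'| ^ η + (1 / 2) ^ n * (2 * H)) := by
            rw [hτT, hτT]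
            gcongr
            exacts [hm _, ih (T p) (τ s) (τ s')]
        _ ≤ A * |s - s'| ^ η + 1 / 2 * (2 * A * |s - s'| ^ η + (1 / 2) ^ n * (2 * H)) := by
            gcongr
        _ = 2 * A * |s - s'| ^ η + (1 / 2) ^ (n + 1) * (2 * H) := by ring
  have hlim : Tendsto (fun n : ℕ => 2 * A * |s - s'| ^ η + (1 / 2) ^ n * (2 * H)) atTop
      (𝓝 (2 * A * |s - s'| ^ η + 0 * (2 * H))) :=
    ((tendsto_pow_atTop_nhds_zero_of_lt_one (by norm_num) (by norm_num)).mul_const _).const_add _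
  simpa only [zero_mul, add_zero] using ge_of_tendsto' hlim fun n => hstep n p s s'

theorem isLeafwiseHolder_zero_of_cohomological (hT : Intertwines Φ T σ) (hη : 0 ≤ η)
    (hσ : ∀ p, |σ p| ≤ 1) (hf : IsLeafwiseHolder Φ η 0 f) (hm : IsLeafwiseHolder Φ η 0 m)
    (hm2 : ∀ p, |m p| ≤ 1 / 2) (hH : ∀ p, ‖u p‖ ≤ H) (hcont : ∀ p, Continuous fun s => u (Φ s p))
    (hu : ∀ p, u p = f p + m p • u (T p)) : IsLeafwiseHolder Φ η 0 u := by
  rcases isEmpty_or_nonempty X with _ | ⟨⟨p₀⟩⟩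
  · exact ⟨0, le_rfl, fun p => isEmptyElim p⟩
  have hH0 : 0 ≤ H := (norm_nonneg _).trans (hH p₀)
  obtain ⟨B₁, hB₁, hf⟩ := hf
  obtain ⟨B₂, hB₂, hm⟩ := hm
  have hstep : ∀ p s s', ‖u (Φ s p) - u (Φ s' p)‖ ≤ (B₁ + B₂ * H) * |s - s'| ^ η +
      |m (Φ s' p)| * ‖u (T (Φ s p)) - u (T (Φ s' p))‖ := by
    intro p s s'
    have hfs := (hf p).2.2 s (mem_univ _) s' (mem_univ _)
    have hms := (hm p).2.2 s (mem_univ _) s' (mem_univ _)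
    calc ‖u (Φ s p) - u (Φ s' p)‖
        = ‖(f (Φ s p) - f (Φ s' p)) + (m (Φ s p) - m (Φ s' p)) • u (T (Φ s p)) +
            m (Φ s' p) • (u (T (Φ s p)) - u (T (Φ s' p)))‖ := by
          rw [hu (Φ s p), hu (Φ s' p)]; congr 1; module
      _ ≤ ‖f (Φ s p) - f (Φ s' p)‖ + ‖m (Φ s p) - m (Φ s' p)‖ * ‖u (T (Φ s p))‖ +
            |m (Φ s' p)| * ‖u (T (Φ s p)) - u (T (Φ s' p))‖ := by
          rw [← norm_smul, ← Real.norm_eq_abs, ← norm_smul]; exact norm_add₃_le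
      _ ≤ B₁ * |s - s'| ^ η + B₂ * |s - s'| ^ η * H +
            |m (Φ s' p)| * ‖u (T (Φ s p)) - u (T (Φ s' p))‖ := by gcongr; exact hH _
      _ = _ := by ring
  refine ⟨H + 2 * (B₁ + B₂ * H), by positivity, fun p => ⟨(hcont p).continuousOn, fun s _ =>
    (hH _).trans (le_add_of_nonneg_right (by positivity)), fun s _ s' _ => ?_⟩⟩
  refine (hT.norm_sub_le_of_contracting hη hσ hm2 (by positivity) hH hstep p s s').trans ?_
  gcongr
  exact le_add_of_nonneg_left hH0

theorem exists_hasLeafDeriv_twist_iterate (hT : Intertwines Φ T σ) (hσ : ∀ p, |σ p| ≤ 1)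
    (hσc : ∀ p, Continuous fun s => σ (Φ s p)) {f' : X → E} {m' : X → ℝ} {B : ℝ} (hB : 0 ≤ B)
    (hf : HasLeafDeriv Φ f f') (hfc : ∀ p, Continuous fun s => f' (Φ s p))
    (hfB : ∀ p, ‖f p‖ ≤ B) (hfB' : ∀ p, ‖f' p‖ ≤ B)
    (hm : HasLeafDeriv Φ m m') (hmc : ∀ p, Continuous fun s => m' (Φ s p))
    (hm2 : ∀ p, |m p| ≤ 1 / 2) (hmB' : ∀ p, |m' p| ≤ B) (n : ℕ) :
    ∃ e : X → E, HasLeafDeriv Φ ((twist T m)^[n] f) e ∧ (∀ p, Continuous fun s => e (Φ s p)) ∧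
      ∀ p, ‖e p‖ ≤ (B + 4 * B * B) * (3 / 4) ^ n := by
  induction n with
  | zero =>
    exact ⟨f', hf, hfc, fun p => (hfB' p).trans (by
      rw [pow_zero, mul_one]; exact le_add_of_nonneg_right (by positivity))⟩
  | succ n ih =>
    obtain ⟨e, he, hec, heB⟩ := ih
    simp only [Function.iterate_succ_apply']
    refine ⟨_, hm.smul (hT.hasLeafDeriv_comp he), fun p => ?_, fun p => ?_⟩
    · exact ((hm.continuous p).smul ((hσc p).smul (hT.continuous_comp hec p))).add
        ((hmc p).smul (hT.continuous_comp he.continuous p))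
    have h34 : (1 / 2 : ℝ) ^ n ≤ (3 / 4) ^ n :=
      pow_le_pow_left₀ (by norm_num) (by norm_num) n
    calc ‖m p • σ p • e (T p) + m' p • (twist T m)^[n] f (T p)‖
        ≤ |m p| * (|σ p| * ‖e (T p)‖) + |m' p| * ‖(twist T m)^[n] f (T p)‖ := by
          refine (norm_add_le _ _).trans_eq ?_
          simp only [norm_smul, Real.norm_eq_abs]
      _ ≤ 1 / 2 * (1 * ((B + 4 * B * B) * (3 / 4) ^ n)) + B * (B * (1 / 2) ^ n) := by
          gcongr
          exacts [hm2 p, hσ p, heB (T p), hmB' p, norm_twist_iterate_le hm2 hfB n (T p)]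
      _ ≤ 1 / 2 * (1 * ((B + 4 * B * B) * (3 / 4) ^ n)) + B * (B * (3 / 4) ^ n) := by gcongr
      _ ≤ (B + 4 * B * B) * (3 / 4) ^ (n + 1) := by
          rw [pow_succ]; nlinarith [mul_nonneg hB (pow_nonneg (show (0 : ℝ) ≤ 3 / 4 by norm_num) n)]

theorem exists_hasLeafDeriv_of_cohomological [CompleteSpace E] (hT : Intertwines Φ T σ)
    (hσ : ∀ p, |σ p| ≤ 1) (hσ0 : IsLeafwiseHolder Φ η 0 σ) (hf : IsLeafwiseHolder Φ η 1 f)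
    (hm : IsLeafwiseHolder Φ η 1 m) (hm2 : ∀ p, |m p| ≤ 1 / 2) (hH : ∀ p, ‖u p‖ ≤ H)
    (hu : ∀ p, u p = f p + m p • u (T p)) :
    ∃ u' : X → E, HasLeafDeriv Φ u u' ∧ (∃ H', ∀ p, ‖u' p‖ ≤ H') ∧
      ∀ p, Continuous fun s => u' (Φ s p) := by
  obtain ⟨B₁, hB₁, hfB⟩ := hf.exists_norm_le
  obtain ⟨f', hff', hf'⟩ := hf.exists_hasLeafDeriv
  obtain ⟨m', hmm', hm'⟩ := hm.exists_hasLeafDeriv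
  obtain ⟨B₂, hB₂, hfB'⟩ := hf'.exists_norm_le
  obtain ⟨B₃, hB₃, hmB'⟩ := hm'.exists_norm_le
  set B := B₁ + B₂ + B₃
  choose e he hec heB using exists_hasLeafDeriv_twist_iterate hT hσ hσ0.continuous
    (B := B) (by positivity) hff' hf'.continuous (fun p => (hfB p).trans (by linarith))
    (fun p => (hfB' p).trans (by linarith)) hmm' hm'.continuous hm2
    (fun p => (hmB' p).trans (by linarith))
  have hsum : Summable fun n : ℕ => (B + 4 * B * B) * (3 / 4 : ℝ) ^ n :=
    (summable_geometric_of_lt_one (by norm_num) (by norm_num)).mul_left _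
  have hterm : ∀ p, Summable fun n => (twist T m)^[n] f p := fun p => .of_norm_bounded
    ((summable_geometric_of_lt_one (by norm_num) (by norm_num)).mul_left B₁)
    fun n => norm_twist_iterate_le hm2 hfB n p
  have hu_tsum : u = fun p => ∑' n, (twist T m)^[n] f p :=
    funext fun p => (hasSum_twist_iterate hm2 hH hu hterm p).tsum_eq.symm
  refine ⟨fun p => ∑' n, e n p, fun p s => ?_, ⟨_, fun p => tsum_of_norm_bounded hsum.hasSum
    (heB · p)⟩, fun p => continuous_tsum (hec · p) hsum fun n s => heB n (Φ s p)⟩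
  rw [hu_tsum]
  exact hasDerivAt_tsum hsum (fun n y => he n p y) (fun n y => heB n (Φ y p)) (hterm (Φ 0 p)) s

theorem isLeafwiseHolder_of_cohomological [CompleteSpace E] (hη : η ∈ Icc (0 : ℝ) 1)
    (hT : Intertwines Φ T σ) (hσ : ∀ p, |σ p| ≤ 1) (hσk : ∀ j < k, IsLeafwiseHolder Φ η j σ)
    (hf : IsLeafwiseHolder Φ η k f) (hm : IsLeafwiseHolder Φ η k m) (hm2 : ∀ p, |m p| ≤ 1 / 2)
    (hH : ∀ p, ‖u p‖ ≤ H) (hcont : ∀ p, Continuous fun s => u (Φ s p))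
    (hu : ∀ p, u p = f p + m p • u (T p)) : IsLeafwiseHolder Φ η k u := by
  induction k generalizing f m u H with
  | zero => exact hT.isLeafwiseHolder_zero_of_cohomological hη.1 hσ hf hm hm2 hH hcont hu
  | succ k ih =>
    have hσk' : ∀ j < k, IsLeafwiseHolder Φ η j σ := fun j hj => hσk j (hj.trans k.lt_succ_self)
    have hmk := hm.of_le hη k.le_succ
    have huk : IsLeafwiseHolder Φ η k u := ih hσk' (hf.of_le hη k.le_succ) hmk hm2 hH hcont hu
    obtain ⟨f', hff', hf'⟩ := hf.exists_hasLeafDeriv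
    obtain ⟨m', hmm', hm'⟩ := hm.exists_hasLeafDeriv
    obtain ⟨u', huu', ⟨H', hH'⟩, hu'c⟩ := hT.exists_hasLeafDeriv_of_cohomological hσ
      (hσk 0 k.succ_pos) (hf.of_le hη (by omega)) (hm.of_le hη (by omega)) hm2 hH hu
    have hu' : ∀ p, u' p = (f' p + m' p • u (T p)) + (m p * σ p) • u' (T p) := by
      have hleaf := hff'.add (hmm'.smul (hT.hasLeafDeriv_comp huu'))
      rw [← funext hu] at hleaf
      exact fun p => (congrFun (huu'.unique hleaf) p).trans (by module)
    have huT := hT.isLeafwiseHolder_comp hη hσ hσk' huk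
    refine .of_hasLeafDeriv hH huu' (ih hσk' (hf'.add (hm'.smul hη huT))
      (hmk.smul hη (hσk k k.lt_succ_self)) (fun p => ?_) hH' hu'c hu')
    rw [smul_eq_mul, abs_mul]
    exact (mul_le_of_le_one_right (abs_nonneg _) (hσ p)).trans (hm2 p)

theorem isLeafwiseHolder_of_cohomological_iterate [CompleteSpace E] (hη : η ∈ Icc (0 : ℝ) 1)
    (hT : Intertwines Φ T σ) {N : ℕ} (hσ : IsLeafwiseHolder Φ η k σ)
    (hf : IsLeafwiseHolder Φ η k f) (hm : IsLeafwiseHolder Φ η k m)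
    (hσN : ∀ p, |cocycle T σ N p| ≤ 1) (hmN : ∀ p, |cocycle T m N p| ≤ 1 / 2)
    (hH : ∀ p, ‖u p‖ ≤ H) (hcont : ∀ p, Continuous fun s => u (Φ s p))
    (hu : ∀ p, u p = f p + m p • u (T p)) : IsLeafwiseHolder Φ η k u := by
  obtain ⟨c, -, hσc⟩ := hσ.exists_norm_le
  obtain ⟨g, hg, hgu⟩ := exists_eq_add_cocycle_smul_iterate (P := IsLeafwiseHolder Φ η k)
    (.const 0) (fun g hg => hf.add (hm.smul hη
      (hT.isLeafwiseHolder_comp hη hσc (fun j hj => hσ.of_le hη hj.le) hg))) hu N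
  exact isLeafwiseHolder_of_cohomological hη (hT.iterate N) hσN
    (fun j hj => (hT.isLeafwiseHolder_cocycle hη hσ hσ N).of_le hη hj.le) hg
    (hT.isLeafwiseHolder_cocycle hη hσ hm N) hmN hH hcont hgu

end Intertwines

end CohomologicalEquation

section UniformHolder

variable {E G : Type*} [NormedAddCommGroup E] [NormedSpace ℝ E] [NormedAddCommGroup G]
  [NormedSpace ℝ G]

/-- `f` is of class `C^k` with bounded derivatives, the one of order `k` being `η`-Hölder. -/
def IsUniformHolder (η : ℝ) (k : ℕ) (f : E → G) : Prop :=
  ContDiff ℝ k f ∧ ∃ B : ℝ, 0 ≤ B ∧ (∀ j ≤ k, ∀ x, ‖iteratedFDeriv ℝ j f x‖ ≤ B) ∧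
    ∀ x y, ‖iteratedFDeriv ℝ k f x - iteratedFDeriv ℝ k f y‖ ≤ B * ‖x - y‖ ^ η

namespace IsUniformHolder

variable {η : ℝ} {k : ℕ} {f : E → G} {W : E → E} {Φ : Flow ℝ E}

theorem hasLeafDeriv_iteratedFDeriv (hf : ContDiff ℝ k f) (hΦ : HasLeafDeriv Φ id W) {j : ℕ}
    (hj : j < k) : HasLeafDeriv Φ (iteratedFDeriv ℝ j f) fun p =>
      (continuousMultilinearCurryLeftEquiv ℝ (fun _ : Fin (j + 1) => E) G)
        (iteratedFDeriv ℝ (j + 1) f p) (W p) := by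
  intro p s
  have hd : DifferentiableAt ℝ (iteratedFDeriv ℝ j f) (Φ s p) :=
    hf.differentiable_iteratedFDeriv (by exact_mod_cast hj) _
  refine (hd.hasFDerivAt.comp_hasDerivAt s (hΦ p s)).congr_deriv ?_
  rw [fderiv_iteratedFDeriv, Function.comp_apply]

theorem norm_curryLeft_apply_le {M B : ℝ} (hM : ∀ p, ‖W p‖ ≤ M) {j : ℕ}
    (hB : ∀ p, ‖iteratedFDeriv ℝ (j + 1) f p‖ ≤ B) (p : E) :
    ‖(continuousMultilinearCurryLeftEquiv ℝ (fun _ : Fin (j + 1) => E) G)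
      (iteratedFDeriv ℝ (j + 1) f p) (W p)‖ ≤ B * M :=
  ContinuousLinearMap.le_of_opNorm_le_of_le _
    ((LinearIsometryEquiv.norm_map _ _).trans_le (hB p)) (hM p)

theorem isLeafwiseHolder_iteratedFDeriv_zero (hf : IsUniformHolder η k f)
    (hη : η ∈ Icc (0 : ℝ) 1) (hΦ : HasLeafDeriv Φ id W) {M : ℝ} (hM : ∀ p, ‖W p‖ ≤ M) {j : ℕ}
    (hj : j ≤ k) : IsLeafwiseHolder Φ η 0 (iteratedFDeriv ℝ j f) := by
  obtain ⟨hf, B, hB, hfB, hholder⟩ := hf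
  have hM0 : 0 ≤ M := (norm_nonneg _).trans (hM 0)
  rcases hj.lt_or_eq with hj | rfl
  · refine ⟨2 * (B + B * M), by positivity, fun p => .zero_of_hasDerivAt hη convex_univ
      (fun s _ => ?_) (fun s _ => hasLeafDeriv_iteratedFDeriv hf hΦ hj p s) fun s _ => ?_⟩
    · exact (hfB j hj.le _).trans (le_add_of_nonneg_right (by positivity))
    · exact (norm_curryLeft_apply_le hM (hfB (j + 1) hj) _).trans (le_add_of_nonneg_left hB)
  · refine ⟨B + B * M ^ η, by positivity, fun p => ⟨?_, fun s _ => ?_, fun s _ s' _ => ?_⟩⟩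
    · exact ((hf.continuous_iteratedFDeriv le_rfl).comp (hΦ.continuous p)).continuousOn
    · exact (hfB j le_rfl _).trans (le_add_of_nonneg_right (by positivity))
    · have horbit : ‖Φ s p - Φ s' p‖ ≤ M * |s - s'| :=
        convex_univ.norm_image_sub_le_of_norm_hasDerivWithin_le
          (fun t _ => (hΦ p t).hasDerivWithinAt) (fun t _ => hM _) (mem_univ s') (mem_univ s)
      calc ‖iteratedFDeriv ℝ j f (Φ s p) - iteratedFDeriv ℝ j f (Φ s' p)‖
          ≤ B * ‖Φ s p - Φ s' p‖ ^ η := hholder _ _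
        _ ≤ B * (M * |s - s'|) ^ η := by gcongr; exact hη.1
        _ = B * M ^ η * |s - s'| ^ η := by rw [Real.mul_rpow hM0 (abs_nonneg _), mul_assoc]
        _ ≤ (B + B * M ^ η) * |s - s'| ^ η := by gcongr; exact le_add_of_nonneg_left hB

theorem isLeafwiseHolder_iteratedFDeriv (hf : IsUniformHolder η k f) (hη : η ∈ Icc (0 : ℝ) 1)
    (hΦ : HasLeafDeriv Φ id W) {M : ℝ} (hM : ∀ p, ‖W p‖ ≤ M) {m : ℕ}
    (hW : ∀ i < m, IsLeafwiseHolder Φ η i W) {j : ℕ} (hj : j + m ≤ k) :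
    IsLeafwiseHolder Φ η m (iteratedFDeriv ℝ j f) := by
  induction m generalizing j with
  | zero => exact hf.isLeafwiseHolder_iteratedFDeriv_zero hη hΦ hM hj
  | succ m ih =>
    have hnext : IsLeafwiseHolder Φ η m (iteratedFDeriv ℝ (j + 1) f) :=
      ih (fun i hi => hW i (hi.trans m.lt_succ_self)) (by omega)
    obtain ⟨hf, B, -, hfB, -⟩ := hf
    exact .of_hasLeafDeriv (hfB j (by omega)) (hasLeafDeriv_iteratedFDeriv hf hΦ (by omega))
      (.bilin (continuousMultilinearCurryLeftEquiv ℝ (fun _ : Fin (j + 1) => E)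
        G).toContinuousLinearEquiv.toContinuousLinearMap hη hnext (hW m m.lt_succ_self))

theorem isLeafwiseHolder (hf : IsUniformHolder η k f) (hη : η ∈ Icc (0 : ℝ) 1)
    (hΦ : HasLeafDeriv Φ id W) {M : ℝ} (hM : ∀ p, ‖W p‖ ≤ M) {m : ℕ}
    (hW : ∀ i < m, IsLeafwiseHolder Φ η i W) (hm : m ≤ k) : IsLeafwiseHolder Φ η m f := by
  simpa [iteratedFDeriv_zero_eq_comp] using
    (hf.isLeafwiseHolder_iteratedFDeriv hη hΦ hM hW ((zero_add m).trans_le hm)).clm_apply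
      (continuousMultilinearCurryFin0 ℝ E G).toContinuousLinearEquiv.toContinuousLinearMap

theorem isLeafwiseHolder_fderiv (hf : IsUniformHolder η k f) (hη : η ∈ Icc (0 : ℝ) 1)
    (hΦ : HasLeafDeriv Φ id W) {M : ℝ} (hM : ∀ p, ‖W p‖ ≤ M) {m : ℕ}
    (hW : ∀ i < m, IsLeafwiseHolder Φ η i W) (hm : m < k) :
    IsLeafwiseHolder Φ η m (fderiv ℝ f) := by
  have h := (hf.isLeafwiseHolder_iteratedFDeriv hη hΦ hM hW ((add_comm 1 m).trans_le hm)).clm_apply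
    (continuousMultilinearCurryFin1 ℝ E G).toContinuousLinearEquiv.toContinuousLinearMap
  convert h using 2 with p
  ext v
  simp

end IsUniformHolder

end UniformHolder

/-- The factor by which `T` changes the speed of the orbits of a vector field `W` whose direction it
preserves. -/
noncomputable def speedFactor {E : Type*} [NormedAddCommGroup E] [InnerProductSpace ℝ E]
    (W T : E → E) (p : E) : ℝ :=
  inner ℝ (fderiv ℝ T p (W p)) (W (T p)) / ‖W (T p)‖ ^ 2

/-- The derivative of `T` maps the direction of the vector field `W` to the direction of `W`. -/
def PreservesDirection {E : Type*} [NormedAddCommGroup E] [InnerProductSpace ℝ E]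
    (W T : E → E) : Prop :=
  ∀ p, fderiv ℝ T p (W p) = speedFactor W T p • W (T p)

/-- The time parameter of the image under `T` of the orbit of `p`. -/
noncomputable def imageTime {E : Type*} [NormedAddCommGroup E] [InnerProductSpace ℝ E]
    (W T : E → E) (Φ : Flow ℝ E) (p : E) (s : ℝ) : ℝ :=
  ∫ u in (0 : ℝ)..s, speedFactor W T (Φ u p)

section ImageOfOrbits

open scoped NNReal

variable {E : Type*} [NormedAddCommGroup E] [InnerProductSpace ℝ E] {W T : E → E} {Φ : Flow ℝ E}

theorem speedFactor_eq_of_fderiv_eq_smul {p : E} {a : ℝ} (h0 : W (T p) ≠ 0)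
    (h : fderiv ℝ T p (W p) = a • W (T p)) : speedFactor W T p = a := by
  rw [speedFactor, h, real_inner_smul_left, real_inner_self_eq_norm_sq, mul_div_assoc,
    div_self (pow_ne_zero 2 (norm_ne_zero_iff.2 h0)), mul_one]

theorem imageTime_zero (p : E) : imageTime W T Φ p 0 = 0 :=
  intervalIntegral.integral_same

namespace IsC1Flow

theorem continuous_speedFactor (h : IsC1Flow W Φ) (h0 : ∀ p, W p ≠ 0) (hT : ContDiff ℝ 1 T) :
    Continuous (speedFactor W T) := by
  have hW := h.contDiff.continuous
  have hWT := hW.comp hT.continuous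
  refine (((hT.continuous_fderiv one_ne_zero).clm_apply hW).inner hWT).div (by fun_prop)
    fun p => pow_ne_zero 2 (norm_ne_zero_iff.2 (h0 (T p)))

theorem hasDerivAt_imageTime (h : IsC1Flow W Φ) (h0 : ∀ p, W p ≠ 0) (hT : ContDiff ℝ 1 T)
    (p : E) (s : ℝ) : HasDerivAt (imageTime W T Φ p) (speedFactor W T (Φ s p)) s :=
  hasDerivAt_intervalIntegral_of_continuous ((h.continuous_speedFactor h0 hT).comp
    (by fun_prop : Continuous fun u => Φ u p)) s

theorem continuous_imageTime (h : IsC1Flow W Φ) (h0 : ∀ p, W p ≠ 0) (hT : ContDiff ℝ 1 T) (s : ℝ) :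
    Continuous fun p => imageTime W T Φ p s := by
  refine intervalIntegral.continuous_parametric_intervalIntegral_of_continuous' ?_ 0 s
  exact (h.continuous_speedFactor h0 hT).comp (by fun_prop : Continuous fun x : E × ℝ => Φ x.2 x.1)

theorem map_orbit (h : IsC1Flow W Φ) (h0 : ∀ p, W p ≠ 0) (hT : ContDiff ℝ 1 T)
    (hd : PreservesDirection W T) {c : ℝ} (hc : ∀ p, |speedFactor W T p| ≤ c) (p : E) (s : ℝ) :
    T (Φ s p) = Φ (imageTime W T Φ p s) (T p) := by
  obtain ⟨L, hL⟩ := h.exists_lipschitz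
  lift c to ℝ≥0 using (abs_nonneg _).trans (hc p)
  have hlip : ∀ s, LipschitzWith (c * L) fun y => speedFactor W T (Φ s p) • W y := fun s =>
    LipschitzWith.of_dist_le_mul fun x y => by
      rw [dist_smul₀, Real.norm_eq_abs, NNReal.coe_mul, mul_assoc]
      exact mul_le_mul (hc _) (hL.dist_le_mul x y) dist_nonneg c.2
  have horbit : (fun s => T (Φ s p)) = fun s => Φ (imageTime W T Φ p s) (T p) := by
    refine ODE_solution_unique_univ (v := fun s y => speedFactor W T (Φ s p) • W y)
      (s := fun _ => univ) (t₀ := 0) (fun s => (hlip s).lipschitzOnWith)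
      (fun s => ⟨?_, trivial⟩) (fun s => ⟨?_, trivial⟩) ?_
    · exact ((hT.differentiable one_ne_zero (Φ s p)).hasFDerivAt.comp_hasDerivAt s
        (h.hasDerivAt p s)).congr_deriv (hd (Φ s p))
    · exact (h.hasDerivAt (T p) (imageTime W T Φ p s)).scomp s (h.hasDerivAt_imageTime h0 hT p s)
    · simp only [imageTime_zero, Φ.map_zero_apply]
  exact congrFun horbit s

theorem intertwines (h : IsC1Flow W Φ) (h0 : ∀ p, W p ≠ 0) (hT : ContDiff ℝ 1 T)
    (hd : PreservesDirection W T) {c : ℝ} (hc : ∀ p, |speedFactor W T p| ≤ c) :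
    Intertwines Φ T (speedFactor W T) := fun p =>
  ⟨imageTime W T Φ p, imageTime_zero p, h.hasDerivAt_imageTime h0 hT p,
    h.map_orbit h0 hT hd hc p⟩

end IsC1Flow

end ImageOfOrbits

section MoveAlongFlow

open Asymptotics

variable {E F G : Type*} [NormedAddCommGroup E] [NormedSpace ℝ E] [NormedAddCommGroup F]
  [NormedSpace ℝ F] [NormedAddCommGroup G] [NormedSpace ℝ G] {W : E → E} {Φ : Flow ℝ E}

namespace IsC1Flow

theorem isLittleO_flow_sub_sub_smul (h : IsC1Flow W Φ) (q : E) :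
    (fun x : ℝ × E => Φ x.1 x.2 - x.2 - x.1 • W q) =o[𝓝 (0, q)] (Prod.fst : ℝ × E → ℝ) := by
  refine isLittleO_iff.2 fun ε hε => ?_
  have hcont : Continuous fun x : ℝ × E => ‖W (Φ x.1 x.2) - W q‖ := by
    have := h.contDiff.continuous
    fun_prop
  have hnear : ∀ᶠ x : ℝ × E in 𝓝 (0, q), ‖W (Φ x.1 x.2) - W q‖ < ε :=
    (hcont.tendsto _).eventually (gt_mem_nhds (by simpa [Φ.map_zero_apply] using hε))
  obtain ⟨δ, hδ, hball⟩ := Metric.eventually_nhds_iff.1 hnear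
  filter_upwards [Metric.ball_mem_nhds (0, q) hδ] with ⟨s, y⟩ hx
  have hderiv : ∀ u ∈ uIcc 0 s, HasDerivWithinAt (fun u => Φ u y - u • W q)
      (W (Φ u y) - W q) (uIcc 0 s) u := fun u _ =>
    (((h.hasDerivAt y u).sub ((hasDerivAt_id u).smul_const (W q))).congr_deriv
      (by rw [one_smul])).hasDerivWithinAt
  have hbound : ∀ u ∈ uIcc 0 s, ‖W (Φ u y) - W q‖ ≤ ε := fun u hu => by
    have hus : |u| ≤ |s| := by simpa using abs_sub_left_of_mem_uIcc hu
    refine (@hball (u, y) (lt_of_le_of_lt ?_ hx)).le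
    simpa only [Prod.dist_eq, Real.dist_0_eq_abs] using max_le_max_right _ hus
  have := (convex_uIcc 0 s).norm_image_sub_le_of_norm_hasDerivWithin_le hderiv hbound
    left_mem_uIcc right_mem_uIcc
  simp only [Φ.map_zero_apply, zero_smul, sub_zero] at this
  rwa [sub_right_comm]

theorem comp_fderiv_eq_of_move (h : IsC1Flow W Φ) {A T : F → E} {A' T' : F →L[ℝ] E} {p : F}
    {δ : F → ℝ} (h0 : W (T p) ≠ 0) (hA : HasFDerivAt A A' p) (hT : HasFDerivAt T T' p)
    (hδ : ContinuousAt δ p) (hδp : δ p = 0) (hAT : ∀ x, A x = Φ (δ x) (T x)) {ℓ : E →L[ℝ] G}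
    (hℓ : ℓ (W (T p)) = 0) : ℓ.comp A' = ℓ.comp T' := by
  set R : F → E := fun x => A x - T x - δ x • W (T p) with hR
  have hAp : A p = T p := by rw [hAT, hδp, Φ.map_zero_apply]
  have hlim : Tendsto (fun x => (δ x, T x)) (𝓝 p) (𝓝 (0, T p)) :=
    (hδp ▸ hδ.tendsto).prodMk_nhds hT.continuousAt
  have hRδ : R =o[𝓝 p] δ := by
    simp only [hR, hAT]
    exact (h.isLittleO_flow_sub_sub_smul (T p)).comp_tendsto hlim
  have hδW : δ =O[𝓝 p] fun x => δ x • W (T p) := by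
    refine .of_bound ‖W (T p)‖⁻¹ (.of_forall fun x => ?_)
    rw [norm_smul, mul_left_comm, inv_mul_cancel₀ (norm_ne_zero_iff.2 h0), mul_one]
  have hδp' : (fun x => δ x • W (T p)) =O[𝓝 p] fun x => x - p := by
    refine (hRδ.trans_isBigO hδW).right_isBigO_add.trans ?_
    simpa [hR, hAp] using (hA.sub hT).isBigO_sub
  have hRp : (fun x => ℓ (A x - T x)) =o[𝓝 p] fun x => x - p := by
    have hℓR : ∀ x, ℓ (A x - T x) = ℓ (R x) := fun x => by
      rw [hR, map_sub ℓ (A x - T x), map_smul, hℓ, smul_zero, sub_zero]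
    simpa only [hℓR] using (ℓ.isBigO_comp R (𝓝 p)).trans_isLittleO
      (hRδ.trans_isBigO (hδW.trans hδp'))
  have hzero : HasFDerivAt (fun x => ℓ (A x - T x)) (0 : F →L[ℝ] G) p := by
    rw [hasFDerivAt_iff_isLittleO]
    simpa [hAp] using hRp
  have := (ℓ.hasFDerivAt.comp p (hA.sub hT)).unique hzero
  rwa [ContinuousLinearMap.comp_sub, sub_eq_zero] at this

end IsC1Flow

end MoveAlongFlow

section TransverseFactor

variable {E : Type*} [NormedAddCommGroup E] [InnerProductSpace ℝ E]
  [Fact (Module.finrank ℝ E = 2)] (o : Orientation ℝ E (Fin 2)) {W T : E → E} {Φ : Flow ℝ E}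

/-- The factor by which `T` scales the area form transverse to a planar vector field `W` whose
direction it preserves. -/
noncomputable def transverseFactor (W T : E → E) (p : E) : ℝ :=
  o.areaForm (W (T p)) (fderiv ℝ T p (o.rightAngleRotation (W p))) / ‖W p‖ ^ 2

theorem PreservesDirection.areaForm_fderiv (hd : PreservesDirection W T) {p : E} (h0 : W p ≠ 0)
    (v : E) : o.areaForm (W (T p)) (fderiv ℝ T p v) =
      transverseFactor o W T p * o.areaForm (W p) v := by
  conv_lhs => rw [← inner_smul_add_areaForm_smul o h0 v, map_add, map_smul, map_smul, hd p,
    smul_smul, map_add, map_smul, map_smul, o.areaForm_apply_self, smul_zero, zero_add]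
  rw [transverseFactor, smul_eq_mul]
  ring

theorem transverseFactor_eq_of_areaForm_fderiv {p : E} {a : ℝ} (h0 : W p ≠ 0)
    (h : ∀ v, o.areaForm (W (T p)) (fderiv ℝ T p v) = a * o.areaForm (W p) v) :
    transverseFactor o W T p = a := by
  rw [transverseFactor, h, o.areaForm_rightAngleRotation_right, real_inner_self_eq_norm_sq,
    mul_div_assoc, div_self (pow_ne_zero 2 (norm_ne_zero_iff.2 h0)), mul_one]

namespace IsC1Flow

theorem flowJacobian_mul_transverseFactor (h : IsC1Flow W Φ) (h0 : ∀ p, W p ≠ 0)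
    (hT : ContDiff ℝ 1 T) (hd : PreservesDirection W T) {c : ℝ}
    (hc : ∀ p, |speedFactor W T p| ≤ c) (p : E) (s : ℝ) :
    flowJacobian W Φ p s * transverseFactor o W T (Φ s p) =
      transverseFactor o W T p * flowJacobian W Φ (T p) (imageTime W T Φ p s) := by
  set t := imageTime W T Φ p s with ht
  have hTd : ∀ x, HasFDerivAt T (fderiv ℝ T x) x := fun x =>
    (hT.differentiable one_ne_zero x).hasFDerivAt
  have hmap : ∀ x, T (Φ s x) = Φ (imageTime W T Φ x s) (T x) := fun x => h.map_orbit h0 hT hd hc x s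
  have hback : Φ (-t) (T (Φ s p)) = T p := by
    rw [hmap p, ← ht, ← Φ.map_add, neg_add_cancel, Φ.map_zero_apply]
  have hA : HasFDerivAt (fun x => Φ (-t) (T (Φ s x))) ((flowDeriv o W Φ (T (Φ s p)) (-t)).comp
      ((fderiv ℝ T (Φ s p)).comp (flowDeriv o W Φ p s))) p :=
    (h.hasFDerivAt_flowDeriv o h0 (T (Φ s p)) (-t)).comp p
      ((hTd (Φ s p)).comp p (h.hasFDerivAt_flowDeriv o h0 p s))
  -- `Φ (-t) ∘ T ∘ Φ s` and `T` differ by a small move along the orbits, so their derivatives at `p`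
  -- agree transversally.
  have htransverse := h.comp_fderiv_eq_of_move (h0 (T p)) hA (hTd p)
    (δ := fun x => imageTime W T Φ x s - t)
    ((h.continuous_imageTime h0 hT s).sub continuous_const).continuousAt (sub_self t)
    (fun x => by rw [hmap x, ← Φ.map_add, neg_add_eq_sub]) (ℓ := o.areaForm' (W (T p)))
    (o.areaForm_apply_self _)
  have hfactor : flowJacobian W Φ (T (Φ s p)) (-t) *
      (transverseFactor o W T (Φ s p) * flowJacobian W Φ p s) = transverseFactor o W T p := by
    refine (transverseFactor_eq_of_areaForm_fderiv o (h0 p) fun v => ?_).symm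
    have := (DFunLike.congr_fun htransverse v).symm
    simp only [ContinuousLinearMap.comp_apply, o.areaForm'_apply,
      LinearMap.coe_toContinuousLinearMap'] at this
    rw [this, ← hback, areaForm_flowDeriv o h0, hd.areaForm_fderiv o (h0 _),
      areaForm_flowDeriv o h0]
    ring
  have hinv : flowJacobian W Φ (T (Φ s p)) (-t) * flowJacobian W Φ (T p) t = 1 := by
    rw [hmap p, ← ht]
    exact flowJacobian_map_neg (T p) t
  linear_combination flowJacobian W Φ (T p) t * hfactor -
    (transverseFactor o W T (Φ s p) * flowJacobian W Φ p s) * hinv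

theorem divergence_cohomological (h : IsC1Flow W Φ) (h0 : ∀ p, W p ≠ 0) (hT : ContDiff ℝ 1 T)
    (hd : PreservesDirection W T) {c : ℝ} (hc : ∀ p, |speedFactor W T p| ≤ c) {m' : E → ℝ}
    (hm : HasLeafDeriv Φ (transverseFactor o W T) m') (p : E) :
    divergence W p * transverseFactor o W T p + m' p =
      transverseFactor o W T p * (speedFactor W T p * divergence W (T p)) := by
  have := FiniteDimensional.of_fact_finrank_eq_two (K := ℝ) (V := E)
  have hleft := (h.hasDerivAt_flowJacobian p 0).mul (hm p 0)
  have hright := ((h.hasDerivAt_flowJacobian (T p) (imageTime W T Φ p 0)).comp 0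
    (h.hasDerivAt_imageTime h0 hT p 0)).const_mul (transverseFactor o W T p)
  have heq : (flowJacobian W Φ p * fun s => transverseFactor o W T (Φ s p)) =
      fun s => transverseFactor o W T p * (flowJacobian W Φ (T p) ∘ imageTime W T Φ p) s :=
    funext fun s => h.flowJacobian_mul_transverseFactor o h0 hT hd hc p s
  have hderiv := (heq ▸ hleft).unique hright
  simp only [imageTime_zero, flowJacobian_zero, Φ.map_zero_apply, one_mul] at hderiv
  rw [hderiv, mul_comm (speedFactor W T p)]

end IsC1Flow

end TransverseFactor

section Iterates

variable {E : Type*} [NormedAddCommGroup E]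

theorem pow_le_abs_cocycle {X : Type*} {T : X → X} {m : X → ℝ} {c : ℝ} (hc : 0 ≤ c)
    (hm : ∀ p, c ≤ |m p|) (n : ℕ) (p : X) : c ^ n ≤ |cocycle T m n p| := by
  induction n generalizing p with
  | zero => simp [cocycle]
  | succ n ih =>
    rw [cocycle, abs_mul, pow_succ']
    gcongr
    exacts [hm p, ih (T p)]

theorem abs_cocycle_le_pow {X : Type*} {T : X → X} {m : X → ℝ} {c : ℝ} (hm : ∀ p, |m p| ≤ c)
    (n : ℕ) (p : X) : |cocycle T m n p| ≤ c ^ n := by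
  induction n generalizing p with
  | zero => simp [cocycle]
  | succ n ih =>
    rw [cocycle, abs_mul, pow_succ']
    exact mul_le_mul (hm p) (ih (T p)) (abs_nonneg _) ((abs_nonneg _).trans (hm p))

theorem contDiff_iterate [NormedSpace ℝ E] {m : WithTop ℕ∞} {T : E → E} (hT : ContDiff ℝ m T)
    (n : ℕ) : ContDiff ℝ m T^[n] := by
  induction n with
  | zero => exact contDiff_id
  | succ n ih => rw [Function.iterate_succ]; exact ih.comp hT

theorem fderiv_iterate_succ [NormedSpace ℝ E] {T : E → E} (hT : ContDiff ℝ 1 T) (n : ℕ) (p : E) :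
    fderiv ℝ (T^[n + 1]) p = (fderiv ℝ (T^[n]) (T p)).comp (fderiv ℝ T p) := by
  rw [Function.iterate_succ]
  exact fderiv_comp p ((contDiff_iterate hT n).differentiable one_ne_zero _)
    (hT.differentiable one_ne_zero p)

namespace PreservesDirection

variable [InnerProductSpace ℝ E] {W T : E → E}

theorem fderiv_iterate (hd : PreservesDirection W T) (hT : ContDiff ℝ 1 T) (n : ℕ) (p : E) :
    fderiv ℝ (T^[n]) p (W p) = cocycle T (speedFactor W T) n p • W (T^[n] p) := by
  induction n generalizing p with
  | zero => simp [cocycle]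
  | succ n ih =>
    rw [fderiv_iterate_succ hT, ContinuousLinearMap.comp_apply, hd p, map_smul, ih (T p), smul_smul,
      cocycle, Function.iterate_succ_apply]

theorem speedFactor_iterate (hd : PreservesDirection W T) (hT : ContDiff ℝ 1 T)
    (h0 : ∀ p, W p ≠ 0) (n : ℕ) : speedFactor W T^[n] = cocycle T (speedFactor W T) n :=
  funext fun p => speedFactor_eq_of_fderiv_eq_smul (h0 _) (hd.fderiv_iterate hT n p)

theorem iterate (hd : PreservesDirection W T) (hT : ContDiff ℝ 1 T) (h0 : ∀ p, W p ≠ 0) (n : ℕ) :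
    PreservesDirection W T^[n] := fun p => by
  rw [hd.speedFactor_iterate hT h0, hd.fderiv_iterate hT]

variable [Fact (Module.finrank ℝ E = 2)] (o : Orientation ℝ E (Fin 2))

theorem areaForm_fderiv_iterate (hd : PreservesDirection W T) (hT : ContDiff ℝ 1 T)
    (h0 : ∀ p, W p ≠ 0) (n : ℕ) (p v : E) : o.areaForm (W (T^[n] p)) (fderiv ℝ (T^[n]) p v) =
      cocycle T (transverseFactor o W T) n p * o.areaForm (W p) v := by
  induction n generalizing p v with
  | zero => simp [cocycle]
  | succ n ih =>
    rw [fderiv_iterate_succ hT, ContinuousLinearMap.comp_apply, Function.iterate_succ_apply,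
      ih (T p), hd.areaForm_fderiv o (h0 p), cocycle]
    ring

theorem transverseFactor_iterate (hd : PreservesDirection W T) (hT : ContDiff ℝ 1 T)
    (h0 : ∀ p, W p ≠ 0) (n : ℕ) :
    transverseFactor o W T^[n] = cocycle T (transverseFactor o W T) n :=
  funext fun p => transverseFactor_eq_of_areaForm_fderiv o (h0 p)
    (hd.areaForm_fderiv_iterate o hT h0 n p)

end PreservesDirection

end Iterates

section PolynomialGrowth

theorem exists_pow_le_mul_rpow {R : ℝ} (hR : 1 < R) {x : ℝ} (hx : 1 ≤ x) :
    ∃ n : ℕ, x ≤ 2 ^ n ∧ R ^ n ≤ R * x ^ Real.logb 2 R := by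
  have hR0 : 0 < R := one_pos.trans hR
  have hx0 : 0 < x := one_pos.trans_le hx
  have hx2 : (2 : ℝ) ^ Real.logb 2 x = x := Real.rpow_logb two_pos (by norm_num) hx0
  have hcomm : R ^ Real.logb 2 x = x ^ Real.logb 2 R := by
    conv_lhs => rw [← Real.rpow_logb two_pos (by norm_num) hR0]
    rw [← Real.rpow_mul two_pos.le, mul_comm, Real.rpow_mul two_pos.le, hx2]
  refine ⟨⌈Real.logb 2 x⌉₊, ?_, ?_⟩
  · rw [← Real.rpow_natCast, ← hx2]
    conv_rhs => rw [hx2]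
    exact Real.rpow_le_rpow_of_exponent_le one_le_two (Nat.le_ceil _)
  · calc R ^ ⌈Real.logb 2 x⌉₊ = R ^ (⌈Real.logb 2 x⌉₊ : ℝ) := (Real.rpow_natCast _ _).symm
      _ ≤ R ^ (Real.logb 2 x + 1) := Real.rpow_le_rpow_of_exponent_le hR.le
          (Nat.ceil_lt_add_one (Real.logb_nonneg one_lt_two hx)).le
      _ = R * x ^ Real.logb 2 R := by rw [Real.rpow_add_one hR0.ne', hcomm, mul_comm]

theorem exists_le_mul_rpow_of_halving {X : Type*} {f : X → ℝ → ℝ} {K R : ℝ} (hK : 0 < K)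
    (hR : 1 < R) (hf : ∀ p s, |s| ≤ 1 → f p s ≤ K)
    (hhalf : ∀ p s, ∃ q s', |s'| ≤ |s| / 2 ∧ f p s ≤ R * f q s') :
    ∃ C β : ℝ, 0 < C ∧ 0 < β ∧ ∀ p s, f p s ≤ C * max 1 |s| ^ β := by
  have hpow : ∀ (n : ℕ) (p : X) (s : ℝ), |s| ≤ 2 ^ n → f p s ≤ R ^ n * K := by
    intro n
    induction n with
    | zero => exact fun p s hs => by simpa using hf p s (by simpa using hs)
    | succ n ih =>
      intro p s hs
      obtain ⟨q, s', hs', hfs⟩ := hhalf p s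
      rw [pow_succ', mul_assoc]
      refine hfs.trans (mul_le_mul_of_nonneg_left (ih q s' ?_) (one_pos.trans hR).le)
      rw [pow_succ] at hs
      linarith
  refine ⟨R * K, Real.logb 2 R, by positivity, Real.logb_pos one_lt_two hR, fun p s => ?_⟩
  obtain ⟨n, hn, hRn⟩ := exists_pow_le_mul_rpow hR (le_max_left 1 |s|)
  calc f p s ≤ R ^ n * K := hpow n p s ((le_max_right _ _).trans hn)
    _ ≤ R * max 1 |s| ^ Real.logb 2 R * K := by gcongr
    _ = R * K * max 1 |s| ^ Real.logb 2 R := by ring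

variable {E : Type*} [NormedAddCommGroup E] [InnerProductSpace ℝ E]
  [Fact (Module.finrank ℝ E = 2)] (o : Orientation ℝ E (Fin 2)) {W T : E → E} {Φ : Flow ℝ E}

-- The Jacobian at time `s` is comparable to the Jacobian at a time at most `s / 2` along the image
-- orbit, so doubling the time multiplies it by at most a constant.
theorem IsC1Flow.exists_flowJacobian_le (h : IsC1Flow W Φ) (h0 : ∀ p, W p ≠ 0)
    (hT : ContDiff ℝ 1 T) (hd : PreservesDirection W T) (hσ : ∀ p, |speedFactor W T p| ≤ 1 / 2)
    {D c₁ c₂ : ℝ} (hD : ∀ p, |divergence W p| ≤ D) (hc₁ : 0 < c₁)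
    (hm₁ : ∀ p, c₁ ≤ |transverseFactor o W T p|) (hm₂ : ∀ p, |transverseFactor o W T p| ≤ c₂) :
    ∃ C β : ℝ, 0 < C ∧ 0 < β ∧ ∀ p s, flowJacobian W Φ p s ≤ C * max 1 |s| ^ β := by
  have hJ : ∀ p s, 0 < flowJacobian W Φ p s := flowJacobian_pos
  have hc₂ : 0 < c₂ := hc₁.trans_le ((hm₁ 0).trans (hm₂ 0))
  have hstep : ∀ p s, flowJacobian W Φ p s ≤
      c₂ / c₁ * flowJacobian W Φ (T p) (imageTime W T Φ p s) := fun p s => by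
    rw [div_mul_eq_mul_div, le_div_iff₀ hc₁]
    calc flowJacobian W Φ p s * c₁ ≤ flowJacobian W Φ p s * |transverseFactor o W T (Φ s p)| :=
          mul_le_mul_of_nonneg_left (hm₁ _) (hJ _ _).le
      _ = |transverseFactor o W T p| * flowJacobian W Φ (T p) (imageTime W T Φ p s) := by
          have := congrArg abs (h.flowJacobian_mul_transverseFactor o h0 hT hd hσ p s)
          rwa [abs_mul, abs_mul, abs_of_pos (hJ _ _), abs_of_pos (hJ _ _)] at this
      _ ≤ c₂ * flowJacobian W Φ (T p) (imageTime W T Φ p s) :=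
          mul_le_mul_of_nonneg_right (hm₂ _) (hJ _ _).le
  have htime : ∀ p s, |imageTime W T Φ p s| ≤ |s| / 2 := fun p s => by
    have := Intertwines.abs_sub_le hσ (h.hasDerivAt_imageTime h0 hT p) s 0
    rw [imageTime_zero, sub_zero, sub_zero] at this
    linarith
  refine exists_le_mul_rpow_of_halving (Real.exp_pos D) (R := c₂ / c₁ + 1)
    (lt_add_of_pos_left 1 (by positivity)) (fun p s hs => ?_) fun p s =>
    ⟨T p, imageTime W T Φ p s, htime p s, (hstep p s).trans ?_⟩
  · exact (flowJacobian_le_exp hD p s).trans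
      (Real.exp_le_exp.2 (mul_le_of_le_one_right ((abs_nonneg _).trans (hD 0)) hs))
  · exact mul_le_mul_of_nonneg_right (le_add_of_nonneg_right zero_le_one) (hJ _ _).le

end PolynomialGrowth

namespace IsC1Flow

variable {E : Type*} [NormedAddCommGroup E] [NormedSpace ℝ E] {W : E → E} {Φ : Flow ℝ E}

theorem exists_norm_fderiv_le (h : IsC1Flow W Φ) : ∃ L, ∀ p, ‖fderiv ℝ W p‖ ≤ L := by
  obtain ⟨L, hL⟩ := h.exists_lipschitz
  exact ⟨L, fun p => norm_fderiv_le_of_lipschitz ℝ hL⟩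

theorem exists_abs_divergence_le [FiniteDimensional ℝ E] (h : IsC1Flow W Φ) :
    ∃ D, ∀ p, |divergence W p| ≤ D := by
  obtain ⟨L, hL⟩ := h.exists_norm_fderiv_le
  exact ⟨_, fun p => ContinuousLinearMap.le_of_opNorm_le_of_le
    (LinearMap.trace ℝ E ∘ₗ ContinuousLinearMap.coeLM ℝ).toContinuousLinearMap le_rfl (hL p)⟩

end IsC1Flow

section ContractedFlow

variable {E : Type*} [NormedAddCommGroup E] [InnerProductSpace ℝ E]
  [Fact (Module.finrank ℝ E = 2)] (o : Orientation ℝ E (Fin 2))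

/-- `Φ` is the flow of a planar vector field `W` whose direction is preserved by a map `T` of class
`C^(k+1+η)` contracting it, and whose speed `‖W ·‖` is of class `C^(k+1+η)`. The contraction is
required only of an iterate of `T`; so is that of the multiplier in the cohomological equation
satisfied by `bending`. -/
structure IsContractedFlow (W T : E → E) (Φ : Flow ℝ E) (η : ℝ) (k : ℕ) : Prop
    extends IsC1Flow W Φ where
  exponent_mem : η ∈ Icc (0 : ℝ) 1
  exists_norm_le : ∃ M, ∀ p, ‖W p‖ ≤ M
  exists_le_norm : ∃ c > 0, ∀ p, c ≤ ‖W p‖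
  contDiff_map : ContDiff ℝ 1 T
  isUniformHolder_fderiv : IsUniformHolder η k (fderiv ℝ T)
  isUniformHolder_norm : IsUniformHolder η (k + 1) fun p => ‖W p‖
  preservesDirection : PreservesDirection W T
  exists_le_abs_transverseFactor : ∃ c > 0, ∀ p, c ≤ |transverseFactor o W T p|
  exists_cocycle_le : ∃ N, ∀ p, |cocycle T (speedFactor W T) N p| ≤ 1 / 2 ∧ |cocycle T
    (fun p => speedFactor W T p * speedFactor W T p * (transverseFactor o W T p)⁻¹) N p| ≤ 1 / 2

namespace IsContractedFlow

variable {o} {W T : E → E} {Φ : Flow ℝ E} {η : ℝ} {k j : ℕ}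

theorem ne_zero (h : IsContractedFlow o W T Φ η k) (p : E) : W p ≠ 0 := by
  obtain ⟨c, hc, hcW⟩ := h.exists_le_norm
  exact norm_pos_iff.1 (hc.trans_le (hcW p))

theorem transverseFactor_ne_zero (h : IsContractedFlow o W T Φ η k) (p : E) :
    transverseFactor o W T p ≠ 0 := by
  obtain ⟨c, hc, hcm⟩ := h.exists_le_abs_transverseFactor
  exact abs_pos.1 (hc.trans_le (hcm p))

theorem hasLeafDeriv_id (h : IsContractedFlow o W T Φ η k) : HasLeafDeriv Φ id W := h.hasDerivAt

theorem exists_norm_acceleration_le (h : IsContractedFlow o W T Φ η k) :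
    ∃ A, ∀ p, ‖acceleration W p‖ ≤ A := by
  obtain ⟨M, hM⟩ := h.exists_norm_le
  obtain ⟨L, hL⟩ := h.exists_norm_fderiv_le
  exact ⟨L * M, fun p => ContinuousLinearMap.le_of_opNorm_le_of_le _ (hL p) (hM p)⟩

theorem exists_abs_bending_le (h : IsContractedFlow o W T Φ η k) :
    ∃ K, ∀ p, |bending o W p| ≤ K := by
  obtain ⟨M, hM⟩ := h.exists_norm_le
  obtain ⟨A, hA⟩ := h.exists_norm_acceleration_le
  exact ⟨M * A, fun p => (o.abs_areaForm_le _ _).trans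
    (mul_le_mul (hM p) (hA p) (norm_nonneg _) ((norm_nonneg _).trans (hM p)))⟩

theorem isLeafwiseHolder_field_zero (h : IsContractedFlow o W T Φ η k) :
    IsLeafwiseHolder Φ η 0 W := by
  obtain ⟨M, hM⟩ := h.exists_norm_le
  obtain ⟨A, hA⟩ := h.exists_norm_acceleration_le
  have hM0 : 0 ≤ M := (norm_nonneg _).trans (hM 0)
  have hA0 : 0 ≤ A := (norm_nonneg _).trans (hA 0)
  exact ⟨2 * (M + A), by positivity, fun p => .zero_of_hasDerivAt h.exponent_mem convex_univ
    (fun s _ => (hM _).trans (le_add_of_nonneg_right hA0)) (fun s _ => h.hasDerivAt_field p s)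
    fun s _ => (hA _).trans (le_add_of_nonneg_left hM0)⟩

theorem isLeafwiseHolder_of_isUniformHolder (h : IsContractedFlow o W T Φ η k)
    (hW : IsLeafwiseHolder Φ η j W) {G : Type*} [NormedAddCommGroup G] [NormedSpace ℝ G]
    {f : E → G} {l : ℕ} (hf : IsUniformHolder η l f) (hj : j ≤ l) : IsLeafwiseHolder Φ η j f := by
  obtain ⟨M, hM⟩ := h.exists_norm_le
  exact hf.isLeafwiseHolder h.exponent_mem h.hasLeafDeriv_id hM
    (fun i hi => hW.of_le h.exponent_mem hi.le) hj

theorem isLeafwiseHolder_fderiv_of_isUniformHolder (h : IsContractedFlow o W T Φ η k)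
    (hW : IsLeafwiseHolder Φ η j W) {G : Type*} [NormedAddCommGroup G] [NormedSpace ℝ G]
    {f : E → G} {l : ℕ} (hf : IsUniformHolder η l f) (hj : j < l) :
    IsLeafwiseHolder Φ η j (fderiv ℝ f) := by
  obtain ⟨M, hM⟩ := h.exists_norm_le
  exact hf.isLeafwiseHolder_fderiv h.exponent_mem h.hasLeafDeriv_id hM
    (fun i hi => hW.of_le h.exponent_mem hi.le) hj

theorem isLeafwiseHolder_norm (h : IsContractedFlow o W T Φ η k) (hW : IsLeafwiseHolder Φ η j W)
    (hj : j ≤ k) : IsLeafwiseHolder Φ η j (fun p => ‖W p‖) :=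
  h.isLeafwiseHolder_of_isUniformHolder hW h.isUniformHolder_norm (hj.trans k.le_succ)

theorem isLeafwiseHolder_inv_norm_sq (h : IsContractedFlow o W T Φ η k)
    (hW : IsLeafwiseHolder Φ η j W) (hj : j ≤ k) :
    IsLeafwiseHolder Φ η j (fun p => (‖W p‖ ^ 2)⁻¹) := by
  obtain ⟨c, hc, hcW⟩ := h.exists_le_norm
  have hnorm := h.isLeafwiseHolder_norm hW hj
  simp only [pow_two]
  refine (hnorm.smul h.exponent_mem hnorm).inv h.exponent_mem (mul_pos hc hc) fun p => ?_
  rw [abs_mul, abs_norm]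
  exact mul_le_mul (hcW p) (hcW p) hc.le (norm_nonneg _)

theorem exists_abs_speedFactor_le (h : IsContractedFlow o W T Φ η k) :
    ∃ c, ∀ p, |speedFactor W T p| ≤ c := by
  obtain ⟨M, hM⟩ := h.exists_norm_le
  obtain ⟨c, hc, hcW⟩ := h.exists_le_norm
  obtain ⟨B, -, hDT⟩ := (h.isLeafwiseHolder_of_isUniformHolder h.isLeafwiseHolder_field_zero
    h.isUniformHolder_fderiv k.zero_le).exists_norm_le
  refine ⟨B * M / c, fun p => (le_div_iff₀ hc).2 ?_⟩
  calc |speedFactor W T p| * c ≤ |speedFactor W T p| * ‖W (T p)‖ := by gcongr; exact hcW _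
    _ = ‖fderiv ℝ T p (W p)‖ := by rw [h.preservesDirection p, norm_smul, Real.norm_eq_abs]
    _ ≤ B * M := ContinuousLinearMap.le_of_opNorm_le_of_le _ (hDT p) (hM p)

theorem intertwines (h : IsContractedFlow o W T Φ η k) : Intertwines Φ T (speedFactor W T) := by
  obtain ⟨c, hc⟩ := h.exists_abs_speedFactor_le
  exact h.toIsC1Flow.intertwines h.ne_zero h.contDiff_map h.preservesDirection hc

theorem isLeafwiseHolder_comp_of_speedFactor (h : IsContractedFlow o W T Φ η k)
    (hσ : ∀ i < j, IsLeafwiseHolder Φ η i (speedFactor W T)) {F : Type*} [NormedAddCommGroup F]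
    [NormedSpace ℝ F] {f : E → F} (hf : IsLeafwiseHolder Φ η j f) :
    IsLeafwiseHolder Φ η j (fun p => f (T p)) := by
  obtain ⟨c, hc⟩ := h.exists_abs_speedFactor_le
  exact h.intertwines.isLeafwiseHolder_comp h.exponent_mem hc hσ hf

theorem isLeafwiseHolder_speedFactor (h : IsContractedFlow o W T Φ η k)
    (hW : IsLeafwiseHolder Φ η j W) (hj : j ≤ k) : IsLeafwiseHolder Φ η j (speedFactor W T) := by
  have hη := h.exponent_mem
  induction j using Nat.strong_induction_on with
  | _ j ih =>
    have hσ : ∀ i < j, IsLeafwiseHolder Φ η i (speedFactor W T) := fun i hi =>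
      ih i hi (hW.of_le hη hi.le) (hi.le.trans hj)
    have hDT := h.isLeafwiseHolder_of_isUniformHolder hW h.isUniformHolder_fderiv hj
    exact ((hDT.apply hη hW).bilin (innerSL ℝ) hη
      (h.isLeafwiseHolder_comp_of_speedFactor hσ hW)).smul hη
      (h.isLeafwiseHolder_comp_of_speedFactor hσ (h.isLeafwiseHolder_inv_norm_sq hW hj))

theorem isLeafwiseHolder_comp (h : IsContractedFlow o W T Φ η k) (hW : IsLeafwiseHolder Φ η j W)
    (hj : j ≤ k) {F : Type*} [NormedAddCommGroup F] [NormedSpace ℝ F] {f : E → F}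
    (hf : IsLeafwiseHolder Φ η j f) : IsLeafwiseHolder Φ η j (fun p => f (T p)) :=
  h.isLeafwiseHolder_comp_of_speedFactor
    (fun _ hi => (h.isLeafwiseHolder_speedFactor hW hj).of_le h.exponent_mem hi.le) hf

theorem isLeafwiseHolder_rightAngleRotation (hW : IsLeafwiseHolder Φ η j W) :
    IsLeafwiseHolder Φ η j (fun p => o.rightAngleRotation (W p)) :=
  hW.clm_apply o.rightAngleRotation.toContinuousLinearEquiv.toContinuousLinearMap

theorem isLeafwiseHolder_transverseFactor (h : IsContractedFlow o W T Φ η k)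
    (hW : IsLeafwiseHolder Φ η j W) (hj : j ≤ k) :
    IsLeafwiseHolder Φ η j (transverseFactor o W T) := by
  have hη := h.exponent_mem
  have hDT := h.isLeafwiseHolder_of_isUniformHolder hW h.isUniformHolder_fderiv hj
  exact ((h.isLeafwiseHolder_comp hW hj hW).bilin o.areaForm' hη
    (hDT.apply hη (isLeafwiseHolder_rightAngleRotation hW))).smul hη
    (h.isLeafwiseHolder_inv_norm_sq hW hj)

theorem isLeafwiseHolder_inv_transverseFactor (h : IsContractedFlow o W T Φ η k)
    (hW : IsLeafwiseHolder Φ η j W) (hj : j ≤ k) :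
    IsLeafwiseHolder Φ η j (fun p => (transverseFactor o W T p)⁻¹) := by
  obtain ⟨c, hc, hcm⟩ := h.exists_le_abs_transverseFactor
  exact (h.isLeafwiseHolder_transverseFactor hW hj).inv h.exponent_mem hc hcm

theorem contDiff_two_map (h : IsContractedFlow o W T Φ η (k + 1)) : ContDiff ℝ 2 T := by
  have hDT : ContDiff ℝ 1 (fderiv ℝ T) :=
    h.isUniformHolder_fderiv.1.of_le (by exact_mod_cast k.succ_pos)
  rw [← one_add_one_eq_two, contDiff_succ_iff_fderiv]
  exact ⟨h.contDiff_map.differentiable one_ne_zero, by simp, hDT⟩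

theorem bending_cohomological (h : IsContractedFlow o W T Φ η k) (hT : ContDiff ℝ 2 T) (p : E) :
    o.areaForm (W (T p)) (fderiv ℝ (fderiv ℝ T) p (W p) (W p)) +
      transverseFactor o W T p * bending o W p =
      speedFactor W T p * speedFactor W T p * bending o W (T p) := by
  -- Differentiate `ω (W ∘ T) (DT W) = 0` along the orbit of `p`.
  have hd := h.preservesDirection
  have hWT : HasDerivAt (fun s => W (T (Φ s p)))
      (fderiv ℝ W (T (Φ 0 p)) (fderiv ℝ T (Φ 0 p) (W (Φ 0 p)))) 0 :=
    (h.contDiff.differentiable one_ne_zero _).hasFDerivAt.comp_hasDerivAt 0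
      ((hT.differentiable two_ne_zero _).hasFDerivAt.comp_hasDerivAt 0 (h.hasDerivAt p 0))
  have hDTW : HasDerivAt (fun s => fderiv ℝ T (Φ s p) (W (Φ s p)))
      (fderiv ℝ (fderiv ℝ T) (Φ 0 p) (W (Φ 0 p)) (W (Φ 0 p)) +
        fderiv ℝ T (Φ 0 p) (acceleration W (Φ 0 p))) 0 :=
    (((hT.fderiv_right (m := 1) le_rfl).differentiable one_ne_zero _).hasFDerivAt.comp_hasDerivAt
      0 (h.hasDerivAt p 0)).clm_apply (h.hasDerivAt_field p 0)
  have hder := o.areaForm'.hasDerivAt_of_bilinear (fun _ => hWT) (fun _ => hDTW)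
  have hzero : (fun s => o.areaForm' (W (T (Φ s p))) (fderiv ℝ T (Φ s p) (W (Φ s p)))) =
      fun _ => 0 := funext fun s => by
    change o.areaForm _ _ = 0
    rw [hd.areaForm_fderiv o (h.ne_zero _), o.areaForm_apply_self, mul_zero]
  rw [hzero] at hder
  have hsum := hder.unique (hasDerivAt_const 0 0)
  rw [Φ.map_zero_apply, hd p] at hsum
  have hbend := hd.areaForm_fderiv o (h.ne_zero p) (acceleration W p)
  simp only [o.areaForm'_apply, map_add, map_smul, LinearMap.coe_toContinuousLinearMap',
    smul_apply, smul_eq_mul, acceleration] at hsum hbend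
  rw [o.areaForm_swap (fderiv ℝ W (T p) (W (T p)))] at hsum
  simp only [bending, acceleration]
  linarith

theorem isLeafwiseHolder_bending (h : IsContractedFlow o W T Φ η k)
    (hW : IsLeafwiseHolder Φ η j W) (hj : j < k) : IsLeafwiseHolder Φ η j (bending o W) := by
  have hη := h.exponent_mem
  obtain ⟨k, rfl⟩ := Nat.exists_eq_succ_of_ne_zero (Nat.ne_zero_of_lt hj)
  obtain ⟨K, hK⟩ := h.exists_abs_bending_le
  obtain ⟨N, hN⟩ := h.exists_cocycle_le
  have hσ := h.isLeafwiseHolder_speedFactor hW hj.le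
  have hm := h.isLeafwiseHolder_inv_transverseFactor hW hj.le
  have hD2 := h.isLeafwiseHolder_fderiv_of_isUniformHolder hW h.isUniformHolder_fderiv hj
  have hforce : IsLeafwiseHolder Φ η j fun p => (-1 : ℝ) • (transverseFactor o W T p)⁻¹ •
      o.areaForm' (W (T p)) (fderiv ℝ (fderiv ℝ T) p (W p) (W p)) :=
    (IsLeafwiseHolder.const (-1 : ℝ)).smul hη (hm.smul hη
      ((h.isLeafwiseHolder_comp hW hj.le hW).bilin o.areaForm' hη ((hD2.apply hη hW).apply hη hW)))
  refine h.intertwines.isLeafwiseHolder_of_cohomological_iterate hη hσ hforce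
    ((hσ.smul hη hσ).smul hη hm) (fun p => (hN p).1.trans (by norm_num)) (fun p => (hN p).2) hK
    (fun p => (h.continuous_bending o).comp (by fun_prop)) fun p => ?_
  have hne := h.transverseFactor_ne_zero p
  have hcoh := h.bending_cohomological h.contDiff_two_map p
  change bending o W p = -1 * ((transverseFactor o W T p)⁻¹ *
    o.areaForm (W (T p)) (fderiv ℝ (fderiv ℝ T) p (W p) (W p))) +
      speedFactor W T p * speedFactor W T p * (transverseFactor o W T p)⁻¹ * bending o W (T p)
  field_simp
  linarith

theorem inner_fderiv_field (h : IsContractedFlow o W T Φ η k) (p v : E) :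
    inner ℝ (W p) (fderiv ℝ W p v) = ‖W p‖ * fderiv ℝ (fun p => ‖W p‖) p v := by
  have hnorm : DifferentiableAt ℝ (fun p => ‖W p‖) p :=
    h.isUniformHolder_norm.1.differentiable (by norm_cast) p
  have hsq := congrArg (fun A : E →L[ℝ] ℝ => A v)
    ((h.contDiff.differentiable one_ne_zero p).hasFDerivAt.norm_sq.unique (hnorm.hasFDerivAt.pow 2))
  simpa [mul_assoc] using hsq

theorem isLeafwiseHolder_inner_fderiv_field (h : IsContractedFlow o W T Φ η k)
    (hW : IsLeafwiseHolder Φ η j W) (hj : j ≤ k) {u : E → E} (hu : IsLeafwiseHolder Φ η j u) :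
    IsLeafwiseHolder Φ η j fun p => inner ℝ (W p) (fderiv ℝ W p (u p)) := by
  simp only [h.inner_fderiv_field]
  exact (h.isLeafwiseHolder_norm hW hj).smul h.exponent_mem
    ((h.isLeafwiseHolder_fderiv_of_isUniformHolder hW h.isUniformHolder_norm
      (Nat.lt_succ_of_le hj)).apply h.exponent_mem hu)

theorem isLeafwiseHolder_field_succ (h : IsContractedFlow o W T Φ η k)
    (hW : IsLeafwiseHolder Φ η j W) (hj : j < k) : IsLeafwiseHolder Φ η (j + 1) W := by
  have hη := h.exponent_mem
  obtain ⟨M, hM⟩ := h.exists_norm_le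
  have hinv := h.isLeafwiseHolder_inv_norm_sq hW hj.le
  refine .of_hasLeafDeriv hM h.hasDerivAt_field ?_
  rw [← funext fun p => inner_smul_add_areaForm_smul o (h.ne_zero p) (acceleration W p)]
  exact (((h.isLeafwiseHolder_inner_fderiv_field hW hj.le hW).smul hη hinv).smul hη hW).add
    (((h.isLeafwiseHolder_bending hW hj).smul hη hinv).smul hη
      (isLeafwiseHolder_rightAngleRotation hW))

theorem isLeafwiseHolder_field (h : IsContractedFlow o W T Φ η k) (hj : j ≤ k) :
    IsLeafwiseHolder Φ η j W := by
  induction j with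
  | zero => exact h.isLeafwiseHolder_field_zero
  | succ j ih => exact h.isLeafwiseHolder_field_succ (ih (j.le_succ.trans hj)) hj

theorem isLeafwiseHolder_divergence (h : IsContractedFlow o W T Φ η k) (hj : j < k) :
    IsLeafwiseHolder Φ η j (divergence W) := by
  have := FiniteDimensional.of_fact_finrank_eq_two (K := ℝ) (V := E)
  have hη := h.exponent_mem
  obtain ⟨D, hD⟩ := h.exists_abs_divergence_le
  obtain ⟨N, hN⟩ := h.exists_cocycle_le
  obtain ⟨c, hc⟩ := h.exists_abs_speedFactor_le
  have hW := h.isLeafwiseHolder_field hj.le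
  have hσ := h.isLeafwiseHolder_speedFactor hW hj.le
  obtain ⟨m', hmm', hm'⟩ := (h.isLeafwiseHolder_transverseFactor
    (h.isLeafwiseHolder_field (Nat.succ_le_of_lt hj)) hj).exists_hasLeafDeriv
  have hforce : IsLeafwiseHolder Φ η j fun p => (-1 : ℝ) • (transverseFactor o W T p)⁻¹ • m' p :=
    (IsLeafwiseHolder.const (-1 : ℝ)).smul hη
      ((h.isLeafwiseHolder_inv_transverseFactor hW hj.le).smul hη hm')
  refine h.intertwines.isLeafwiseHolder_of_cohomological_iterate hη hσ hforce hσ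
    (fun p => (hN p).1.trans (by norm_num)) (fun p => (hN p).1) hD
    (fun p => h.continuous_divergence.comp (by fun_prop)) fun p => ?_
  have hne := h.transverseFactor_ne_zero p
  have hcoh := h.divergence_cohomological o h.ne_zero h.contDiff_map h.preservesDirection hc hmm' p
  simp only [smul_eq_mul]
  field_simp
  linarith

theorem isLeafwiseHolder_shear (h : IsContractedFlow o W T Φ η k) (hj : j < k) :
    IsLeafwiseHolder Φ η j (shear o W) := by
  have hW := h.isLeafwiseHolder_field hj.le
  exact ((h.isLeafwiseHolder_inner_fderiv_field hW hj.le
    (isLeafwiseHolder_rightAngleRotation hW)).add (h.isLeafwiseHolder_bending hW hj)).smul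
    h.exponent_mem (h.isLeafwiseHolder_inv_norm_sq hW hj.le)

theorem exists_abs_shear_le (h : IsContractedFlow o W T Φ η k) : ∃ S, ∀ p, |shear o W p| ≤ S := by
  obtain ⟨K, hK⟩ := h.exists_abs_bending_le
  have hW := h.isLeafwiseHolder_field k.zero_le
  obtain ⟨I, hI, hinner⟩ := (h.isLeafwiseHolder_inner_fderiv_field hW k.zero_le
    (isLeafwiseHolder_rightAngleRotation hW)).exists_norm_le
  obtain ⟨R, -, hR⟩ := (h.isLeafwiseHolder_inv_norm_sq hW k.zero_le).exists_norm_le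
  refine ⟨(I + K) * R, fun p => ?_⟩
  rw [shear, div_eq_mul_inv, abs_mul]
  exact mul_le_mul ((abs_add_le _ _).trans (add_le_add (hinner p) (hK p))) (hR p) (abs_nonneg _)
    (add_nonneg hI ((abs_nonneg _).trans (hK p)))

end IsContractedFlow

end ContractedFlow

section PolynomialGrowth

theorem add_mul_rpow_max_le {C C' t β β' : ℝ} (hC : 0 ≤ C) (hC' : 0 ≤ C') (hβ : 0 ≤ β)
    (hβ' : 0 ≤ β') :
    C * max 1 t ^ β + C' * max 1 t ^ β' ≤ (C + C') * max 1 t ^ (β + β') := by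
  rw [add_mul]
  gcongr <;> first | exact le_max_left 1 t | linarith

variable {X E F G : Type*} [NormedAddCommGroup E]

/-- A family of curves `f x : ℝ → E` grows at most polynomially in forward time, uniformly over the
family. -/
def HasPolynomialGrowth (f : X → ℝ → E) : Prop :=
  ∃ C β : ℝ, 0 ≤ C ∧ 0 ≤ β ∧ ∀ x, ∀ s ≥ 0, ‖f x s‖ ≤ C * max 1 s ^ β

namespace HasPolynomialGrowth

theorem exists_norm_le_of_le {f : X → ℝ → E} (hf : HasPolynomialGrowth f) :
    ∃ C β : ℝ, 0 ≤ C ∧ 0 ≤ β ∧ ∀ x s t, 0 ≤ s → s ≤ t → ‖f x s‖ ≤ C * max 1 t ^ β := by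
  obtain ⟨C, β, hC, hβ, hf⟩ := hf
  exact ⟨C, β, hC, hβ, fun x s t hs hst => (hf x s hs).trans (by gcongr)⟩

theorem of_bounded {f : X → ℝ → E} {B : ℝ} (hf : ∀ x s, ‖f x s‖ ≤ B) : HasPolynomialGrowth f :=
  ⟨|B|, 0, abs_nonneg B, le_rfl, fun x s _ => by
    rw [Real.rpow_zero, mul_one]
    exact (hf x s).trans (le_abs_self B)⟩

variable [NormedSpace ℝ E]

theorem smul {f : X → ℝ → ℝ} {g : X → ℝ → E} (hf : HasPolynomialGrowth f)
    (hg : HasPolynomialGrowth g) : HasPolynomialGrowth fun x s => f x s • g x s := by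
  obtain ⟨C, β, hC, hβ, hf⟩ := hf
  obtain ⟨C', β', hC', hβ', hg⟩ := hg
  refine ⟨C * C', β + β', by positivity, by positivity, fun x s hs => ?_⟩
  calc ‖f x s • g x s‖ = ‖f x s‖ * ‖g x s‖ := norm_smul _ _
    _ ≤ (C * max 1 s ^ β) * (C' * max 1 s ^ β') := by gcongr; exacts [hf x s hs, hg x s hs]
    _ = C * C' * max 1 s ^ (β + β') := by rw [Real.rpow_add (by positivity)]; ring

theorem of_hasDerivAt {f g : X → ℝ → E} (hg : HasPolynomialGrowth g) (h0 : ∀ x, f x 0 = 0)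
    (hfg : ∀ x s, HasDerivAt (f x) (g x s) s) : HasPolynomialGrowth f := by
  obtain ⟨C, β, hC, hβ, hg⟩ := hg.exists_norm_le_of_le
  refine ⟨C, β + 1, hC, by positivity, fun x t ht => ?_⟩
  have hmvt := norm_image_sub_le_of_norm_deriv_right_le_segment
    (fun s _ => (hfg x s).continuousAt.continuousWithinAt)
    (fun s _ => (hfg x s).hasDerivWithinAt) (fun s hs => hg x s t hs.1 hs.2.le) t ⟨ht, le_rfl⟩
  calc ‖f x t‖ ≤ C * max 1 t ^ β * t := by simpa only [h0, sub_zero] using hmvt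
    _ ≤ C * max 1 t ^ β * max 1 t := by gcongr; exact le_max_right 1 t
    _ = C * max 1 t ^ (β + 1) := by rw [Real.rpow_add_one (by positivity), mul_assoc]

end HasPolynomialGrowth

variable [NormedSpace ℝ E] [NormedAddCommGroup F] [NormedSpace ℝ F] [NormedAddCommGroup G]
  [NormedSpace ℝ G] {η : ℝ} {k : ℕ}

/-- A family of curves `f x : ℝ → E` is of class `C^(k+η)` on each interval `(0, t)`, with norm at
most polynomial in `t`, uniformly over the family. -/
def HasHolderPolynomialGrowth (η : ℝ) (k : ℕ) (f : X → ℝ → E) : Prop :=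
  ∃ C β : ℝ, 0 ≤ C ∧ 0 ≤ β ∧ ∀ x t, IsHolderCurve η k (C * max 1 t ^ β) (Ioo 0 t) (f x)

namespace HasHolderPolynomialGrowth

theorem add {f g : X → ℝ → E} (hf : HasHolderPolynomialGrowth η k f)
    (hg : HasHolderPolynomialGrowth η k g) :
    HasHolderPolynomialGrowth η k fun x s => f x s + g x s := by
  obtain ⟨C, β, hC, hβ, hf⟩ := hf
  obtain ⟨C', β', hC', hβ', hg⟩ := hg
  exact ⟨C + C', β + β', by positivity, by positivity, fun x t =>
    ((hf x t).add (hg x t)).mono (add_mul_rpow_max_le hC hC' hβ hβ') Subset.rfl⟩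

theorem bilin (b : E →L[ℝ] F →L[ℝ] G) (hη : η ∈ Icc (0 : ℝ) 1) {f : X → ℝ → E} {g : X → ℝ → F}
    (hf : HasHolderPolynomialGrowth η k f) (hg : HasHolderPolynomialGrowth η k g) :
    HasHolderPolynomialGrowth η k fun x s => b (f x s) (g x s) := by
  obtain ⟨C, β, hC, hβ, hf⟩ := hf
  obtain ⟨C', β', hC', hβ', hg⟩ := hg
  refine ⟨2 * 4 ^ k * (‖b‖ * C * C'), β + β', by positivity, by positivity, fun x t =>
    (IsHolderCurve.bilin b hη (convex_Ioo 0 t) (by positivity) (by positivity) (hf x t)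
      (hg x t)).mono (le_of_eq ?_) Subset.rfl⟩
  rw [Real.rpow_add (by positivity)]
  ring

theorem smul (hη : η ∈ Icc (0 : ℝ) 1) {f : X → ℝ → ℝ} {g : X → ℝ → E}
    (hf : HasHolderPolynomialGrowth η k f) (hg : HasHolderPolynomialGrowth η k g) :
    HasHolderPolynomialGrowth η k fun x s => f x s • g x s :=
  hf.bilin (ContinuousLinearMap.lsmul ℝ ℝ) hη hg

theorem const {g : X → E} {B : ℝ} (hg : ∀ x, ‖g x‖ ≤ B) :
    HasHolderPolynomialGrowth η k fun x (_ : ℝ) => g x :=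
  ⟨|B|, 0, abs_nonneg B, le_rfl, fun x t => (IsHolderCurve.const (I := Ioo 0 t) (g x)).mono
    (by simpa using (hg x).trans (le_abs_self B)) Subset.rfl⟩

theorem zero_of_hasDerivAt (hη : η ∈ Icc (0 : ℝ) 1) {f g : X → ℝ → E}
    (hf : HasPolynomialGrowth f) (hg : HasPolynomialGrowth g)
    (hfg : ∀ x s, HasDerivAt (f x) (g x s) s) : HasHolderPolynomialGrowth η 0 f := by
  obtain ⟨C, β, hC, hβ, hf⟩ := hf.exists_norm_le_of_le
  obtain ⟨C', β', hC', hβ', hg⟩ := hg.exists_norm_le_of_le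
  refine ⟨2 * (C + C'), β + β', by positivity, by positivity, fun x t => ?_⟩
  have hle := add_mul_rpow_max_le (t := t) hC hC' hβ hβ'
  have h₁ : 0 ≤ C * max 1 t ^ β := by positivity
  have h₂ : 0 ≤ C' * max 1 t ^ β' := by positivity
  rw [mul_assoc]
  exact .zero_of_hasDerivAt hη (convex_Ioo 0 t)
    (fun s hs => (hf x s t hs.1.le hs.2.le).trans (by linarith)) (fun s _ => hfg x s)
    fun s hs => (hg x s t hs.1.le hs.2.le).trans (by linarith)

theorem succ_of_hasDerivAt {f g : X → ℝ → E} (hf : HasPolynomialGrowth f)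
    (hg : HasHolderPolynomialGrowth η k g) (hfg : ∀ x s, HasDerivAt (f x) (g x s) s) :
    HasHolderPolynomialGrowth η (k + 1) f := by
  obtain ⟨C, β, hC, hβ, hf⟩ := hf.exists_norm_le_of_le
  obtain ⟨C', β', hC', hβ', hg⟩ := hg
  refine ⟨C + C', β + β', by positivity, by positivity, fun x t => ?_⟩
  have hle := add_mul_rpow_max_le (t := t) hC hC' hβ hβ'
  have h₁ : 0 ≤ C * max 1 t ^ β := by positivity
  have h₂ : 0 ≤ C' * max 1 t ^ β' := by positivity
  exact ⟨fun s hs => (hf x s t hs.1.le hs.2.le).trans (by linarith), g x, fun s _ => hfg x s,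
    (hg x t).mono (by linarith) Subset.rfl⟩

theorem exists_holderNormOn_le {ρ : ℝ} {f : X → ℝ → E}
    (hf : HasHolderPolynomialGrowth (ρ - ⌊ρ⌋₊) ⌊ρ⌋₊ f) :
    ∃ C β : ℝ, 0 < C ∧ 0 < β ∧ ∀ x t, ContDiffOn ℝ (⌊ρ⌋₊ : ℕ) (f x) (Ioo 0 t) ∧
      holderNormOn ρ (Ioo 0 t) (f x) ≤ ENNReal.ofReal (C * max 1 t ^ β) := by
  obtain ⟨C, β, hC, hβ, hf⟩ := hf
  set S : ℝ := ∑ j ∈ Finset.range (⌊ρ⌋₊ + 1), 2 ^ (⌊ρ⌋₊ - j) + 1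
  refine ⟨S * (C + 1), β + 1, by positivity, by positivity, fun x t =>
    ⟨(hf x t).contDiffOn isOpen_Ioo, ?_⟩⟩
  refine ((hf x t).holderNormOn_le isOpen_Ioo (by positivity)).trans (ENNReal.ofReal_le_ofReal ?_)
  rw [mul_assoc]
  gcongr
  exacts [le_add_of_nonneg_right zero_le_one, le_max_left 1 t, le_add_of_nonneg_right zero_le_one]

end HasHolderPolynomialGrowth

theorem IsLeafwiseHolder.hasHolderPolynomialGrowth [TopologicalSpace X] {Φ : Flow ℝ X} {f : X → E}
    (hf : IsLeafwiseHolder Φ η k f) : HasHolderPolynomialGrowth η k fun x s => f (Φ s x) := by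
  obtain ⟨B, hB, hf⟩ := hf
  exact ⟨B, 0, hB, le_rfl, fun x t => (hf x).mono (by simp) (subset_univ _)⟩

end PolynomialGrowth

namespace IsContractedFlow

variable {E : Type*} [NormedAddCommGroup E] [InnerProductSpace ℝ E]
  [Fact (Module.finrank ℝ E = 2)] {o : Orientation ℝ E (Fin 2)} {W T : E → E} {Φ : Flow ℝ E}
  {η : ℝ} {k j : ℕ}

theorem hasPolynomialGrowth_flowJacobian (h : IsContractedFlow o W T Φ η k) :
    HasPolynomialGrowth (flowJacobian W Φ) := by
  have := FiniteDimensional.of_fact_finrank_eq_two (K := ℝ) (V := E)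
  have hd := h.preservesDirection
  have hT := h.contDiff_map
  obtain ⟨D, hD⟩ := h.exists_abs_divergence_le
  obtain ⟨c₁, hc₁, hm₁⟩ := h.exists_le_abs_transverseFactor
  obtain ⟨c₂, -, hm₂⟩ := (h.isLeafwiseHolder_transverseFactor h.isLeafwiseHolder_field_zero
    k.zero_le).exists_norm_le
  obtain ⟨N, hN⟩ := h.exists_cocycle_le
  obtain ⟨C, β, hC, hβ, hJ⟩ := h.exists_flowJacobian_le o h.ne_zero (contDiff_iterate hT N)
    (hd.iterate hT h.ne_zero N)
    (fun p => by rw [hd.speedFactor_iterate hT h.ne_zero]; exact (hN p).1)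
    hD (pow_pos hc₁ N)
    (fun p => by
      rw [hd.transverseFactor_iterate o hT h.ne_zero]; exact pow_le_abs_cocycle hc₁.le hm₁ N p)
    fun p => by
      rw [hd.transverseFactor_iterate o hT h.ne_zero]; exact abs_cocycle_le_pow hm₂ N p
  refine ⟨C, β, hC.le, hβ.le, fun p s hs => ?_⟩
  rw [Real.norm_of_nonneg (flowJacobian_pos p s).le]
  simpa only [abs_of_nonneg hs] using hJ p s

theorem hasHolderPolynomialGrowth_flowJacobian (h : IsContractedFlow o W T Φ η k) (hj : j ≤ k) :
    HasHolderPolynomialGrowth η j (flowJacobian W Φ) := by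
  have := FiniteDimensional.of_fact_finrank_eq_two (K := ℝ) (V := E)
  have hη := h.exponent_mem
  have hJ := h.hasPolynomialGrowth_flowJacobian
  induction j with
  | zero =>
    obtain ⟨D, hD⟩ := h.exists_abs_divergence_le
    exact .zero_of_hasDerivAt hη hJ (hJ.smul (.of_bounded fun p s => hD (Φ s p)))
      h.hasDerivAt_flowJacobian
  | succ j ih =>
    exact .succ_of_hasDerivAt hJ ((ih (j.le_succ.trans hj)).smul hη
      (h.isLeafwiseHolder_divergence hj).hasHolderPolynomialGrowth) h.hasDerivAt_flowJacobian

theorem exists_norm_norm_sq_le (h : IsContractedFlow o W T Φ η k) :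
    ∃ B, ∀ p, ‖‖W p‖ ^ 2‖ ≤ B := by
  obtain ⟨M, hM⟩ := h.exists_norm_le
  refine ⟨M ^ 2, fun p => ?_⟩
  rw [norm_pow, norm_norm]
  gcongr
  exact hM p

theorem hasPolynomialGrowth_flowNormal (h : IsContractedFlow o W T Φ η k) :
    HasPolynomialGrowth (flowNormal W Φ) := by
  obtain ⟨B, hB⟩ := h.exists_norm_norm_sq_le
  obtain ⟨R, -, hR⟩ := (h.isLeafwiseHolder_inv_norm_sq h.isLeafwiseHolder_field_zero
    k.zero_le).exists_norm_le
  unfold flowNormal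
  simp only [div_eq_mul_inv]
  exact (h.hasPolynomialGrowth_flowJacobian.smul (.of_bounded fun p _ => hB p)).smul
    (.of_bounded fun p s => hR (Φ s p))

theorem hasHolderPolynomialGrowth_flowNormal (h : IsContractedFlow o W T Φ η k) (hj : j ≤ k) :
    HasHolderPolynomialGrowth η j (flowNormal W Φ) := by
  have hη := h.exponent_mem
  obtain ⟨B, hB⟩ := h.exists_norm_norm_sq_le
  unfold flowNormal
  simp only [div_eq_mul_inv]
  exact ((h.hasHolderPolynomialGrowth_flowJacobian hj).smul hη (.const hB)).smul hη
    (h.isLeafwiseHolder_inv_norm_sq (h.isLeafwiseHolder_field hj) hj).hasHolderPolynomialGrowth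

theorem hasHolderPolynomialGrowth_flowShear (h : IsContractedFlow o W T Φ η k) :
    HasHolderPolynomialGrowth η k (flowShear o W Φ) := by
  have := FiniteDimensional.of_fact_finrank_eq_two (K := ℝ) (V := E)
  have hη := h.exponent_mem
  obtain ⟨S, hS⟩ : ∃ S, ∀ p, ‖shear o W p‖ ≤ S := h.exists_abs_shear_le
  have hder := h.hasDerivAt_flowShear o h.ne_zero
  have hrate := h.hasPolynomialGrowth_flowNormal.smul (.of_bounded fun p s => hS (Φ s p))
  have hgrowth : HasPolynomialGrowth (flowShear o W Φ) :=
    hrate.of_hasDerivAt (fun p => intervalIntegral.integral_same) hder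
  cases k with
  | zero => exact .zero_of_hasDerivAt hη hgrowth hrate hder
  | succ k =>
    exact .succ_of_hasDerivAt hgrowth ((h.hasHolderPolynomialGrowth_flowNormal k.le_succ).smul hη
      (h.isLeafwiseHolder_shear k.lt_succ_self).hasHolderPolynomialGrowth) hder

theorem hasHolderPolynomialGrowth_flowDeriv (h : IsContractedFlow o W T Φ η k) :
    HasHolderPolynomialGrowth η k (flowDeriv o W Φ) := by
  have hη := h.exponent_mem
  obtain ⟨M, hM⟩ := h.exists_norm_le
  have hW := h.isLeafwiseHolder_field le_rfl
  obtain ⟨R, hR0, hR⟩ := (h.isLeafwiseHolder_inv_norm_sq hW le_rfl).exists_norm_le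
  have hframe := hW.hasHolderPolynomialGrowth
  have hframe' := (isLeafwiseHolder_rightAngleRotation (o := o) hW).hasHolderPolynomialGrowth
  have hcoframe : ∀ u : E → E, (∀ p, ‖u p‖ ≤ M) →
      HasHolderPolynomialGrowth η k fun p (_ : ℝ) => (‖W p‖ ^ 2)⁻¹ • innerSL ℝ (u p) :=
    fun u hu => .const fun p => by
      rw [norm_smul, innerSL_apply_norm]
      exact mul_le_mul (hR p) (hu p) (norm_nonneg _) hR0
  exact ((hcoframe W hM).bilin (ContinuousLinearMap.smulRightL ℝ E E) hη hframe).add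
    ((hcoframe _ fun p => (o.rightAngleRotation.norm_map _).trans_le (hM p)).bilin
      (ContinuousLinearMap.smulRightL ℝ E E) hη
      ((h.hasHolderPolynomialGrowth_flowShear.smul hη hframe).add
        ((h.hasHolderPolynomialGrowth_flowNormal le_rfl).smul hη hframe')))

end IsContractedFlow

section TorusCovering

theorem torusProj_surjective : Function.Surjective torusProj := fun x => by
  choose y hy using fun i => QuotientAddGroup.mk_surjective (x i)
  exact ⟨WithLp.toLp 2 y, funext hy⟩

theorem torusProj_add (p q : Plane) : torusProj (p + q) = torusProj p + torusProj q :=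
  funext fun i => AddCircle.coe_add 1 (p i) (q i)

theorem torusProj_sub (p q : Plane) : torusProj (p - q) = torusProj p - torusProj q :=
  funext fun i => AddCircle.coe_sub 1 (p i) (q i)

/-- The vectors of the plane with integer coordinates, which form the kernel of the covering
projection. -/
def IsLatticeVector (q : Plane) : Prop := ∀ i, ∃ n : ℤ, q i = n

theorem torusProj_eq_zero_iff (q : Plane) : torusProj q = 0 ↔ IsLatticeVector q := by
  rw [funext_iff]
  refine forall_congr' fun i => (AddCircle.coe_eq_zero_iff 1).trans (exists_congr fun n => ?_)
  rw [zsmul_one, eq_comm]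

theorem torusProj_eq_iff (p q : Plane) : torusProj p = torusProj q ↔ IsLatticeVector (p - q) := by
  rw [← torusProj_eq_zero_iff, torusProj_sub, sub_eq_zero]

theorem exists_isLatticeVector_norm_sub_le (p : Plane) :
    ∃ q, IsLatticeVector q ∧ ‖p - q‖ ≤ 2 := by
  refine ⟨WithLp.toLp 2 fun i => (⌊p i⌋ : ℝ), fun i => ⟨⌊p i⌋, rfl⟩, ?_⟩
  have hfract : ∀ i, ‖Int.fract (p i)‖ ^ 2 ≤ 1 := fun i => pow_le_one₀ (norm_nonneg _) <| by
    rw [Real.norm_of_nonneg (Int.fract_nonneg _)]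
    exact (Int.fract_lt_one _).le
  rw [EuclideanSpace.norm_eq, Fin.sum_univ_two]
  exact Real.sqrt_le_iff.2 ⟨zero_le_two, (add_le_add (hfract 0) (hfract 1)).trans (by norm_num)⟩

/-- Invariance of a function on the plane under translations by integer vectors. -/
def LatticePeriodic {G : Type*} (f : Plane → G) : Prop :=
  ∀ p q, IsLatticeVector q → f (p + q) = f p

theorem latticePeriodic_comp_torusProj {G : Type*} (f : Torus2 → G) :
    LatticePeriodic fun p => f (torusProj p) := fun p q hq => by
  simp only [torusProj_add, (torusProj_eq_zero_iff q).2 hq, add_zero]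

namespace LatticePeriodic

theorem exists_norm_le {G : Type*} [NormedAddCommGroup G] {f : Plane → G}
    (hf : LatticePeriodic f) (hc : Continuous f) : ∃ B, ∀ p, ‖f p‖ ≤ B := by
  obtain ⟨B, hB⟩ := (isCompact_closedBall (0 : Plane) 2).exists_bound_of_continuousOn
    hc.continuousOn
  refine ⟨B, fun p => ?_⟩
  obtain ⟨q, hq, hpq⟩ := exists_isLatticeVector_norm_sub_le p
  rw [← sub_add_cancel p q, hf (p - q) q hq]
  exact hB _ (mem_closedBall_zero_iff.2 hpq)

variable {G : Type*} [NormedAddCommGroup G] [NormedSpace ℝ G] {f : Plane → G}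

protected theorem iteratedFDeriv (hf : LatticePeriodic f) (j : ℕ) :
    LatticePeriodic (iteratedFDeriv ℝ j f) := fun p q hq => by
  rw [← iteratedFDeriv_comp_add_right j q p, funext fun x => hf x q hq]

protected theorem fderiv (hf : LatticePeriodic f) : LatticePeriodic (fderiv ℝ f) :=
  fun p q hq => by rw [← fderiv_comp_add_right q, funext fun x => hf x q hq]

theorem isUniformHolder (hf : LatticePeriodic f) {η : ℝ} {k : ℕ} (hc : ContDiff ℝ k f) {K : ℝ}
    (hK : ∀ x y, ‖iteratedFDeriv ℝ k f x - iteratedFDeriv ℝ k f y‖ ≤ K * ‖x - y‖ ^ η) :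
    IsUniformHolder η k f := by
  choose B hB using fun j : Fin (k + 1) => (hf.iteratedFDeriv j).exists_norm_le
    (hc.continuous_iteratedFDeriv (by exact_mod_cast Nat.lt_succ_iff.1 j.2))
  have hB0 : ∀ j, 0 ≤ B j := fun j => (norm_nonneg _).trans (hB j 0)
  have hsum : 0 ≤ ∑ j, B j := Finset.sum_nonneg fun j _ => hB0 j
  refine ⟨hc, |K| + ∑ j, B j, by positivity, fun j hj x => ?_, fun x y => (hK x y).trans ?_⟩
  · calc ‖iteratedFDeriv ℝ j f x‖ ≤ B ⟨j, Nat.lt_succ_of_le hj⟩ := hB ⟨j, Nat.lt_succ_of_le hj⟩ x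
      _ ≤ ∑ j, B j := Finset.single_le_sum (fun j _ => hB0 j) (Finset.mem_univ _)
      _ ≤ |K| + ∑ j, B j := le_add_of_nonneg_left (abs_nonneg K)
  · gcongr
    exact (le_abs_self K).trans (le_add_of_nonneg_right hsum)

end LatticePeriodic

theorem eq_of_isLatticeVector {f : Plane → Plane} (hc : Continuous f)
    (hf : ∀ p, IsLatticeVector (f p)) (p q : Plane) : f p = f q := by
  ext i
  choose n hn using fun p => hf p i
  have hci : Continuous fun p => f p i := (EuclideanSpace.proj (𝕜 := ℝ) i).continuous.comp hc
  have hcn : Continuous n :=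
    Int.isClosedEmbedding_coe_real.isEmbedding.continuous_iff.2 (hci.congr hn)
  rw [hn p, hn q, PreconnectedSpace.constant inferInstance hcn]

theorem latticePeriodic_fderiv_of_lift {f : Torus2 → Torus2} {g : Plane → Plane}
    (hg : ∀ p, torusProj (g p) = f (torusProj p)) (hc : Continuous g) :
    LatticePeriodic (fderiv ℝ g) := fun p q hq => by
  have hlat : ∀ x, IsLatticeVector (g (x + q) - g x) := fun x => by
    rw [← torusProj_eq_iff, hg, hg, torusProj_add, (torusProj_eq_zero_iff q).2 hq, add_zero]
  have hconst : ∀ x, g (x + q) = g x + (g (p + q) - g p) := fun x => by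
    rw [eq_of_isLatticeVector (by fun_prop) hlat p x, add_sub_cancel]
  rw [← fderiv_comp_add_right q, funext hconst, fderiv_add_const]

end TorusCovering

section ContractedField

theorem cocycle_mul_mul_inv {X : Type*} (T : X → X) (a b : X → ℝ) (n : ℕ) (x : X) :
    cocycle T (fun x => a x * a x * (b x)⁻¹) n x =
      cocycle T a n x * cocycle T a n x * (cocycle T b n x)⁻¹ := by
  induction n generalizing x with
  | zero => simp [cocycle]
  | succ n ih => simp only [cocycle, ih, mul_inv]; ring

theorem exists_norm_fderiv_iterate_le {E : Type*} [NormedAddCommGroup E] [NormedSpace ℝ E]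
    {T : E → E} (hT : ContDiff ℝ 1 T) {S : ℝ} (hS : ∀ p, ‖fderiv ℝ T p‖ ≤ S) (n : ℕ) :
    ∃ S', ∀ p, ‖fderiv ℝ (T^[n]) p‖ ≤ S' := by
  induction n with
  | zero => exact ⟨1, fun p => by simpa using ContinuousLinearMap.norm_id_le⟩
  | succ n ih =>
    obtain ⟨S', hS'⟩ := ih
    refine ⟨S' * S, fun p => ?_⟩
    rw [fderiv_iterate_succ hT]
    exact (ContinuousLinearMap.opNorm_comp_le _ _).trans
      (mul_le_mul (hS' _) (hS p) (norm_nonneg _) ((norm_nonneg _).trans (hS' p)))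

variable {E : Type*} [NormedAddCommGroup E] [InnerProductSpace ℝ E]

theorem norm_mul_norm_map_le [Fact (Module.finrank ℝ E = 2)]
    (o : Orientation ℝ E (Fin 2)) (A : E →L[ℝ] E) (w u : E) :
    ‖w‖ * ‖A u‖ ≤ ‖A w‖ * ‖u‖ + ‖A‖ * |o.areaForm w u| := by
  rcases eq_or_ne w 0 with rfl | hw
  · simp
  have hpos : 0 < ‖w‖ := norm_pos_iff.2 hw
  have halong : ‖A ((inner ℝ w u / ‖w‖ ^ 2) • w)‖ ≤ ‖A w‖ * ‖u‖ / ‖w‖ := by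
    rw [map_smul, norm_smul, norm_div, norm_pow, norm_norm]
    calc ‖(inner ℝ w u : ℝ)‖ / ‖w‖ ^ 2 * ‖A w‖ ≤ ‖w‖ * ‖u‖ / ‖w‖ ^ 2 * ‖A w‖ := by
          gcongr; exact norm_inner_le_norm w u
      _ = ‖A w‖ * ‖u‖ / ‖w‖ := by field_simp
  have hacross : ‖A ((o.areaForm w u / ‖w‖ ^ 2) • o.rightAngleRotation w)‖ ≤
      ‖A‖ * |o.areaForm w u| / ‖w‖ := by
    refine (A.le_opNorm _).trans_eq ?_
    rw [norm_smul, LinearIsometryEquiv.norm_map, norm_div, norm_pow, norm_norm, Real.norm_eq_abs]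
    field_simp
  rw [mul_comm, ← le_div_iff₀ hpos, add_div]
  conv_lhs => rw [← inner_smul_add_areaForm_smul o hw u, map_add]
  exact (norm_add_le _ _).trans (add_le_add halong hacross)

/-- `T` is a uniformly hyperbolic map of the plane contracting the vector field `W` and expanding
the directions `Eu`. -/
structure IsContractedField (W T : E → E) (Eu : E → Submodule ℝ E) : Prop where
  exists_norm_le : ∃ M, ∀ p, ‖W p‖ ≤ M
  exists_le_norm : ∃ c > 0, ∀ p, c ≤ ‖W p‖
  contDiff_map : ContDiff ℝ 1 T
  exists_norm_fderiv_map_le : ∃ S, ∀ p, ‖fderiv ℝ T p‖ ≤ S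
  preservesDirection : PreservesDirection W T
  unstable_ne_bot : ∀ p, Eu p ≠ ⊥
  fderiv_mem_unstable : ∀ p, ∀ u ∈ Eu p, fderiv ℝ T p u ∈ Eu (T p)
  hyperbolic : ∃ C lam : ℝ, 0 < C ∧ 1 < lam ∧ ∀ (n : ℕ) (p : E),
    ‖fderiv ℝ (T^[n]) p (W p)‖ ≤ C * lam⁻¹ ^ n * ‖W p‖ ∧
      ∀ u ∈ Eu p, C⁻¹ * lam ^ n * ‖u‖ ≤ ‖fderiv ℝ (T^[n]) p u‖

namespace IsContractedField

variable {W T : E → E} {Eu : E → Submodule ℝ E}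

theorem ne_zero (h : IsContractedField W T Eu) (p : E) : W p ≠ 0 := by
  obtain ⟨c, hc, hcW⟩ := h.exists_le_norm
  exact norm_pos_iff.1 (hc.trans_le (hcW p))

theorem fderiv_iterate_mem_unstable (h : IsContractedField W T Eu) (n : ℕ) {p u : E}
    (hu : u ∈ Eu p) : fderiv ℝ (T^[n]) p u ∈ Eu (T^[n] p) := by
  induction n generalizing p u with
  | zero => simpa using hu
  | succ n ih =>
    rw [fderiv_iterate_succ h.contDiff_map, ContinuousLinearMap.comp_apply,
      Function.iterate_succ_apply]
    exact ih (h.fderiv_mem_unstable p u hu)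

theorem exists_abs_cocycle_speedFactor_le (h : IsContractedField W T Eu) {ε : ℝ} (hε : 0 < ε) :
    ∃ n, ∀ p, |cocycle T (speedFactor W T) n p| ≤ ε := by
  obtain ⟨M, hM⟩ := h.exists_norm_le
  obtain ⟨c, hc, hcW⟩ := h.exists_le_norm
  obtain ⟨C, lam, hC, hlam, hyp⟩ := h.hyperbolic
  have hM0 : 0 < M := hc.trans_le ((hcW 0).trans (hM 0))
  obtain ⟨n, hn⟩ := exists_pow_lt_of_lt_one (show 0 < ε * c / (C * M) by positivity)
    (inv_lt_one_of_one_lt₀ hlam)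
  rw [lt_div_iff₀ (by positivity)] at hn
  refine ⟨n, fun p => le_of_mul_le_mul_right ?_ hc⟩
  calc |cocycle T (speedFactor W T) n p| * c
      ≤ |cocycle T (speedFactor W T) n p| * ‖W (T^[n] p)‖ := by gcongr; exact hcW _
    _ = ‖fderiv ℝ (T^[n]) p (W p)‖ := by
      rw [h.preservesDirection.fderiv_iterate h.contDiff_map, norm_smul, Real.norm_eq_abs]
    _ ≤ C * lam⁻¹ ^ n * ‖W p‖ := (hyp n p).1
    _ ≤ C * lam⁻¹ ^ n * M := by gcongr; exact hM p
    _ ≤ ε * c := by linarith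

variable [Fact (Module.finrank ℝ E = 2)] (o : Orientation ℝ E (Fin 2))

-- An unstable vector almost parallel to `W` could not grow under an iterate expanding every
-- unstable vector more than it expands `W`.
theorem exists_mul_norm_le_abs_areaForm (h : IsContractedField W T Eu) :
    ∃ c > 0, ∀ p, ∀ u ∈ Eu p, c * ‖u‖ ≤ |o.areaForm (W p) u| := by
  obtain ⟨c₀, hc₀, hcW⟩ := h.exists_le_norm
  obtain ⟨C, lam, hC, hlam, hyp⟩ := h.hyperbolic
  obtain ⟨n, hn⟩ := pow_unbounded_of_one_lt (C * (C + 1)) hlam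
  obtain ⟨S₀, hS₀⟩ := h.exists_norm_fderiv_map_le
  obtain ⟨S, hS⟩ := exists_norm_fderiv_iterate_le h.contDiff_map hS₀ n
  have hS0 : 0 ≤ S := (norm_nonneg _).trans (hS 0)
  refine ⟨c₀ / (S + 1), by positivity, fun p u hu => ?_⟩
  obtain ⟨hstable, hunstable⟩ := hyp n p
  have hW : ‖fderiv ℝ (T^[n]) p (W p)‖ ≤ C * ‖W p‖ := hstable.trans <| by
    gcongr
    exact mul_le_of_le_one_right hC.le
      (pow_le_one₀ (by positivity) (inv_le_one_of_one_le₀ hlam.le))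
  have hu : (C + 1) * ‖u‖ ≤ ‖fderiv ℝ (T^[n]) p u‖ := le_trans (by
    gcongr
    rw [inv_mul_eq_div, le_div_iff₀ hC]
    linarith) (hunstable u hu)
  rw [div_mul_eq_mul_div, div_le_iff₀ (by positivity)]
  have hexpand : ‖W p‖ * ((C + 1) * ‖u‖) ≤
      C * ‖W p‖ * ‖u‖ + S * |o.areaForm (W p) u| :=
    calc ‖W p‖ * ((C + 1) * ‖u‖) ≤ ‖W p‖ * ‖fderiv ℝ (T^[n]) p u‖ := by gcongr
      _ ≤ ‖fderiv ℝ (T^[n]) p (W p)‖ * ‖u‖ + ‖fderiv ℝ (T^[n]) p‖ * |o.areaForm (W p) u| :=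
        norm_mul_norm_map_le o _ _ _
      _ ≤ C * ‖W p‖ * ‖u‖ + S * |o.areaForm (W p) u| := by gcongr; exact hS p
  have hspeed : c₀ * ‖u‖ ≤ ‖W p‖ * ‖u‖ := by gcongr; exact hcW p
  linarith [abs_nonneg (o.areaForm (W p) u)]

theorem exists_le_abs_cocycle_transverseFactor (h : IsContractedField W T Eu) :
    ∃ c > 0, ∀ n p, c ≤ |cocycle T (transverseFactor o W T) n p| := by
  obtain ⟨M, hM⟩ := h.exists_norm_le
  obtain ⟨c, hc, hcu⟩ := h.exists_mul_norm_le_abs_areaForm o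
  obtain ⟨C, lam, hC, hlam, hyp⟩ := h.hyperbolic
  have hM0 : 0 < M := (norm_pos_iff.2 (h.ne_zero 0)).trans_le (hM 0)
  refine ⟨c * C⁻¹ / M, by positivity, fun n p => ?_⟩
  obtain ⟨u, hu, hu0⟩ := Submodule.exists_mem_ne_zero_of_ne_bot (h.unstable_ne_bot p)
  have hgrow : C⁻¹ * ‖u‖ ≤ ‖fderiv ℝ (T^[n]) p u‖ := le_trans (by
    gcongr
    exact le_mul_of_one_le_right (by positivity) (one_le_pow₀ hlam.le)) ((hyp n p).2 u hu)
  rw [div_le_iff₀ hM0]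
  refine le_of_mul_le_mul_right ?_ (norm_pos_iff.2 hu0)
  calc c * C⁻¹ * ‖u‖ = c * (C⁻¹ * ‖u‖) := mul_assoc _ _ _
    _ ≤ c * ‖fderiv ℝ (T^[n]) p u‖ := by gcongr
    _ ≤ |o.areaForm (W (T^[n] p)) (fderiv ℝ (T^[n]) p u)| :=
      hcu _ _ (h.fderiv_iterate_mem_unstable n hu)
    _ = |cocycle T (transverseFactor o W T) n p| * |o.areaForm (W p) u| := by
      rw [h.preservesDirection.areaForm_fderiv_iterate o h.contDiff_map h.ne_zero, abs_mul]
    _ ≤ |cocycle T (transverseFactor o W T) n p| * (M * ‖u‖) := by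
      gcongr
      exact (o.abs_areaForm_le _ _).trans (by gcongr; exact hM p)
    _ = |cocycle T (transverseFactor o W T) n p| * M * ‖u‖ := (mul_assoc _ _ _).symm

theorem isContractedFlow (h : IsContractedField W T Eu) {Φ : Flow ℝ E} (hΦ : IsC1Flow W Φ) {η : ℝ}
    (hη : η ∈ Icc (0 : ℝ) 1) {k : ℕ} (hT : IsUniformHolder η k (fderiv ℝ T))
    (hW : IsUniformHolder η (k + 1) fun p => ‖W p‖) : IsContractedFlow o W T Φ η k := by
  obtain ⟨c, hc, hm⟩ := h.exists_le_abs_cocycle_transverseFactor o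
  obtain ⟨N, hN⟩ := h.exists_abs_cocycle_speedFactor_le (lt_min one_half_pos hc)
  have hspeed : ∀ p, |cocycle T (speedFactor W T) N p| ≤ 1 / 2 := fun p =>
    (hN p).trans (min_le_left _ _)
  refine { hΦ with
    exponent_mem := hη
    exists_norm_le := h.exists_norm_le
    exists_le_norm := h.exists_le_norm
    contDiff_map := h.contDiff_map
    isUniformHolder_fderiv := hT
    isUniformHolder_norm := hW
    preservesDirection := h.preservesDirection
    exists_le_abs_transverseFactor := ⟨c, hc, fun p => by simpa [cocycle] using hm 1 p⟩
    exists_cocycle_le := ⟨N, fun p => ⟨hspeed p, ?_⟩⟩ }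
  rw [cocycle_mul_mul_inv, abs_mul, abs_mul, abs_inv]
  calc |cocycle T (speedFactor W T) N p| * |cocycle T (speedFactor W T) N p| *
        |cocycle T (transverseFactor o W T) N p|⁻¹ ≤ 1 / 2 * c * c⁻¹ := by
        gcongr
        exacts [hspeed p, (hN p).trans (min_le_right _ _), hm N p]
    _ = 1 / 2 := mul_inv_cancel_right₀ hc.ne' _

end IsContractedField

end ContractedField

section AnosovLift

theorem exists_smul_eq_of_isCompl {K E : Type*} [Field K] [AddCommGroup E] [Module K E]
    [Fact (Module.finrank K E = 2)] {A B : Submodule K E} (hB : B ≠ ⊥) (hAB : IsCompl A B)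
    {v w : E} (hv : v ∈ A) (hv0 : v ≠ 0) (hw : w ∈ A) : ∃ c : K, c • v = w := by
  have := FiniteDimensional.of_fact_finrank_eq_two (K := K) (V := E)
  have hsum := Submodule.finrank_add_eq_of_isCompl hAB
  rw [Fact.out (p := Module.finrank K E = 2)] at hsum
  have hA1 : 1 ≤ Module.finrank K A :=
    Submodule.one_le_finrank_iff.2 (Submodule.ne_bot_iff A |>.2 ⟨v, hv, hv0⟩)
  have hB1 : 1 ≤ Module.finrank K B := Submodule.one_le_finrank_iff.2 hB
  have hA : Module.finrank K A = 1 := by omega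
  obtain ⟨c, hc⟩ := exists_smul_eq_of_finrank_eq_one hA (x := (⟨v, hv⟩ : A)) (by simpa using hv0)
    ⟨w, hw⟩
  exact ⟨c, congrArg Subtype.val hc⟩

theorem norm_iteratedFDeriv_fderiv_sub {E G : Type*} [NormedAddCommGroup E] [NormedSpace ℝ E]
    [NormedAddCommGroup G] [NormedSpace ℝ G] (f : E → G) (k : ℕ) (x y : E) :
    ‖iteratedFDeriv ℝ k (fderiv ℝ f) x - iteratedFDeriv ℝ k (fderiv ℝ f) y‖ =
      ‖iteratedFDeriv ℝ (k + 1) f x - iteratedFDeriv ℝ (k + 1) f y‖ := by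
  simp only [iteratedFDeriv_succ_eq_comp_right, Function.comp_apply, ← dist_eq_norm,
    LinearIsometryEquiv.dist_map]

theorem exists_lift_flow {V : Torus2 → Plane} {φ : Flow ℝ Torus2} (hφ : IsFlowGeneratedBy φ V)
    (hV : ContDiff ℝ 1 fun p => V (torusProj p)) :
    ∃ Φ : Flow ℝ Plane, IsC1Flow (fun p => V (torusProj p)) Φ ∧
      ∀ s p, torusProj (Φ s p) = φ s (torusProj p) := by
  choose γ hγ using hφ
  obtain ⟨L, hL⟩ := (latticePeriodic_comp_torusProj V).fderiv.exists_norm_le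
    (hV.continuous_fderiv one_ne_zero)
  have hLip : LipschitzWith L.toNNReal fun p => V (torusProj p) :=
    lipschitzWith_of_nnnorm_fderiv_le (hV.differentiable one_ne_zero) fun p =>
      NNReal.le_toNNReal_of_coe_le (hL p)
  let Ψ : ℝ → Plane → Plane := fun s p => γ (torusProj p) s - γ (torusProj p) 0 + p
  have hproj : ∀ s p, torusProj (Ψ s p) = φ s (torusProj p) := fun s p => by
    rw [torusProj_add, torusProj_sub, (hγ _ s).1, (hγ _ 0).1, φ.map_zero_apply, sub_add_cancel]
  have hΨ : ∀ p s, HasDerivAt (fun s => Ψ s p) (V (torusProj (Ψ s p))) s := fun p s => by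
    rw [hproj]
    exact ((hγ (torusProj p) s).2.sub_const _).add_const _
  obtain ⟨Φ, hΦ⟩ := exists_flow_of_hasDerivAt hLip (fun p => by simp [Ψ]) hΨ
  exact ⟨Φ, ⟨hV, ⟨_, hLip⟩, by simpa only [hΦ] using hΨ⟩, by simpa only [hΦ] using hproj⟩

instance fact_finrank_plane : Fact (Module.finrank ℝ Plane = 2) := ⟨finrank_euclideanSpace_fin⟩

theorem IsHolderClass.exists_norm_iteratedFDeriv_sub_le {E G : Type*} [NormedAddCommGroup E]
    [NormedSpace ℝ E] [NormedAddCommGroup G] [NormedSpace ℝ G] {r : ℝ} (hr : 1 ≤ r) {f : E → G}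
    (hf : IsHolderClass r f) : ContDiff ℝ (⌊r - 1⌋₊ + 1 : ℕ) f ∧ ∃ K, ∀ x y,
      ‖iteratedFDeriv ℝ (⌊r - 1⌋₊ + 1) f x - iteratedFDeriv ℝ (⌊r - 1⌋₊ + 1) f y‖ ≤
        K * ‖x - y‖ ^ (r - 1 - ⌊r - 1⌋₊) := by
  have hfloor : ⌊r⌋₊ = ⌊r - 1⌋₊ + 1 := by
    rw [← Nat.floor_add_one (sub_nonneg.2 hr), sub_add_cancel]
  have hexponent : r - ⌊r⌋₊ = r - 1 - ⌊r - 1⌋₊ := by rw [hfloor]; push_cast; ring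
  rwa [IsHolderClass, hexponent, hfloor] at hf

variable {f : Torus2 → Torus2} {T : Plane → Plane}

theorem torusProj_iterate (hT : ∀ p, torusProj (T p) = f (torusProj p)) (n : ℕ) (p : Plane) :
    torusProj (T^[n] p) = f^[n] (torusProj p) :=
  Function.Semiconj.iterate_right (f := torusProj) hT n p

theorem hasTorusFDerivAt_iterate (hT : ∀ p, torusProj (T p) = f (torusProj p))
    (hTc : ContDiff ℝ 1 T) (n : ℕ) (p : Plane) :
    HasTorusFDerivAt f^[n] (fderiv ℝ T^[n] p) (torusProj p) :=
  ⟨p, T^[n], rfl, Eventually.of_forall (torusProj_iterate hT n),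
    ((contDiff_iterate hTc n).differentiable one_ne_zero p).hasFDerivAt⟩

theorem hasTorusFDerivAt_lift (hT : ∀ p, torusProj (T p) = f (torusProj p))
    (hTc : ContDiff ℝ 1 T) (p : Plane) : HasTorusFDerivAt f (fderiv ℝ T p) (torusProj p) :=
  hasTorusFDerivAt_iterate hT hTc 1 p

theorem exists_norm_le_of_continuous_norm {G : Type*} [NormedAddCommGroup G] {V : Torus2 → G}
    (hV : Continuous fun p => ‖V (torusProj p)‖) : ∃ M, ∀ p, ‖V (torusProj p)‖ ≤ M := by
  simpa only [norm_norm] using (latticePeriodic_comp_torusProj fun x => ‖V x‖).exists_norm_le hV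

theorem exists_le_norm_of_continuous_norm {G : Type*} [NormedAddCommGroup G] {V : Torus2 → G}
    (hV : Continuous fun p => ‖V (torusProj p)‖) (hV0 : ∀ x, V x ≠ 0) :
    ∃ c > 0, ∀ p, c ≤ ‖V (torusProj p)‖ := by
  obtain ⟨B, hB⟩ := (latticePeriodic_comp_torusProj fun x => ‖V x‖⁻¹).exists_norm_le
    (hV.inv₀ fun p => norm_ne_zero_iff.2 (hV0 _))
  simp only [norm_inv, norm_norm] at hB
  have hpos : ∀ p, 0 < ‖V (torusProj p)‖ := fun p => norm_pos_iff.2 (hV0 _)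
  exact ⟨B⁻¹, inv_pos.2 ((inv_pos.2 (hpos 0)).trans_le (hB 0)), fun p =>
    inv_le_of_inv_le₀ (hpos p) (hB p)⟩

namespace IsAnosov

variable {r : ℝ} {F : Torus2 ≃ Torus2} {Es Eu : Torus2 → Submodule ℝ Plane} {V : Torus2 → Plane}

theorem preservesDirection (hF : IsAnosov r F Es Eu)
    (hT : ∀ p, torusProj (T p) = F (torusProj p)) (hTc : ContDiff ℝ 1 T)
    (hV0 : ∀ x, V x ≠ 0) (hVs : ∀ x, V x ∈ Es x) :
    PreservesDirection (fun p => V (torusProj p)) T := fun p => by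
  have hmem : fderiv ℝ T p (V (torusProj p)) ∈ Es (torusProj (T p)) := by
    rw [hT, ← hF.map_stable _ _ (hasTorusFDerivAt_lift hT hTc p)]
    exact Submodule.mem_map_of_mem (hVs _)
  obtain ⟨a, ha⟩ := exists_smul_eq_of_isCompl (hF.unstable_ne_bot _) (hF.isCompl _) (hVs _)
    (hV0 _) hmem
  rw [speedFactor_eq_of_fderiv_eq_smul (hV0 _) ha.symm, ha]

theorem isContractedField (hF : IsAnosov r F Es Eu)
    (hT : ∀ p, torusProj (T p) = F (torusProj p)) (hTc : ContDiff ℝ 1 T)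
    (hVc : Continuous fun p => ‖V (torusProj p)‖) (hV0 : ∀ x, V x ≠ 0) (hVs : ∀ x, V x ∈ Es x) :
    IsContractedField (fun p => V (torusProj p)) T (fun p => Eu (torusProj p)) where
  exists_norm_le := exists_norm_le_of_continuous_norm hVc
  exists_le_norm := exists_le_norm_of_continuous_norm hVc hV0
  contDiff_map := hTc
  exists_norm_fderiv_map_le := (latticePeriodic_fderiv_of_lift hT hTc.continuous).exists_norm_le
    (hTc.continuous_fderiv one_ne_zero)
  preservesDirection := hF.preservesDirection hT hTc hV0 hVs
  unstable_ne_bot p := hF.unstable_ne_bot _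
  fderiv_mem_unstable p u hu := by
    rw [hT, ← hF.map_unstable _ _ (hasTorusFDerivAt_lift hT hTc p)]
    exact Submodule.mem_map_of_mem hu
  hyperbolic := by
    obtain ⟨C, lam, hC, hlam, hyp⟩ := hF.hyperbolic
    refine ⟨C, lam, hC, hlam, fun n p => ?_⟩
    obtain ⟨hstable, hunstable⟩ := hyp n _ _ (hasTorusFDerivAt_iterate hT hTc n p)
    exact ⟨hstable _ (hVs _), hunstable⟩

theorem exists_isContractedFlow (hr : 1 ≤ r) (hF : IsAnosov r F Es Eu)
    (hVnorm : IsTorusHolderFun r fun x => ‖V x‖) (hV0 : ∀ x, V x ≠ 0) (hVs : ∀ x, V x ∈ Es x)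
    (o : Orientation ℝ Plane (Fin 2)) {Φ : Flow ℝ Plane}
    (hΦ : IsC1Flow (fun p => V (torusProj p)) Φ) :
    ∃ T, IsContractedFlow o (fun p => V (torusProj p)) T Φ (r - 1 - ⌊r - 1⌋₊) ⌊r - 1⌋₊ := by
  obtain ⟨T, hT, hTr⟩ := hF.smooth
  obtain ⟨hTk, K, hK⟩ := hTr.exists_norm_iteratedFDeriv_sub_le hr
  obtain ⟨hVk, K', hK'⟩ := IsHolderClass.exists_norm_iteratedFDeriv_sub_le hr hVnorm
  have hTc : ContDiff ℝ 1 T := hTk.of_le (by norm_cast; omega)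
  have hη : r - 1 - ⌊r - 1⌋₊ ∈ Icc (0 : ℝ) 1 :=
    ⟨sub_nonneg.2 (Nat.floor_le (sub_nonneg.2 hr)),
      sub_le_iff_le_add'.2 (Nat.lt_floor_add_one (r - 1)).le⟩
  refine ⟨T, (hF.isContractedField hT hTc hVk.continuous hV0 hVs).isContractedFlow o hΦ hη ?_
    ((latticePeriodic_comp_torusProj fun x => ‖V x‖).isUniformHolder hVk hK')⟩
  exact (latticePeriodic_fderiv_of_lift hT hTc.continuous).isUniformHolder
    (hTk.fderiv_right (by norm_cast)) fun x y =>
      (norm_iteratedFDeriv_fderiv_sub T _ x y).trans_le (hK x y)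

end IsAnosov

end AnosovLift

theorem lemma4p1_general (r : ℝ) (hr : 1 ≤ r)
    (F : Torus2 ≃ Torus2) (Es Eu : Torus2 → Submodule ℝ Plane) (hF : IsAnosov r F Es Eu)
    (V : Torus2 → Plane) (hV : ContDiff ℝ 1 fun p => V (torusProj p))
    (hVnorm : IsTorusHolderFun r (fun x => ‖V x‖))
    (hV0 : ∀ x, V x ≠ 0) (hVs : ∀ x, V x ∈ Es x)
    (φ : Flow ℝ Torus2) (hφ : IsFlowGeneratedBy φ V) :
    ∃ C β : ℝ, 0 < C ∧ 0 < β ∧ ∀ x : Torus2, ∃ ξ : ℝ → (Plane →L[ℝ] Plane),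
      (∀ s, HasTorusFDerivAt (φ s) (ξ s) x ∧ IsUnit (ξ s)) ∧
      ∀ t : ℝ, 0 < t →
        ContDiffOn ℝ (⌊r - 1⌋₊ : ℕ) ξ (Set.Ioo 0 t) ∧
        holderNormOn (r - 1) (Set.Ioo 0 t) ξ ≤ ENNReal.ofReal (C * max 1 t ^ β) := by
  let o : Orientation ℝ Plane (Fin 2) := (EuclideanSpace.basisFun (Fin 2) ℝ).toBasis.orientation
  obtain ⟨Φ, hΦ, hproj⟩ := exists_lift_flow hφ hV
  obtain ⟨T, hT⟩ := hF.exists_isContractedFlow hr hVnorm hV0 hVs o hΦ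
  obtain ⟨C, β, hC, hβ, hbound⟩ := hT.hasHolderPolynomialGrowth_flowDeriv.exists_holderNormOn_le
  refine ⟨C, β, hC, hβ, fun x => ?_⟩
  obtain ⟨p, rfl⟩ := torusProj_surjective x
  exact ⟨flowDeriv o _ Φ p, fun s =>
    ⟨⟨p, Φ s, rfl, .of_forall (hproj s), hΦ.hasFDerivAt_flowDeriv o (fun _ => hV0 _) p s⟩,
      isUnit_flowDeriv o (fun _ => hV0 _) p s⟩, fun t _ => hbound p t⟩

theorem lemma4p1 (α r : ℝ) (hα : 0 < α) (hr : 1 + α < r)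
    (F : Torus2 ≃ Torus2) (Es Eu : Torus2 → Submodule ℝ Plane) (hF : IsAnosov r F Es Eu)
    (V : Torus2 → Plane) (hV : IsTorusHolderFun (1 + α) V)
    (hVnorm : IsTorusHolderFun r (fun x => ‖V x‖))
    (hV0 : ∀ x, V x ≠ 0) (hVs : ∀ x, V x ∈ Es x)
    (φ : Flow ℝ Torus2) (hφ : IsFlowGeneratedBy φ V) :
    ∃ C β : ℝ, 0 < C ∧ 0 < β ∧ ∀ x : Torus2, ∃ ξ : ℝ → (Plane →L[ℝ] Plane),
      (∀ s, HasTorusFDerivAt (φ s) (ξ s) x ∧ IsUnit (ξ s)) ∧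
      ∀ t : ℝ, 0 < t →
        ContDiffOn ℝ (⌊r - 1⌋₊ : ℕ) ξ (Set.Ioo 0 t) ∧
        holderNormOn (r - 1) (Set.Ioo 0 t) ξ ≤ ENNReal.ofReal (C * max 1 t ^ β) := by
  have hV1 : 1 ≤ ⌊1 + α⌋₊ := Nat.le_floor (by push_cast; linarith)
  exact lemma4p1_general r (by linarith) F Es Eu hF V (hV.1.of_le (by exact_mod_cast hV1)) hVnorm
    hV0 hVs φ hφ
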